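/- **Theorem 4.** Let $X$ be a topological space and let $G$ be a local coefficient system (bundle of abelian groups) on $X$, i.e. a functor from the fundamental groupoid of $X$ to abelian groups. Let $\Delta^k=\langle e_0,\dots,e_k\rangle$ be the standard $k$-simplex. Singular chains and cochains with coefficients in $G$ are $$S_k(X;G)=\bigoplus_{\sigma:\Delta^k\to X}G(\sigma(e_0)),\qquad S^k(X;G)=\prod_{\sigma:\Delta^k\to X}G(\sigma(e_0)),$$ with $$\partial(g\sigma)=(\sigma_{01}g)\,\sigma_0+\sum_{i=1}^{k}(-1)^i g\,\sigma_i\quad(k\ge 1),\qquad (-1)^k(\delta c)(\sigma)=\sigma_{01}^{-1}c(\sigma_0)+\sum_{i=1}^{k+1}(-1)^i c(\sigma_i)$$ for $\sigma:\Delta^k\to X$, $g\in G(\sigma(e_0))$ in the first formula and $c\in S^k(X;G)$, $\sigma:\Delta^{k+1}\to X$ in the second. Here $\sigma_i$ is the restriction of $\sigma$ to the face opposite $e_i$, and $\sigma_{01}:G(\sigma(e_0))\to G(\sigma(e_1))$ is the isomorphism induced by $\sigma$ restricted to the edge from $e_0$ to $e_1$. Their (co)homology groups are $H_*(X;G)$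 and $H^*(X;G)$. For continuous $f:Y\to X$, let $f^*G$ be the pullback of $G$; the (co)chain maps $g\sigma\mapsto g(f\circ\sigma)$ and $c\mapsto(\sigma\mapsto c(f\circ\sigma))$ induce $f_*:H_*(Y;f^*G)\to H_*(X;G)$ and $f^*:H^*(X;G)\to H^*(Y;f^*G)$. Let $SX$ be the singular complex of $X$: the quotient space of the disjoint union of one $k$-simplex for each $k\ge 0$ and each continuous map $\sigma:\Delta^k\to X$, in which the $i$-th face of the simplex of $\sigma$ is glued to the simplex of $\sigma_i$, for all $\sigma$ and $i$. Let $I_X:SX\to X$ be the canonical map, equal to $\sigma$ on the simplex indexed by $\sigma$. Then $$I_{X*}:H_n(SX;I_X^*G)\to H_n(X;G)\qquad\text{and}\qquad I_X^*:H^n(X;G)\to H^n(SX;I_X^*G)$$ are isomorphisms for every $n\ge 0$. -/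

import Mathlib

open CategoryTheory

universe u v

noncomputable section

namespace LocalCoeff

/-! ### Standard simplices -/

/-- The standard topological `k`-simplex `Δ^k = ⟨e_0, …, e_k⟩`. -/
abbrev Simplex (k : ℕ) : Type := stdSimplex ℝ (Fin (k + 1))

/-- The leading vertex `e_0` of `Δ^k`. -/
def e₀ (k : ℕ) : Simplex k := stdSimplex.vertex 0

/-- The inclusion of the face of `Δ^{k+1}` opposite to the vertex `e_i`. -/
def face {k : ℕ} (i : Fin (k + 2)) : C(Simplex k, Simplex (k + 1)) :=
  ⟨stdSimplex.map i.succAbove, stdSimplex.continuous_map _⟩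

/-- The straight path from `a` to `b` in `Δ^k`. -/
def straightPath {k : ℕ} (a b : Simplex k) : Path a b where
  toFun t := ⟨AffineMap.lineMap a.1 b.1 (t : ℝ),
    (convex_stdSimplex ℝ _).lineMap_mem a.2 b.2 t.2⟩
  continuous_toFun := by
    refine Continuous.subtype_mk ?_ _
    simp only [AffineMap.lineMap_apply]
    fun_prop
  source' := by simp
  target' := by simp

/-- The class of the straight path from `a` to `b` in the fundamental groupoid of `Δ^k`. -/
def straightClass {k : ℕ} (a b : Simplex k) :
    (⟨a⟩ : FundamentalGroupoid (Simplex k)) ⟶ ⟨b⟩ :=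
  Path.Homotopic.Quotient.mk (straightPath a b)

instance (k : ℕ) : ContractibleSpace (Simplex k) :=
  (convex_stdSimplex ℝ (Fin (k + 1))).contractibleSpace ⟨_, (e₀ k).2⟩

lemma hom_ext_simplex {k : ℕ} {a b : FundamentalGroupoid (Simplex k)} (p q : a ⟶ b) : p = q :=
  Subsingleton.elim (α := Path.Homotopic.Quotient a.as b.as) p q

lemma face_e₀_of_ne_zero {k : ℕ} {i : Fin (k + 2)} (hi : i ≠ 0) : face i (e₀ k) = e₀ (k + 1) := by
  simp [face, e₀, Fin.succAbove_ne_zero_zero hi]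

lemma face_zero_e₀ {k : ℕ} : face 0 (e₀ k) = (stdSimplex.vertex 1 : Simplex (k + 1)) := by
  simp [face, e₀]

lemma face_comp_face {k : ℕ} {i j : Fin (k + 2)} (h : i ≤ j) :
    (face j.succ).comp (face (k := k) i) = (face i.castSucc).comp (face j) := by
  ext1 x
  simp only [face, ContinuousMap.comp_apply, ContinuousMap.coe_mk, stdSimplex.map_comp_apply]
  congr 1
  have := SimplexCategory.δ_comp_δ h
  funext y
  exact congrArg (fun f => f.toOrderHom y) this

/-! ### Local coefficient systems -/

/-- A local coefficient system (bundle of abelian groups) on `X`: a functor from the fundamental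
groupoid of `X` to abelian groups. A path from `x` to `y` acts by an isomorphism
`G(x) → G(y)`. -/
abbrev CoefficientSystem (X : Type u) [TopologicalSpace X] :=
  FundamentalGroupoid X ⥤ AddCommGrpCat.{v}

variable {X : Type u} [TopologicalSpace X] {Y : Type u} [TopologicalSpace Y]
  {Z : Type u} [TopologicalSpace Z]

/-- The pullback `f^* G` of a local coefficient system along a continuous map. -/
abbrev CoefficientSystem.pullback (f : C(X, Y)) (G : CoefficientSystem.{u, v} Y) :
    CoefficientSystem.{u, v} X :=
  FundamentalGroupoid.map f ⋙ G

/-- The group `G(σ(e_0))` attached to a singular simplex `σ`. -/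
abbrev coeffAt (G : CoefficientSystem.{u, v} X) {k : ℕ} (σ : C(Simplex k, X)) :
    AddCommGrpCat.{v} :=
  G.obj ⟨σ (e₀ k)⟩

/-- The isomorphism `G(σ(a)) → G(σ(b))` given by `σ` composed with the straight path from `a`
to `b`. -/
def transport (G : CoefficientSystem.{u, v} X) {k : ℕ} (σ : C(Simplex k, X)) (a b : Simplex k) :
    G.obj ⟨σ a⟩ ⟶ G.obj ⟨σ b⟩ :=
  G.map ((FundamentalGroupoid.map σ).map (straightClass a b))

/-- The `i`-th face `σ_i` of a singular simplex. -/
abbrev simplexFace {k : ℕ} (σ : C(Simplex (k + 1), X)) (i : Fin (k + 2)) : C(Simplex k, X) :=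
  σ.comp (face i)

lemma transport_self (G : CoefficientSystem.{u, v} X) {k : ℕ} (σ : C(Simplex k, X))
    (a : Simplex k) : transport G σ a a = 𝟙 _ := by
  rw [transport, hom_ext_simplex (straightClass a a) (𝟙 _), CategoryTheory.Functor.map_id]
  exact G.map_id _

lemma transport_trans (G : CoefficientSystem.{u, v} X) {k : ℕ} (σ : C(Simplex k, X))
    (a b c : Simplex k) : transport G σ a b ≫ transport G σ b c = transport G σ a c := by
  rw [transport, transport, transport,
    hom_ext_simplex (straightClass a c) (straightClass a b ≫ straightClass b c),
    CategoryTheory.Functor.map_comp]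
  exact (G.map_comp _ _).symm

lemma transport_face (G : CoefficientSystem.{u, v} X) {k : ℕ} (σ : C(Simplex (k + 1), X))
    (i : Fin (k + 2)) (a b : Simplex k) :
    transport G (simplexFace σ i) a b = transport G σ (face i a) (face i b) := by
  rw [transport, transport, hom_ext_simplex (straightClass (face i a) (face i b))
    ((FundamentalGroupoid.map (face i)).map (straightClass a b))]
  rfl

lemma transport_pullback (f : C(X, Y)) (G : CoefficientSystem.{u, v} Y) {k : ℕ}
    (σ : C(Simplex k, X)) (a b : Simplex k) :
    transport (CoefficientSystem.pullback f G) σ a b = transport G (f.comp σ) a b := rfl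

/-- The transport `G(σ(e_0)) → G(σ_i(e_0))`. For `i = 0` it is the isomorphism induced by the
edge of `σ` from `e_0` to `e_1`; for `i ≠ 0` it is the identity (`toFace_of_ne_zero`). -/
def toFace (G : CoefficientSystem.{u, v} X) {k : ℕ} (σ : C(Simplex (k + 1), X))
    (i : Fin (k + 2)) : coeffAt G σ ⟶ coeffAt G (simplexFace σ i) :=
  transport G σ (e₀ (k + 1)) (face i (e₀ k))

/-- The transport `G(σ_i(e_0)) → G(σ(e_0))`, inverse to `toFace`. -/
def ofFace (G : CoefficientSystem.{u, v} X) {k : ℕ} (σ : C(Simplex (k + 1), X))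
    (i : Fin (k + 2)) : coeffAt G (simplexFace σ i) ⟶ coeffAt G σ :=
  transport G σ (face i (e₀ k)) (e₀ (k + 1))

lemma transport_of_eq (G : CoefficientSystem.{u, v} X) {k : ℕ} (σ : C(Simplex k, X))
    {a b : Simplex k} (h : a = b) : transport G σ a b = eqToHom (by rw [h]) := by
  subst h
  simpa using transport_self G σ a

lemma toFace_of_ne_zero (G : CoefficientSystem.{u, v} X) {k : ℕ} (σ : C(Simplex (k + 1), X))
    {i : Fin (k + 2)} (hi : i ≠ 0) :
    toFace G σ i = eqToHom (by simp [coeffAt, face_e₀_of_ne_zero hi]) :=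
  transport_of_eq G σ (face_e₀_of_ne_zero hi).symm

lemma ofFace_of_ne_zero (G : CoefficientSystem.{u, v} X) {k : ℕ} (σ : C(Simplex (k + 1), X))
    {i : Fin (k + 2)} (hi : i ≠ 0) :
    ofFace G σ i = eqToHom (by simp [coeffAt, face_e₀_of_ne_zero hi]) :=
  transport_of_eq G σ (face_e₀_of_ne_zero hi)

lemma toFace_ofFace (G : CoefficientSystem.{u, v} X) {k : ℕ} (σ : C(Simplex (k + 1), X))
    (i : Fin (k + 2)) : toFace G σ i ≫ ofFace G σ i = 𝟙 _ := by
  rw [toFace, ofFace, transport_trans, transport_self]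

/-! ### Singular chains and cochains -/

/-- The alternating double sum over iterated faces vanishes. -/
lemma alternating_sum_eq_zero {A : Type*} [AddCommGroup A] {k : ℕ}
    (f : Fin (k + 3) → Fin (k + 2) → A)
    (hf : ∀ i j : Fin (k + 2), i ≤ j → f j.succ i = f i.castSucc j) :
    ∑ j : Fin (k + 3), ∑ i : Fin (k + 2), ((-1 : ℤ) ^ (j : ℕ) * (-1 : ℤ) ^ (i : ℕ)) • f j i = 0 := by
  rw [← Finset.sum_product', Finset.univ_product_univ]
  let S : Finset (Fin (k + 3) × Fin (k + 2)) := {p | (p.1 : ℕ) ≤ (p.2 : ℕ)}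
  rw [← Finset.sum_add_sum_compl S, ← eq_neg_iff_add_eq_zero, ← Finset.sum_neg_distrib]
  refine Finset.sum_bij (fun p hp => (p.2.succ,
    Fin.castLT p.1 (lt_of_le_of_lt (Finset.mem_filter.mp hp).right p.2.is_lt))) ?_ ?_ ?_ ?_
  · intro p hp
    simp only [S, Finset.compl_filter, Finset.mem_filter_univ, Fin.val_succ, Fin.val_castLT]
      at hp ⊢
    omega
  · rintro ⟨i, j⟩ hp ⟨i', j'⟩ hp' h
    simp only [Prod.mk.injEq, Fin.ext_iff, Fin.val_castLT, Fin.val_succ] at h ⊢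
    omega
  · rintro ⟨i', j'⟩ hp
    simp only [S, Finset.compl_filter, Finset.mem_filter_univ, not_le] at hp
    refine ⟨(j'.castSucc, i'.pred ?_), ?_, ?_⟩
    · rintro rfl
      simp at hp
    · simp [S]
      omega
    · simp
  · rintro ⟨i, j⟩ hp
    have hle : (i : ℕ) ≤ j := by simpa [S] using hp
    have hi : (i : ℕ) < k + 2 := lt_of_le_of_lt hle j.is_lt
    have key := hf (i.castLT hi) j hle
    rw [Fin.castSucc_castLT] at key
    dsimp only
    rw [key, ← neg_smul]
    congr 1
    simp only [Fin.val_succ, Fin.val_castLT, pow_succ]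
    ring

open scoped Classical DirectSum

/-- Singular `k`-chains `S_k(X; G) = ⨁_σ G(σ(e_0))`. -/
abbrev Chains (G : CoefficientSystem.{u, v} X) (k : ℕ) : Type (max u v) :=
  ⨁ σ : C(Simplex k, X), coeffAt G σ

/-- Singular `k`-cochains `S^k(X; G) = ∏_σ G(σ(e_0))`. -/
abbrev Cochains (G : CoefficientSystem.{u, v} X) (k : ℕ) : Type (max u v) :=
  ∀ σ : C(Simplex k, X), coeffAt G σ

/-- The elementary chain `g σ`. -/
abbrev single (G : CoefficientSystem.{u, v} X) {k : ℕ} (σ : C(Simplex k, X)) :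
    coeffAt G σ →+ Chains G k :=
  DirectSum.of (fun σ : C(Simplex k, X) => (coeffAt G σ : Type v)) σ

/-- The boundary `∂(g σ) = ∑_i (-1)^i g σ_i`, where `g` is moved to `G(σ_0(e_0))` along the edge
of `σ` from `e_0` to `e_1` in the term `i = 0`. -/
def boundary (G : CoefficientSystem.{u, v} X) (k : ℕ) : Chains G (k + 1) →+ Chains G k :=
  DirectSum.toAddMonoid fun σ =>
    ∑ i : Fin (k + 2), (-1 : ℤ) ^ (i : ℕ) •
      (single G (simplexFace σ i)).comp (toFace G σ i).hom

/-- The coboundary `(δ c)(σ) = (-1)^k ∑_i (-1)^i c(σ_i)` of a `k`-cochain, where `c(σ_0)` is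
moved back to `G(σ(e_0))` along the edge of `σ` from `e_1` to `e_0`. -/
def coboundary (G : CoefficientSystem.{u, v} X) (k : ℕ) : Cochains G k →+ Cochains G (k + 1) :=
  AddMonoidHom.pi fun σ =>
    (-1 : ℤ) ^ k • ∑ i : Fin (k + 2), (-1 : ℤ) ^ (i : ℕ) •
      (ofFace G σ i).hom.comp (Pi.evalAddMonoidHom _ (simplexFace σ i))

lemma boundary_single (G : CoefficientSystem.{u, v} X) (k : ℕ) (σ : C(Simplex (k + 1), X))
    (g : coeffAt G σ) :
    boundary G k (single G σ g) =
      ∑ i : Fin (k + 2), (-1 : ℤ) ^ (i : ℕ) • single G (simplexFace σ i) (toFace G σ i g) := by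
  simp [boundary]

lemma coboundary_apply (G : CoefficientSystem.{u, v} X) (k : ℕ) (c : Cochains G k)
    (σ : C(Simplex (k + 1), X)) :
    coboundary G k c σ = (-1 : ℤ) ^ k • ∑ i : Fin (k + 2), (-1 : ℤ) ^ (i : ℕ) •
      ofFace G σ i (c (simplexFace σ i)) := by
  change ((-1 : ℤ) ^ k • ∑ i : Fin (k + 2), (-1 : ℤ) ^ (i : ℕ) •
      (ofFace G σ i).hom.comp (Pi.evalAddMonoidHom (fun τ : C(Simplex k, X) =>
        (coeffAt G τ : Type v)) (simplexFace σ i))) c = _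
  simp

lemma single_transport_congr (G : CoefficientSystem.{u, v} X) {k l : ℕ} (σ : C(Simplex l, X))
    {θ θ' : C(Simplex k, Simplex l)} (h : θ = θ') (g : coeffAt G σ) :
    single G (σ.comp θ) (transport G σ (e₀ l) (θ (e₀ k)) g) =
      single G (σ.comp θ') (transport G σ (e₀ l) (θ' (e₀ k)) g) := by
  subst h; rfl

lemma transport_apply_congr (G : CoefficientSystem.{u, v} X) {k l : ℕ} (σ : C(Simplex l, X))
    {θ θ' : C(Simplex k, Simplex l)} (h : θ = θ') (c : Cochains G k) :
    transport G σ (θ (e₀ k)) (e₀ l) (c (σ.comp θ)) =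
      transport G σ (θ' (e₀ k)) (e₀ l) (c (σ.comp θ')) := by
  subst h; rfl

lemma toFace_toFace (G : CoefficientSystem.{u, v} X) {k : ℕ} (σ : C(Simplex (k + 2), X))
    (j : Fin (k + 3)) (i : Fin (k + 2)) :
    toFace G σ j ≫ toFace G (simplexFace σ j) i =
      transport G σ (e₀ (k + 2)) (((face j).comp (face i)) (e₀ k)) := by
  rw [toFace, toFace, transport_face]
  exact transport_trans G σ _ _ _

lemma ofFace_ofFace (G : CoefficientSystem.{u, v} X) {k : ℕ} (σ : C(Simplex (k + 2), X))
    (j : Fin (k + 3)) (i : Fin (k + 2)) :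
    ofFace G (simplexFace σ j) i ≫ ofFace G σ j =
      transport G σ (((face j).comp (face i)) (e₀ k)) (e₀ (k + 2)) := by
  rw [ofFace, ofFace, transport_face]
  exact transport_trans G σ _ _ _

lemma boundary_boundary (G : CoefficientSystem.{u, v} X) (k : ℕ) :
    (boundary G k).comp (boundary G (k + 1)) = 0 := by
  refine DirectSum.addHom_ext' fun σ => ?_
  refine AddMonoidHom.ext fun g => ?_
  have h1 : ∀ (j : Fin (k + 3)) (i : Fin (k + 2)),
      single G (simplexFace (simplexFace σ j) i)
        (toFace G (simplexFace σ j) i (toFace G σ j g)) =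
      single G (σ.comp ((face j).comp (face i)))
        (transport G σ (e₀ (k + 2)) (((face j).comp (face i)) (e₀ k)) g) := fun j i => by
    rw [← toFace_toFace]; rfl
  have h2 := alternating_sum_eq_zero (fun (j : Fin (k + 3)) (i : Fin (k + 2)) =>
      single G (σ.comp ((face j).comp (face i)))
        (transport G σ (e₀ (k + 2)) (((face j).comp (face i)) (e₀ k)) g))
      (fun i j h => single_transport_congr G σ (face_comp_face h) g)
  change boundary G k (boundary G (k + 1) (single G σ g)) = 0
  rw [boundary_single, map_sum, ← h2]
  refine Finset.sum_congr rfl fun j _ => ?_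
  rw [map_zsmul, boundary_single, Finset.smul_sum]
  refine Finset.sum_congr rfl fun i _ => ?_
  rw [h1, smul_smul]

lemma coboundary_coboundary (G : CoefficientSystem.{u, v} X) (k : ℕ) :
    (coboundary G (k + 1)).comp (coboundary G k) = 0 := by
  refine AddMonoidHom.ext fun c => funext fun σ => ?_
  have h1 : ∀ (j : Fin (k + 3)) (i : Fin (k + 2)),
      ofFace G σ j (ofFace G (simplexFace σ j) i (c (simplexFace (simplexFace σ j) i))) =
      transport G σ (((face j).comp (face i)) (e₀ k)) (e₀ (k + 2))
        (c (σ.comp ((face j).comp (face i)))) := fun j i => by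
    rw [← ofFace_ofFace]; rfl
  have h2 := alternating_sum_eq_zero (fun (j : Fin (k + 3)) (i : Fin (k + 2)) =>
      transport G σ (((face j).comp (face i)) (e₀ k)) (e₀ (k + 2))
        (c (σ.comp ((face j).comp (face i)))))
      (fun i j h => transport_apply_congr G σ (face_comp_face h) c)
  change coboundary G (k + 1) (coboundary G k c) σ = 0
  have h3 : ∑ j : Fin (k + 3), (-1 : ℤ) ^ (j : ℕ) •
      ofFace G σ j (coboundary G k c (simplexFace σ j)) = (-1 : ℤ) ^ k • (0 : coeffAt G σ) := by
    rw [← h2, Finset.smul_sum]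
    refine Finset.sum_congr rfl fun j _ => ?_
    rw [coboundary_apply, map_zsmul, map_sum, smul_comm, Finset.smul_sum]
    congr 1
    refine Finset.sum_congr rfl fun i _ => ?_
    rw [map_zsmul, h1, smul_smul]
  rw [coboundary_apply, h3, smul_zero, smul_zero]

/-- The singular chain complex `S_*(X; G)`. -/
def chainComplex (G : CoefficientSystem.{u, v} X) : ChainComplex AddCommGrpCat.{max u v} ℕ :=
  ChainComplex.of (fun k => AddCommGrpCat.of (Chains G k))
    (fun k => AddCommGrpCat.ofHom (boundary G k))
    (fun k => by rw [← AddCommGrpCat.ofHom_comp, boundary_boundary]; rfl)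

/-- The singular cochain complex `S^*(X; G)`. -/
def cochainComplex (G : CoefficientSystem.{u, v} X) : CochainComplex AddCommGrpCat.{max u v} ℕ :=
  CochainComplex.of (fun k => AddCommGrpCat.of (Cochains G k))
    (fun k => AddCommGrpCat.ofHom (coboundary G k))
    (fun k => by rw [← AddCommGrpCat.ofHom_comp, coboundary_coboundary]; rfl)

lemma chainComplex_d (G : CoefficientSystem.{u, v} X) (k : ℕ) :
    (chainComplex G).d (k + 1) k = AddCommGrpCat.ofHom (boundary G k) :=
  ChainComplex.of_d (fun k => AddCommGrpCat.of (Chains G k))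
    (fun k => AddCommGrpCat.ofHom (boundary G k)) k

lemma cochainComplex_d (G : CoefficientSystem.{u, v} X) (k : ℕ) :
    (cochainComplex G).d k (k + 1) = AddCommGrpCat.ofHom (coboundary G k) :=
  CochainComplex.of_d (fun k => AddCommGrpCat.of (Cochains G k))
    (fun k => AddCommGrpCat.ofHom (coboundary G k)) k

/-! ### Functoriality -/

/-- The map `g σ ↦ g (f ∘ σ)` on chains. -/
def chainPush (f : C(X, Y)) (G : CoefficientSystem.{u, v} Y) (k : ℕ) :
    Chains (CoefficientSystem.pullback f G) k →+ Chains G k :=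
  DirectSum.toAddMonoid fun σ => single G (f.comp σ)

/-- The map `c ↦ (σ ↦ c (f ∘ σ))` on cochains. -/
def cochainPull (f : C(X, Y)) (G : CoefficientSystem.{u, v} Y) (k : ℕ) :
    Cochains G k →+ Cochains (CoefficientSystem.pullback f G) k :=
  AddMonoidHom.pi fun σ => Pi.evalAddMonoidHom (fun τ => (coeffAt G τ : Type v)) (f.comp σ)

lemma boundary_chainPush (f : C(X, Y)) (G : CoefficientSystem.{u, v} Y) (k : ℕ) :
    (boundary G k).comp (chainPush f G (k + 1)) =
      (chainPush f G k).comp (boundary (CoefficientSystem.pullback f G) k) := by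
  refine DirectSum.addHom_ext' fun σ => ?_
  refine AddMonoidHom.ext fun g => ?_
  have h (l : ℕ) (τ : C(Simplex l, X)) (x) : chainPush f G l (single _ τ x) =
      single G (f.comp τ) x := by
    exact DirectSum.toAddMonoid_of _ _ _
  change boundary G k (chainPush f G (k + 1) (single _ σ g)) =
    chainPush f G k (boundary _ k (single _ σ g))
  rw [boundary_single, map_sum]
  refine (congrArg (boundary G k) (h _ σ g)).trans
    ((boundary_single G k (f.comp σ) g).trans (Finset.sum_congr rfl fun i _ => ?_))
  rw [map_zsmul]
  exact congrArg _ (h k (simplexFace σ i) _).symm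

lemma coboundary_cochainPull (f : C(X, Y)) (G : CoefficientSystem.{u, v} Y) (k : ℕ) :
    (coboundary (CoefficientSystem.pullback f G) k).comp (cochainPull f G k) =
      (cochainPull f G (k + 1)).comp (coboundary G k) := by
  refine AddMonoidHom.ext fun c => funext fun σ => ?_
  change coboundary (CoefficientSystem.pullback f G) k (cochainPull f G k c) σ =
    coboundary G k c (f.comp σ)
  rw [coboundary_apply, coboundary_apply]
  rfl

/-- The chain map `f_# : S_*(X; f^*G) → S_*(Y; G)`. -/
def chainMap (f : C(X, Y)) (G : CoefficientSystem.{u, v} Y) :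
    chainComplex (CoefficientSystem.pullback f G) ⟶ chainComplex G :=
  ChainComplex.ofHom (fun k => AddCommGrpCat.ofHom (chainPush f G k)) fun k => by
    rw [chainComplex_d, chainComplex_d]
    exact congrArg AddCommGrpCat.ofHom (boundary_chainPush f G k)

/-- The cochain map `f^# : S^*(Y; G) → S^*(X; f^*G)`. -/
def cochainMap (f : C(X, Y)) (G : CoefficientSystem.{u, v} Y) :
    cochainComplex G ⟶ cochainComplex (CoefficientSystem.pullback f G) :=
  CochainComplex.ofHom (fun k => AddCommGrpCat.ofHom (cochainPull f G k)) fun k => by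
    rw [cochainComplex_d, cochainComplex_d]
    exact congrArg AddCommGrpCat.ofHom (coboundary_cochainPull f G k)

/-- Singular homology `H_n(X; G)`. -/
abbrev homology (G : CoefficientSystem.{u, v} X) (n : ℕ) : AddCommGrpCat.{max u v} :=
  (chainComplex G).homology n

/-- Singular cohomology `H^n(X; G)`. -/
abbrev cohomology (G : CoefficientSystem.{u, v} X) (n : ℕ) : AddCommGrpCat.{max u v} :=
  (cochainComplex G).homology n

/-- The induced map `f_* : H_n(X; f^*G) → H_n(Y; G)`. -/
abbrev homologyMap (f : C(X, Y)) (G : CoefficientSystem.{u, v} Y) (n : ℕ) :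
    homology (CoefficientSystem.pullback f G) n ⟶ homology G n :=
  HomologicalComplex.homologyMap (chainMap f G) n

/-- The induced map `f^* : H^n(Y; G) → H^n(X; f^*G)`. -/
abbrev cohomologyMap (f : C(X, Y)) (G : CoefficientSystem.{u, v} Y) (n : ℕ) :
    cohomology G n ⟶ cohomology (CoefficientSystem.pullback f G) n :=
  HomologicalComplex.homologyMap (cochainMap f G) n

/-! ### The singular complex -/

/-- The disjoint union of one copy of `Δ^k` for every `k` and every continuous `σ : Δ^k → X`
(the index set of pairs `(k, σ)` plays no topological role). -/
abbrev SimplexUnion (X : Type u) [TopologicalSpace X] : Type u :=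
  Σ s : (Σ k : ℕ, C(Simplex k, X)), Simplex s.1

/-- The gluing: the simplex of `σ_i` is identified with the `i`-th face of the simplex of `σ`. -/
inductive Glue (X : Type u) [TopologicalSpace X] : SimplexUnion X → SimplexUnion X → Prop
  | face {k : ℕ} (σ : C(Simplex (k + 1), X)) (i : Fin (k + 2)) (t : Simplex k) :
      Glue X ⟨⟨k + 1, σ⟩, face i t⟩ ⟨⟨k, simplexFace σ i⟩, t⟩

/-- The singular complex `S X`: the quotient space of `SimplexUnion X` by the equivalence
relation generated by `Glue X`. -/
def SingularComplex (X : Type u) [TopologicalSpace X] : Type u := Quot (Glue X)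

instance (X : Type u) [TopologicalSpace X] : TopologicalSpace (SingularComplex X) :=
  inferInstanceAs (TopologicalSpace (Quot (Glue X)))

/-- The canonical map `I_X : S X → X`, which is `σ` on the simplex indexed by `σ`. -/
def canonicalMap (X : Type u) [TopologicalSpace X] : C(SingularComplex X, X) where
  toFun := Quot.lift (fun p : SimplexUnion X => p.1.2 p.2) (by rintro _ _ ⟨σ, i, t⟩; rfl)
  continuous_toFun := continuous_quot_lift _ (continuous_sigma fun s => s.2.continuous)

end LocalCoeff

end

/-!
The canonical map `I : SX → X` has a section on the level of singular simplices: a singular simplex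
`σ` of `X` goes to its characteristic map `charMap σ : Δ^k → SX`, and `I ∘ charMap σ = σ`. Since
`charMap` commutes with faces, `σ ↦ charMap σ` gives a chain map `charChainMap` with
`charChainMap ≫ I_* = 𝟙`, and dually a cochain map `charCochainMap` with `I^* ≫ charCochainMap = 𝟙`.
It remains to see that the other composites induce the identity on homology and cohomology. They
come from the projection `cellular` that replaces a singular simplex `τ` of `SX` by the
characteristic map of `I ∘ τ`. So it suffices to find a chain homotopy from the identity to a chain
map whose values are combinations of characteristic maps.

In order to treat all coefficient systems, homology and cohomology at once, this is done for
`BasedChains`: combinations of pairs of a simplex `τ` of `SX` and a path class in `X` from a base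
point `x` to the image of the leading vertex of `τ`. An assignment of based chains to the singular
simplices of `SX` acts on the chains and on the cochains with values in any pullback `I^*G`
(`opChain`, `opCochain`). As the based chains are free over the fundamental groupoid, the homotopy
can be constructed by induction on the dimension
(`BasedChains.exists_homotopy_to_cellular`), once every cycle of based chains is known to be
homologous to a combination of characteristic maps (`BasedChains.IsCycle.exists_cellular_eq`).

To prove this for a cycle, subdivide it barycentrically until each of its simplices lies in a member
of the open cover of `SX` by the sets `near a`. The points of `near a` are moved into the cell of
`a` by `sharpenHomotopy`, which keeps every cell invariant and cuts off the small barycentric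
coordinates. So sharpening takes a simplex `τ` in `near a` to `charMap a ∘ ρ` for some
`ρ : Δ^k → Δ^m`, which is a chart of `τ` (`IsChart`). The simplex `charMap a ∘ ρ` is still not a
characteristic map. But `a` is the back face of the simplex `joinSimplex a ρ` of `X`, whose front
face `a ∘ (affine map with e_i ↦ ρ e_i)` has dimension `k`. In the cell of `joinSimplex a ρ`, the
map `ρ` into the back face slides along straight segments to the identity of the front face, which
is a characteristic map. Two charts of the same simplex differ by a face inclusion
(`IsChart.exists_face`), so the deformation depends only on `τ` and is compatible with faces
(`deform_face`), and the prism operator turns it into a chain homotopy (`chainHomotopy`).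
-/

noncomputable section

namespace LocalCoeff

/-! ### Ordered chains on a set -/

/-- Formal integral combinations of `n`-tuples of points of `V`: the augmented ordered chain complex
of the full simplex on the set `V`. The index counts vertices rather than the dimension, so that
degree `0`, spanned by the empty tuple, is the augmentation. -/
abbrev Tuples (V : Type*) (n : ℕ) := FreeAbelianGroup (Fin n → V)

namespace Tuples

open FreeAbelianGroup

variable {V V' W W' : Type*}

/-- The alternating sum of the tuples with one entry omitted. -/
def bd {n : ℕ} : Tuples V (n + 1) →+ Tuples V n :=
  lift fun w => ∑ i : Fin (n + 1), (-1 : ℤ) ^ (i : ℕ) • of (w ∘ i.succAbove)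

lemma bd_of {n : ℕ} (w : Fin (n + 1) → V) :
    bd (of w) = ∑ i : Fin (n + 1), (-1 : ℤ) ^ (i : ℕ) • of (w ∘ i.succAbove) :=
  lift_apply_of _ _

/-- The cone with apex `v`, which puts `v` in front of every tuple. -/
def cone (v : V) {n : ℕ} : Tuples V n →+ Tuples V (n + 1) :=
  FreeAbelianGroup.map fun w => (Fin.cons v w : Fin (n + 1) → V)

@[simp]
lemma cone_of (v : V) {n : ℕ} (w : Fin n → V) :
    cone v (of w) = of (Fin.cons v w : Fin (n + 1) → V) :=
  map_of_apply _

lemma bd_cone (v : V) {n : ℕ} (c : Tuples V (n + 1)) : bd (cone v c) = c - cone v (bd c) := by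
  suffices h : bd.comp (cone v) = AddMonoidHom.id (Tuples V (n + 1)) - (cone v).comp bd from
    DFunLike.congr_fun h c
  refine lift_ext _ _ fun w => ?_
  simp only [AddMonoidHom.comp_apply, AddMonoidHom.sub_apply, AddMonoidHom.id_apply, cone_of,
    bd_of, map_sum, map_zsmul]
  rw [Fin.sum_univ_succ, sub_eq_add_neg, ← Finset.sum_neg_distrib]
  refine congrArg₂ _ ?_ ?_
  · rw [Fin.val_zero, pow_zero, one_smul]
    rfl
  · refine Finset.sum_congr rfl fun i _ => ?_
    rw [Fin.val_succ, pow_succ, mul_neg_one, neg_smul]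
    congr 3
    funext j
    refine Fin.cases ?_ (fun j => ?_) j <;> simp

lemma bd_cone_zero (v : V) (c : Tuples V 0) : bd (cone v c) = c := by
  suffices h : bd.comp (cone v) = AddMonoidHom.id (Tuples V 0) from DFunLike.congr_fun h c
  refine lift_ext _ _ fun w => ?_
  simp only [AddMonoidHom.comp_apply, AddMonoidHom.id_apply, cone_of, bd_of]
  simp

lemma of_eq_cone {n : ℕ} (w : Fin (n + 1) → V) : of w = cone (w 0) (of (Fin.tail w)) := by
  rw [cone_of, Fin.cons_self_tail]

lemma bd_bd : ∀ {n : ℕ} (c : Tuples V (n + 2)), bd (bd c) = 0 := by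
  suffices h : ∀ n : ℕ, bd.comp (bd (V := V) (n := n + 1)) = 0 from
    fun {n} c => DFunLike.congr_fun (h n) c
  intro n
  induction n with
  | zero =>
    refine lift_ext _ _ fun w => ?_
    rw [AddMonoidHom.comp_apply, of_eq_cone, bd_cone, map_sub, bd_cone_zero, sub_self]
    rfl
  | succ n ih =>
    refine lift_ext _ _ fun w => ?_
    have ih' := DFunLike.congr_fun ih (of (Fin.tail w))
    rw [AddMonoidHom.comp_apply] at ih'
    rw [AddMonoidHom.comp_apply, of_eq_cone, bd_cone, map_sub, bd_cone, ih']
    simp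

/-- The map of ordered chains induced by a map of vertices. -/
def map (g : V → W) {n : ℕ} : Tuples V n →+ Tuples W n :=
  FreeAbelianGroup.map (g ∘ ·)

@[simp]
lemma map_of (g : V → W) {n : ℕ} (w : Fin n → V) : map g (of w) = of (g ∘ w) :=
  map_of_apply _

lemma map_bd (g : V → W) {n : ℕ} (c : Tuples V (n + 1)) : map g (bd c) = bd (map g c) := by
  suffices h : (map g).comp bd = bd.comp (map g (n := n + 1)) from DFunLike.congr_fun h c
  refine lift_ext _ _ fun w => ?_
  simp [bd_of, Function.comp_assoc]

lemma map_cone (g : V → W) (v : V) {n : ℕ} (c : Tuples V n) :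
    map g (cone v c) = cone (g v) (map g c) := by
  suffices h : (map g).comp (cone v (n := n)) = (cone (g v)).comp (map g) from
    DFunLike.congr_fun h c
  refine lift_ext _ _ fun w => ?_
  simp only [AddMonoidHom.comp_apply, cone_of, map_of]
  congr 1
  funext j
  refine Fin.cases ?_ (fun j => ?_) j <;> simp

lemma map_map (g : V → V') (g' : V' → W) {n : ℕ} (c : Tuples V n) :
    map g' (map g c) = map (g' ∘ g) c := by
  suffices h : (map g').comp (map g (n := n)) = map (g' ∘ g) from DFunLike.congr_fun h c
  refine lift_ext _ _ fun w => ?_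
  simp [Function.comp_assoc]

section ConeHomotopy

variable (α β : ∀ n, Tuples V n →+ Tuples V' n) (apex : ∀ n : ℕ, (Fin (n + 1) → V) → V')

/-- A chain homotopy between two chain maps `α` and `β` that agree in degree `0`. Ordered chains
are acyclic, and the homotopy is built degree by degree by coning off, from the point `apex w`, the
cycle that has to be bounded on the tuple `w`. -/
def coneHomotopy : ∀ n, Tuples V n →+ Tuples V' (n + 1)
  | 0 => 0
  | n + 1 => lift fun w =>
      cone (apex _ w) (α (n + 1) (of w) - β (n + 1) (of w) - coneHomotopy n (bd (of w)))

lemma coneHomotopy_zero (c : Tuples V 0) : coneHomotopy α β apex 0 c = 0 := rfl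

lemma coneHomotopy_of {n : ℕ} (w : Fin (n + 1) → V) :
    coneHomotopy α β apex (n + 1) (of w) =
      cone (apex _ w)
        (α (n + 1) (of w) - β (n + 1) (of w) - coneHomotopy α β apex n (bd (of w))) :=
  lift_apply_of _ _

variable {α β}

lemma bd_coneHomotopy (hα : ∀ n c, bd (α (n + 1) c) = α n (bd c))
    (hβ : ∀ n c, bd (β (n + 1) c) = β n (bd c)) (h0 : ∀ c, α 0 c = β 0 c) :
    ∀ (n : ℕ) (c : Tuples V (n + 1)), bd (coneHomotopy α β apex (n + 1) c) =
      α (n + 1) c - β (n + 1) c - coneHomotopy α β apex n (bd c) := by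
  suffices h : ∀ n, bd.comp (coneHomotopy α β apex (n + 1)) =
      α (n + 1) - β (n + 1) - (coneHomotopy α β apex n).comp bd from
    fun n c => DFunLike.congr_fun (h n) c
  intro n
  induction n with
  | zero =>
    refine lift_ext _ _ fun w => ?_
    have hz : bd (α 1 (of w) - β 1 (of w) - coneHomotopy α β apex 0 (bd (of w))) = 0 := by
      rw [coneHomotopy_zero, sub_zero, map_sub, hα, hβ, h0, sub_self]
    rw [AddMonoidHom.comp_apply, coneHomotopy_of, bd_cone, hz, map_zero, sub_zero]
    rfl
  | succ n ih =>
    refine lift_ext _ _ fun w => ?_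
    have hz : bd (α (n + 2) (of w) - β (n + 2) (of w) -
        coneHomotopy α β apex (n + 1) (bd (of w))) = 0 := by
      have := DFunLike.congr_fun ih (bd (of w))
      rw [AddMonoidHom.comp_apply] at this
      rw [map_sub, map_sub, hα, hβ, this]
      simp [bd_bd]
    rw [AddMonoidHom.comp_apply, coneHomotopy_of, bd_cone, hz, map_zero, sub_zero]
    rfl

lemma map_coneHomotopy {α' β' : ∀ n, Tuples W n →+ Tuples W' n}
    {apex' : ∀ n : ℕ, (Fin (n + 1) → W) → W'} {g : V → W} {g' : V' → W'}
    (hα : ∀ n c, map g' (α n c) = α' n (map g c)) (hβ : ∀ n c, map g' (β n c) = β' n (map g c))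
    (hv : ∀ (n : ℕ) (w : Fin (n + 1) → V), g' (apex n w) = apex' _ (g ∘ w)) :
    ∀ (n : ℕ) (c : Tuples V n), map g' (coneHomotopy α β apex n c) =
      coneHomotopy α' β' apex' n (map g c) := by
  suffices h : ∀ n, (map g').comp (coneHomotopy α β apex n) =
      (coneHomotopy α' β' apex' n).comp (map g) from fun n c => DFunLike.congr_fun (h n) c
  intro n
  induction n with
  | zero =>
    refine lift_ext _ _ fun w => ?_
    simp [coneHomotopy_zero]
  | succ n ih =>
    refine lift_ext _ _ fun w => ?_
    have ih' := DFunLike.congr_fun ih (bd (of w))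
    simp only [AddMonoidHom.comp_apply] at ih' ⊢
    rw [coneHomotopy_of, map_cone, map_sub (map g'), map_sub (map g'), hα, hβ, ih', map_bd, hv,
      map_of, coneHomotopy_of]

end ConeHomotopy

section Subdivision

variable (b : ∀ n : ℕ, (Fin (n + 1) → V) → V)

/-- Subdivision of ordered chains, where `b w` is the point taken as barycenter of `w`: the
subdivided boundary of `w` is coned off from `b w`. -/
def sd : ∀ n, Tuples V n →+ Tuples V n
  | 0 => AddMonoidHom.id _
  | n + 1 => lift fun w => cone (b _ w) (sd n (bd (of w)))

lemma sd_zero (c : Tuples V 0) : sd b 0 c = c := rfl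

lemma sd_of {n : ℕ} (w : Fin (n + 1) → V) :
    sd b (n + 1) (of w) = cone (b _ w) (sd b n (bd (of w))) :=
  lift_apply_of _ _

lemma bd_sd : ∀ (n : ℕ) (c : Tuples V (n + 1)), bd (sd b (n + 1) c) = sd b n (bd c) := by
  suffices h : ∀ n, bd.comp (sd b (n + 1)) = (sd b n).comp bd from
    fun n c => DFunLike.congr_fun (h n) c
  intro n
  induction n with
  | zero =>
    refine lift_ext _ _ fun w => ?_
    rw [AddMonoidHom.comp_apply, sd_of, bd_cone_zero]
    rfl
  | succ n ih =>
    refine lift_ext _ _ fun w => ?_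
    have ih' := DFunLike.congr_fun ih (bd (of w))
    simp only [AddMonoidHom.comp_apply] at ih' ⊢
    rw [sd_of, bd_cone, ih', bd_bd, map_zero, map_zero, sub_zero]

variable {b}

lemma map_sd {b' : ∀ n : ℕ, (Fin (n + 1) → W) → W} {g : V → W}
    (hg : ∀ (n : ℕ) (w : Fin (n + 1) → V), g (b n w) = b' _ (g ∘ w)) :
    ∀ (n : ℕ) (c : Tuples V n), map g (sd b n c) = sd b' n (map g c) := by
  suffices h : ∀ n, (map g).comp (sd b n) = (sd b' n).comp (map g) from
    fun n c => DFunLike.congr_fun (h n) c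
  intro n
  induction n with
  | zero => rfl
  | succ n ih =>
    refine lift_ext _ _ fun w => ?_
    have ih' := DFunLike.congr_fun ih (bd (of w))
    simp only [AddMonoidHom.comp_apply] at ih' ⊢
    rw [sd_of, map_cone, ih', map_bd, hg, map_of, sd_of]

end Subdivision

end Tuples

/-! ### Affine maps between simplices -/

section Affine

variable {ι ι' ι'' : Type*} [Fintype ι] [Fintype ι'] [Fintype ι'']

/-- The affine map of simplices `t ↦ ∑ i, t i • w i` that takes the `i`-th vertex to `w i`. -/
def aff (w : ι' → stdSimplex ℝ ι) : C(stdSimplex ℝ ι', stdSimplex ℝ ι) where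
  toFun t := ⟨fun j => ∑ i, t i * w i j,
    fun j => Finset.sum_nonneg fun i _ =>
      mul_nonneg (stdSimplex.zero_le t i) (stdSimplex.zero_le (w i) j), by
      rw [Finset.sum_comm]
      simp [← Finset.mul_sum]⟩
  continuous_toFun := by
    refine Continuous.subtype_mk (continuous_pi fun j => ?_) _
    exact continuous_finsetSum _ fun i _ =>
      ((continuous_apply i).comp continuous_subtype_val).mul continuous_const

lemma aff_apply (w : ι' → stdSimplex ℝ ι) (t : stdSimplex ℝ ι') (j : ι) :
    aff w t j = ∑ i, t i * w i j := rfl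

lemma aff_aff (u : ι' → stdSimplex ℝ ι) (w : ι'' → stdSimplex ℝ ι') (t : stdSimplex ℝ ι'') :
    aff u (aff w t) = aff (fun i => aff u (w i)) t := by
  ext j
  simp only [aff_apply, Finset.sum_mul, Finset.mul_sum]
  rw [Finset.sum_comm]
  simp [mul_assoc]

@[simp]
lemma aff_vertex [DecidableEq ι'] (w : ι' → stdSimplex ℝ ι) (i : ι') :
    aff w (stdSimplex.vertex i) = w i := by
  ext j
  simp [aff_apply, Pi.single_apply]

lemma aff_vertices [DecidableEq ι] :
    aff (stdSimplex.vertex : ι → stdSimplex ℝ ι) = ContinuousMap.id _ := by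
  ext t j
  simp [aff_apply, Pi.single_apply]

lemma map_apply_eq_sum [DecidableEq ι] (f : ι' → ι) (t : stdSimplex ℝ ι') (j : ι) :
    stdSimplex.map f t j = ∑ i, if f i = j then t i else 0 := by
  classical
  rw [stdSimplex.map_coe, FunOnFinite.linearMap_apply_apply, ← Finset.sum_filter]

lemma map_eq_aff [DecidableEq ι] (f : ι' → ι) (t : stdSimplex ℝ ι') :
    stdSimplex.map f t = aff (fun i => stdSimplex.vertex (f i)) t := by
  ext j
  simp only [map_apply_eq_sum, aff_apply, stdSimplex.vertex_coe, Pi.single_apply, mul_ite, mul_one,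
    mul_zero]
  exact Finset.sum_congr rfl fun i _ => by simp only [eq_comm]

lemma aff_map (w : ι' → stdSimplex ℝ ι) (f : ι'' → ι') (t : stdSimplex ℝ ι'') :
    aff w (stdSimplex.map f t) = aff (w ∘ f) t := by
  classical
  rw [map_eq_aff, aff_aff]
  simp only [aff_vertex]
  rfl

lemma map_aff (f : ι → ι'') (w : ι' → stdSimplex ℝ ι) (t : stdSimplex ℝ ι') :
    stdSimplex.map f (aff w t) = aff (fun i => stdSimplex.map f (w i)) t := by
  classical
  simp only [map_eq_aff, aff_aff]

lemma map_apply_of_injective {f : ι' → ι} (hf : Function.Injective f) (t : stdSimplex ℝ ι')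
    (i : ι') : stdSimplex.map f t (f i) = t i := by
  classical
  simp [map_apply_eq_sum, hf.eq_iff]

lemma map_apply_of_notMem (f : ι' → ι) (t : stdSimplex ℝ ι') {j : ι} (hj : j ∉ Set.range f) :
    stdSimplex.map f t j = 0 := by
  classical
  rw [map_apply_eq_sum]
  exact Finset.sum_eq_zero fun i _ => if_neg fun h => hj ⟨i, h⟩

lemma map_injective {f : ι' → ι} (hf : Function.Injective f) :
    Function.Injective (stdSimplex.map (S := ℝ) f) := by
  intro s t h
  ext i
  rw [← map_apply_of_injective hf s, h, map_apply_of_injective hf]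

lemma dist_le_of_forall {x y : stdSimplex ℝ ι} {r : ℝ} (hr : 0 ≤ r) (h : ∀ j, |x j - y j| ≤ r) :
    dist x y ≤ r :=
  (dist_pi_le_iff hr).2 h

lemma abs_sub_le_dist (x y : stdSimplex ℝ ι) (j : ι) : |x j - y j| ≤ dist x y :=
  dist_le_pi_dist x.1 y.1 j

lemma sub_aff_apply (x : stdSimplex ℝ ι) (w : ι' → stdSimplex ℝ ι) (t : stdSimplex ℝ ι') (j : ι) :
    x j - aff w t j = ∑ i, t i * (x j - w i j) := by
  simp only [mul_sub, Finset.sum_sub_distrib, ← Finset.sum_mul, stdSimplex.sum_eq_one, one_mul,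
    aff_apply]

lemma dist_aff_le {x : stdSimplex ℝ ι} {w : ι' → stdSimplex ℝ ι} {r : ℝ} (hr : 0 ≤ r)
    (h : ∀ i, dist x (w i) ≤ r) (t : stdSimplex ℝ ι') : dist x (aff w t) ≤ r := by
  refine dist_le_of_forall hr fun j => ?_
  rw [sub_aff_apply]
  calc |∑ i, t i * (x j - w i j)| ≤ ∑ i, |t i * (x j - w i j)| := Finset.abs_sum_le_sum_abs _ _
    _ ≤ ∑ i, t i * r := Finset.sum_le_sum fun i _ => by
        rw [abs_mul, abs_of_nonneg (stdSimplex.zero_le t i)]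
        exact mul_le_mul_of_nonneg_left ((abs_sub_le_dist x (w i) j).trans (h i))
          (stdSimplex.zero_le t i)
    _ = r := by rw [← Finset.sum_mul, stdSimplex.sum_eq_one t, one_mul]

/-- The barycenter of a nonempty tuple of points of a simplex. -/
def bary (n : ℕ) (w : Fin (n + 1) → stdSimplex ℝ ι) : stdSimplex ℝ ι :=
  aff w stdSimplex.barycenter

lemma dist_bary_le {n : ℕ} {w : Fin (n + 1) → stdSimplex ℝ ι} {d : ℝ}
    (h : ∀ i j, dist (w i) (w j) ≤ d) (j : Fin (n + 1)) :
    dist (w j) (bary n w) ≤ n / (n + 1) * d := by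
  have hd : 0 ≤ d := dist_nonneg.trans (h 0 0)
  refine dist_le_of_forall (by positivity) fun k => ?_
  have hb (i : Fin (n + 1)) :
      (stdSimplex.barycenter : stdSimplex ℝ (Fin (n + 1))) i = ((n : ℝ) + 1)⁻¹ := by
    have := stdSimplex.barycenter_apply (𝕜 := ℝ) i
    rw [Fintype.card_fin, Nat.cast_succ] at this
    exact this
  rw [bary, sub_aff_apply]
  simp only [hb, ← Finset.mul_sum]
  -- the term of index `j` vanishes, which leaves `n` terms out of `n + 1`
  rw [Fin.sum_univ_succAbove _ j, sub_self, zero_add, abs_mul, abs_of_nonneg (by positivity),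
    div_mul_eq_mul_div, div_eq_inv_mul]
  refine mul_le_mul_of_nonneg_left ?_ (by positivity)
  calc |∑ i, (w j k - w (j.succAbove i) k)| ≤ ∑ i, |w j k - w (j.succAbove i) k| :=
        Finset.abs_sum_le_sum_abs _ _
    _ ≤ ∑ _i : Fin n, d := Finset.sum_le_sum fun i _ => (abs_sub_le_dist _ _ k).trans (h _ _)
    _ = n * d := by simp

lemma aff_bary (u : ι' → stdSimplex ℝ ι) (n : ℕ) (w : Fin (n + 1) → stdSimplex ℝ ι') :
    aff u (bary n w) = bary n (fun i => aff u (w i)) :=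
  aff_aff _ _ _

lemma aff_comp_face {k : ℕ} (w : Fin (k + 2) → stdSimplex ℝ ι) (i : Fin (k + 2)) :
    (aff w).comp (face i) = aff (w ∘ i.succAbove) := by
  ext1 t
  exact aff_map w i.succAbove t

/-- The tuple of all vertices of the standard simplex. -/
def vertices (k : ℕ) : Tuples (Simplex k) (k + 1) :=
  FreeAbelianGroup.of fun i => stdSimplex.vertex i

lemma map_aff_vertices {k : ℕ} (w : Fin (k + 1) → stdSimplex ℝ ι) :
    Tuples.map (aff w) (vertices k) = FreeAbelianGroup.of w := by
  rw [vertices, Tuples.map_of]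
  congr 1
  funext i
  exact aff_vertex w i

end Affine

/-! ### The mesh of iterated subdivisions -/

/-- The combinations of basis elements that lie in `P`. -/
def spanned {A : Type*} (P : Set A) : AddSubgroup (FreeAbelianGroup A) :=
  AddSubgroup.closure (FreeAbelianGroup.of '' P)

lemma of_mem_spanned {A : Type*} {P : Set A} {a : A} (ha : a ∈ P) :
    FreeAbelianGroup.of a ∈ spanned P :=
  AddSubgroup.subset_closure ⟨a, ha, rfl⟩

lemma map_mem_of_spanned {A B : Type*} [AddCommGroup B] {P : Set A} {H : AddSubgroup B}
    (f : FreeAbelianGroup A →+ B) (h : ∀ a ∈ P, f (FreeAbelianGroup.of a) ∈ H)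
    {c : FreeAbelianGroup A} (hc : c ∈ spanned P) : f c ∈ H := by
  have : spanned P ≤ H.comap f := by
    refine (AddSubgroup.closure_le _).2 ?_
    rintro _ ⟨a, ha, rfl⟩
    exact h a ha
  exact this hc

lemma spanned_mono {A : Type*} {P Q : Set A} (h : P ⊆ Q) : spanned P ≤ spanned Q :=
  AddSubgroup.closure_mono (Set.image_mono h)

lemma eqOn_spanned {A B : Type*} [AddCommGroup B] {P : Set A} {f g : FreeAbelianGroup A →+ B}
    (h : ∀ a ∈ P, f (FreeAbelianGroup.of a) = g (FreeAbelianGroup.of a)) {c : FreeAbelianGroup A}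
    (hc : c ∈ spanned P) : f c = g c := by
  have := map_mem_of_spanned (H := ⊥) (f - g) (fun a ha => by simp [h a ha]) hc
  rwa [AddSubgroup.mem_bot, AddMonoidHom.sub_apply, sub_eq_zero] at this

namespace Tuples

open FreeAbelianGroup

variable {ι : Type*} [Fintype ι]

/-- Barycentric subdivision shrinks tuples of at most `N + 1` points by the factor
`N / (N + 1)`. The statement also records that the new points lie in the hull of the old ones,
which is what the distances to the barycenter depend on. -/
lemma sd_of_mem {N : ℕ} {d : ℝ} : ∀ {n : ℕ}, n ≤ N + 1 → ∀ {w : Fin n → stdSimplex ℝ ι},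
    (∀ i j, dist (w i) (w j) ≤ d) →
    sd bary n (of w) ∈ spanned {u : Fin n → stdSimplex ℝ ι |
      (∀ i, u i ∈ Set.range (aff w)) ∧ ∀ i j, dist (u i) (u j) ≤ N / (N + 1) * d}
  | 0, _, w, _ => of_mem_spanned ⟨fun i => i.elim0, fun i => i.elim0⟩
  | n + 1, hn, w, hw => by
    have hd : 0 ≤ d := dist_nonneg.trans (hw 0 0)
    have hκ : (n : ℝ) / (n + 1) ≤ N / (N + 1) := by
      rw [div_le_div_iff₀ (by positivity) (by positivity)]
      have : (n : ℝ) ≤ N := by exact_mod_cast Nat.le_of_succ_le_succ hn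
      nlinarith
    have hb (x) (hx : x ∈ Set.range (aff w)) : dist (bary n w) x ≤ N / (N + 1) * d := by
      obtain ⟨t, rfl⟩ := hx
      refine dist_aff_le (by positivity) (fun i => ?_) t
      rw [dist_comm]
      exact (dist_bary_le hw i).trans (mul_le_mul_of_nonneg_right hκ hd)
    have hface : sd bary n (bd (of w)) ∈ spanned {u : Fin n → stdSimplex ℝ ι |
        (∀ i, u i ∈ Set.range (aff w)) ∧ ∀ i j, dist (u i) (u j) ≤ N / (N + 1) * d} := by
      rw [bd_of, map_sum]
      refine sum_mem fun i _ => ?_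
      rw [map_zsmul]
      refine zsmul_mem (spanned_mono ?_
        (sd_of_mem (Nat.le_of_succ_le hn) (w := w ∘ i.succAbove) fun j k => hw _ _)) _
      refine fun u hu => ⟨fun j => ?_, hu.2⟩
      obtain ⟨t, ht⟩ := hu.1 j
      exact ⟨stdSimplex.map i.succAbove t, by rw [aff_map, ht]⟩
    rw [sd_of]
    refine map_mem_of_spanned (cone _) (fun u hu => ?_) hface
    rw [cone_of]
    refine of_mem_spanned ⟨fun i => ?_, fun i j => ?_⟩
    · refine Fin.cases ?_ (fun i => ?_) i
      · exact ⟨_, rfl⟩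
      · simpa using hu.1 i
    · refine Fin.cases ?_ (fun i => ?_) i <;> refine Fin.cases ?_ (fun j => ?_) j
      · simp only [Fin.cons_zero, dist_self]
        positivity
      · simpa using hb _ (hu.1 j)
      · rw [dist_comm]
        simpa using hb _ (hu.1 i)
      · simpa using hu.2 i j

lemma sd_iterate_of_mem {N : ℕ} {d : ℝ} {n : ℕ} (hn : n ≤ N + 1) {w : Fin n → stdSimplex ℝ ι}
    (hw : ∀ i j, dist (w i) (w j) ≤ d) (m : ℕ) :
    (sd bary n)^[m] (of w) ∈ spanned {u : Fin n → stdSimplex ℝ ι |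
      ∀ i j, dist (u i) (u j) ≤ (N / (N + 1)) ^ m * d} := by
  induction m with
  | zero => exact of_mem_spanned (by simpa using hw)
  | succ m ih =>
    rw [Function.iterate_succ_apply']
    refine map_mem_of_spanned (sd bary n) (fun u hu => ?_) ih
    refine spanned_mono (fun u' hu' => ?_) (sd_of_mem hn hu)
    rw [pow_succ', mul_assoc]
    exact hu'.2

end Tuples

/-! ### Path classes in simplices -/

section Edge

variable {ι ι' : Type} [Fintype ι] [Nonempty ι] [Fintype ι'] [Nonempty ι']
  {X : Type u} [TopologicalSpace X]

instance : ContractibleSpace (stdSimplex ℝ ι) :=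
  (convex_stdSimplex ℝ ι).contractibleSpace ⟨_, (Classical.arbitrary (stdSimplex ℝ ι)).2⟩

/-- The only path class from `a` to `b` in a simplex. -/
def simplexHom (a b : stdSimplex ℝ ι) : (⟨a⟩ : FundamentalGroupoid (stdSimplex ℝ ι)) ⟶ ⟨b⟩ :=
  Path.Homotopic.Quotient.mk (PathConnectedSpace.somePath a b)

lemma hom_ext_stdSimplex {a b : FundamentalGroupoid (stdSimplex ℝ ι)} (p q : a ⟶ b) : p = q :=
  Subsingleton.elim (α := Path.Homotopic.Quotient a.as b.as) p q

/-- The path class from `H a` to `H b` that a map `H` from a simplex determines. -/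
def edge (H : C(stdSimplex ℝ ι, X)) (a b : stdSimplex ℝ ι) :
    (⟨H a⟩ : FundamentalGroupoid X) ⟶ ⟨H b⟩ :=
  (FundamentalGroupoid.map H).map (simplexHom a b)

lemma edge_trans (H : C(stdSimplex ℝ ι, X)) (a b c : stdSimplex ℝ ι) :
    edge H a b ≫ edge H b c = edge H a c := by
  rw [edge, edge, edge, hom_ext_stdSimplex (simplexHom a c) (simplexHom a b ≫ simplexHom b c),
    CategoryTheory.Functor.map_comp]
  rfl

lemma edge_self (H : C(stdSimplex ℝ ι, X)) (a : stdSimplex ℝ ι) : edge H a a = 𝟙 _ := by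
  rw [edge, hom_ext_stdSimplex (simplexHom a a) (𝟙 _), CategoryTheory.Functor.map_id]
  rfl

lemma edge_comp (H : C(stdSimplex ℝ ι, X)) (g : C(stdSimplex ℝ ι', stdSimplex ℝ ι))
    (a b : stdSimplex ℝ ι') : edge (H.comp g) a b = edge H (g a) (g b) := by
  rw [edge, edge, hom_ext_stdSimplex (simplexHom (g a) (g b))
    ((FundamentalGroupoid.map g).map (simplexHom a b))]
  rfl

lemma transport_eq_map_edge (G : CoefficientSystem.{u, v} X) {k : ℕ} (σ : C(Simplex k, X))
    (a b : Simplex k) : transport G σ a b = G.map (edge σ a b) := by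
  rw [transport, edge, hom_ext_simplex (straightClass a b) (simplexHom a b)]

end Edge

/-! ### Chains based at a point -/

section BasedChains

open FreeAbelianGroup

variable {X Z : Type u} [TopologicalSpace X] [TopologicalSpace Z]

/-- A singular simplex `τ` of a space `Z` over `X`, together with a path class in `X` from the base
point `x` to the image of the leading vertex of `τ`. -/
abbrev BasedSimplex (f : C(Z, X)) (k : ℕ) (x : FundamentalGroupoid X) : Type u :=
  Σ τ : C(Simplex k, Z), (x ⟶ (⟨f (τ (e₀ k))⟩ : FundamentalGroupoid X))

/-- Singular chains of `Z` with coefficients in the pullback of the local coefficient system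
`y ↦ ℤ[π(x, y)]` on `X`. They are universal: a combination of based simplices acts on the chains and
on the cochains with values in any local coefficient system. -/
abbrev BasedChains (f : C(Z, X)) (k : ℕ) (x : FundamentalGroupoid X) : Type u :=
  FreeAbelianGroup (BasedSimplex f k x)

variable {f : C(Z, X)} {x y : FundamentalGroupoid X}
  {ι ι' : Type} [Fintype ι] [Nonempty ι] [Fintype ι'] [Nonempty ι']

/-- The based simplex `H ∘ θ`, where `γ` leads from the base point to `f (H p)` and is continued
inside the simplex on which `H` is defined. -/
def entry (H : C(stdSimplex ℝ ι, Z)) (p : stdSimplex ℝ ι)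
    (γ : x ⟶ (⟨f (H p)⟩ : FundamentalGroupoid X)) {l : ℕ} (θ : C(Simplex l, stdSimplex ℝ ι)) :
    BasedSimplex f l x :=
  ⟨H.comp θ, γ ≫ edge (f.comp H) p (θ (e₀ l))⟩

lemma entry_id {k : ℕ} (τ : C(Simplex k, Z)) (γ : x ⟶ (⟨f (τ (e₀ k))⟩ : FundamentalGroupoid X)) :
    entry τ (e₀ k) γ (ContinuousMap.id _) = ⟨τ, γ⟩ := by
  rw [entry]
  have h : γ ≫ edge (f.comp τ) (e₀ k) (e₀ k) = γ := by
    rw [edge_self]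
    exact Category.comp_id γ
  exact congrArg (Sigma.mk (β := fun τ : C(Simplex k, Z) =>
    (x ⟶ (⟨f (τ (e₀ k))⟩ : FundamentalGroupoid X))) τ) h

lemma entry_comp (H : C(stdSimplex ℝ ι, Z)) (g : C(stdSimplex ℝ ι', stdSimplex ℝ ι))
    (p : stdSimplex ℝ ι') (γ : x ⟶ (⟨f (H (g p))⟩ : FundamentalGroupoid X)) {l : ℕ}
    (θ : C(Simplex l, stdSimplex ℝ ι')) :
    entry (f := f) (H.comp g) p γ θ = entry H (g p) γ (g.comp θ) := by
  have h := edge_comp (f.comp H) g p (θ (e₀ l))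
  exact congrArg (fun δ => (⟨H.comp (g.comp θ), γ ≫ δ⟩ : BasedSimplex f l x)) h

lemma entry_base (H : C(stdSimplex ℝ ι, Z)) (p p' : stdSimplex ℝ ι)
    (γ : x ⟶ (⟨f (H p)⟩ : FundamentalGroupoid X)) {l : ℕ} (θ : C(Simplex l, stdSimplex ℝ ι)) :
    entry (f := f) H p' (γ ≫ edge (f.comp H) p p') θ = entry H p γ θ := by
  have h : (γ ≫ edge (f.comp H) p p') ≫ edge (f.comp H) p' (θ (e₀ l)) =
      γ ≫ edge (f.comp H) p (θ (e₀ l)) := by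
    rw [← edge_trans (f.comp H) p p' (θ (e₀ l))]
    exact Category.assoc (obj := FundamentalGroupoid X) _ _ _
  exact congrArg (fun δ => (⟨H.comp θ, δ⟩ : BasedSimplex f l x)) h

/-- The boundary of based chains. -/
def BasedChains.bd {k : ℕ} : BasedChains f (k + 1) x →+ BasedChains f k x :=
  lift fun p => ∑ i : Fin (k + 2), (-1 : ℤ) ^ (i : ℕ) •
    of (entry p.1 (e₀ (k + 1)) p.2 (face i))

lemma BasedChains.bd_of {k : ℕ} (p : BasedSimplex f (k + 1) x) :
    bd (of p) = ∑ i : Fin (k + 2), (-1 : ℤ) ^ (i : ℕ) •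
      of (entry p.1 (e₀ (k + 1)) p.2 (face i)) :=
  lift_apply_of _ _

/-- The based chain obtained by realizing tuples of points as affine simplices and mapping them
to `Z` by `H`. -/
def push (H : C(stdSimplex ℝ ι, Z)) (p : stdSimplex ℝ ι)
    (γ : x ⟶ (⟨f (H p)⟩ : FundamentalGroupoid X)) {l : ℕ} :
    Tuples (stdSimplex ℝ ι) (l + 1) →+ BasedChains f l x :=
  FreeAbelianGroup.map fun w => entry H p γ (aff w)

@[simp]
lemma push_of (H : C(stdSimplex ℝ ι, Z)) (p : stdSimplex ℝ ι)
    (γ : x ⟶ (⟨f (H p)⟩ : FundamentalGroupoid X)) {l : ℕ} (w : Fin (l + 1) → stdSimplex ℝ ι) :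
    push H p γ (of w) = of (entry H p γ (aff w)) :=
  map_of_apply _

lemma push_bd (H : C(stdSimplex ℝ ι, Z)) (p : stdSimplex ℝ ι)
    (γ : x ⟶ (⟨f (H p)⟩ : FundamentalGroupoid X)) {l : ℕ} (c : Tuples (stdSimplex ℝ ι) (l + 2)) :
    push H p γ (Tuples.bd c) = BasedChains.bd (push H p γ c) := by
  suffices h : (push H p γ).comp Tuples.bd =
      (BasedChains.bd (f := f)).comp (push H p γ (l := l + 1)) from DFunLike.congr_fun h c
  refine lift_ext _ _ fun w => ?_
  simp only [AddMonoidHom.comp_apply, Tuples.bd_of, push_of, BasedChains.bd_of, map_sum, map_zsmul]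
  refine Finset.sum_congr rfl fun i _ => ?_
  congr 2
  refine Eq.trans ?_ (entry_comp H (aff w) (e₀ (l + 1)) _ (face i)).symm
  rw [aff_comp_face]
  exact (entry_base H p _ γ _).symm

lemma push_comp (H : C(stdSimplex ℝ ι, Z)) (w : ι' → stdSimplex ℝ ι)
    (p : stdSimplex ℝ ι') (γ : x ⟶ (⟨f (H (aff w p))⟩ : FundamentalGroupoid X)) {l : ℕ}
    (c : Tuples (stdSimplex ℝ ι') (l + 1)) :
    push (f := f) (H.comp (aff w)) p γ c = push H (aff w p) γ (Tuples.map (aff w) c) := by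
  suffices h : push (f := f) (H.comp (aff w)) p γ (l := l) =
      (push H (aff w p) γ).comp (Tuples.map (aff w)) from DFunLike.congr_fun h c
  refine lift_ext _ _ fun v => ?_
  simp only [AddMonoidHom.comp_apply, Tuples.map_of, push_of]
  rw [entry_comp]
  congr 2
  ext1 t
  exact aff_aff w v t

lemma push_base (H : C(stdSimplex ℝ ι, Z)) (p p' : stdSimplex ℝ ι)
    (γ : x ⟶ (⟨f (H p)⟩ : FundamentalGroupoid X)) {l : ℕ} (c : Tuples (stdSimplex ℝ ι) (l + 1)) :
    push (f := f) H p' (γ ≫ edge (f.comp H) p p') c = push H p γ c := by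
  suffices h : push (f := f) H p' (γ ≫ edge (f.comp H) p p') (l := l) = push H p γ from
    DFunLike.congr_fun h c
  refine lift_ext _ _ fun v => ?_
  rw [push_of, push_of, entry_base]

lemma push_vertices {k : ℕ} (p : BasedSimplex f k x) :
    push p.1 (e₀ k) p.2 (vertices k) = of p := by
  rw [vertices, push_of]
  have := aff_vertices (ι := Fin (k + 1))
  rw [this, entry_id]

lemma BasedChains.bd_bd {k : ℕ} (z : BasedChains f (k + 2) x) : bd (bd z) = 0 := by
  suffices h : bd.comp (bd (f := f) (x := x) (k := k + 1)) = 0 from DFunLike.congr_fun h z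
  refine lift_ext _ _ fun p => ?_
  rw [AddMonoidHom.comp_apply, ← push_vertices, ← push_bd, ← push_bd, Tuples.bd_bd, map_zero]
  rfl

/-- Change of the base point along a path class. -/
def pull (γ : y ⟶ x) {k : ℕ} : BasedChains f k x →+ BasedChains f k y :=
  FreeAbelianGroup.map fun p => ⟨p.1, γ ≫ p.2⟩

@[simp]
lemma pull_of (γ : y ⟶ x) {k : ℕ} (p : BasedSimplex f k x) :
    pull γ (of p) = of (⟨p.1, γ ≫ p.2⟩ : BasedSimplex f k y) :=
  map_of_apply _

lemma pull_bd (γ : y ⟶ x) {k : ℕ} (z : BasedChains f (k + 1) x) :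
    pull γ (BasedChains.bd z) = BasedChains.bd (pull γ z) := by
  suffices h : (pull γ).comp (BasedChains.bd (f := f) (k := k)) = BasedChains.bd.comp (pull γ) from
    DFunLike.congr_fun h z
  refine lift_ext _ _ fun p => ?_
  simp [BasedChains.bd_of, entry]

lemma pull_pull {w : FundamentalGroupoid X} (δ : w ⟶ y) (γ : y ⟶ x) {k : ℕ}
    (z : BasedChains f k x) : pull δ (pull γ z) = pull (δ ≫ γ) z := by
  suffices h : (pull δ).comp (pull (f := f) γ (k := k)) = pull (δ ≫ γ) from
    DFunLike.congr_fun h z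
  refine lift_ext _ _ fun p => ?_
  simp

/-- The operator on based chains that replaces a simplex `τ` by the image under `τ` of a fixed
combination of affine simplices of the standard simplex. -/
def natOp {k l : ℕ} (c : Tuples (Simplex k) (l + 1)) : BasedChains f k x →+ BasedChains f l x :=
  lift fun p => push p.1 (e₀ k) p.2 c

lemma natOp_push {k l : ℕ} (c : Tuples (Simplex k) (l + 1)) (H : C(stdSimplex ℝ ι, Z))
    (p : stdSimplex ℝ ι) (γ : x ⟶ (⟨f (H p)⟩ : FundamentalGroupoid X))
    (w : Fin (k + 1) → stdSimplex ℝ ι) :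
    natOp (f := f) c (push H p γ (of w)) = push H p γ (Tuples.map (aff w) c) := by
  rw [push_of, natOp, lift_apply_of]
  refine Eq.trans ?_ (push_base H p (aff w (e₀ k)) γ _)
  exact push_comp H w (e₀ k) _ c

end BasedChains

/-! ### Subdivision of singular chains -/

section Subdivision

open FreeAbelianGroup

variable {X Z : Type u} [TopologicalSpace X] [TopologicalSpace Z]
variable {f : C(Z, X)} {x : FundamentalGroupoid X} {ι : Type} [Fintype ι]

/-- The homotopy between the identity and the subdivision of tuples in a simplex. -/
def sdHomotopy (n : ℕ) : Tuples (stdSimplex ℝ ι) n →+ Tuples (stdSimplex ℝ ι) (n + 1) :=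
  Tuples.coneHomotopy (fun _ => AddMonoidHom.id _) (Tuples.sd bary) (fun _ w => w 0) n

lemma bd_sdHomotopy (n : ℕ) (c : Tuples (stdSimplex ℝ ι) (n + 1)) :
    Tuples.bd (sdHomotopy (n + 1) c) =
      c - Tuples.sd bary (n + 1) c - sdHomotopy n (Tuples.bd c) := by
  rw [sdHomotopy, Tuples.bd_coneHomotopy _ (fun n c => by rw [AddMonoidHom.id_apply,
    AddMonoidHom.id_apply]) (Tuples.bd_sd bary) (fun c => (Tuples.sd_zero _ c).symm) n c,
    AddMonoidHom.id_apply, sdHomotopy]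

lemma map_aff_sdHomotopy {ι' : Type} [Fintype ι'] (w : ι → stdSimplex ℝ ι') (n : ℕ)
    (c : Tuples (stdSimplex ℝ ι) n) :
    Tuples.map (aff w) (sdHomotopy n c) = sdHomotopy n (Tuples.map (aff w) c) := by
  rw [sdHomotopy, sdHomotopy]
  exact Tuples.map_coneHomotopy _
    (fun n c => by rw [AddMonoidHom.id_apply, AddMonoidHom.id_apply])
    (Tuples.map_sd fun n v => aff_bary w n v) (fun _ _ => rfl) n c

variable [Nonempty ι]

namespace BasedChains

/-- Barycentric subdivision of based chains. -/
def sd {k : ℕ} : BasedChains f k x →+ BasedChains f k x :=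
  natOp (Tuples.sd bary (k + 1) (vertices k))

/-- The homotopy between the identity and barycentric subdivision. -/
def sdHomotopy {k : ℕ} : BasedChains f k x →+ BasedChains f (k + 1) x :=
  natOp (LocalCoeff.sdHomotopy (k + 1) (vertices k))

lemma sd_push (H : C(stdSimplex ℝ ι, Z)) (p : stdSimplex ℝ ι)
    (γ : x ⟶ (⟨f (H p)⟩ : FundamentalGroupoid X)) {k : ℕ} (c : Tuples (stdSimplex ℝ ι) (k + 1)) :
    sd (push (f := f) H p γ c) = push H p γ (Tuples.sd bary (k + 1) c) := by
  suffices h : sd.comp (push (f := f) H p γ) = (push H p γ).comp (Tuples.sd bary (k + 1)) from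
    DFunLike.congr_fun h c
  refine lift_ext _ _ fun w => ?_
  rw [AddMonoidHom.comp_apply, sd, natOp_push, Tuples.map_sd fun n v => aff_bary w n v,
    map_aff_vertices]
  rfl

lemma sdHomotopy_push (H : C(stdSimplex ℝ ι, Z)) (p : stdSimplex ℝ ι)
    (γ : x ⟶ (⟨f (H p)⟩ : FundamentalGroupoid X)) {k : ℕ} (c : Tuples (stdSimplex ℝ ι) (k + 1)) :
    sdHomotopy (push (f := f) H p γ c) = push H p γ (LocalCoeff.sdHomotopy (k + 1) c) := by
  suffices h : sdHomotopy.comp (push (f := f) H p γ) =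
      (push H p γ).comp (LocalCoeff.sdHomotopy (k + 1)) from DFunLike.congr_fun h c
  refine lift_ext _ _ fun w => ?_
  rw [AddMonoidHom.comp_apply, sdHomotopy, natOp_push, map_aff_sdHomotopy, map_aff_vertices]
  rfl

lemma bd_sdHomotopy_zero (z : BasedChains f 0 x) : bd (sdHomotopy z) = z - sd z := by
  suffices h : bd.comp sdHomotopy = AddMonoidHom.id (BasedChains f 0 x) - sd from
    DFunLike.congr_fun h z
  refine lift_ext _ _ fun p => ?_
  rw [AddMonoidHom.comp_apply, AddMonoidHom.sub_apply, ← push_vertices, sdHomotopy_push, ← push_bd,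
    LocalCoeff.bd_sdHomotopy, sd_push, map_sub, map_sub]
  exact sub_eq_self.2 (map_zero _)

lemma bd_sdHomotopy {k : ℕ} (z : BasedChains f (k + 1) x) :
    bd (sdHomotopy z) = z - sd z - sdHomotopy (bd z) := by
  suffices h : bd.comp sdHomotopy = AddMonoidHom.id (BasedChains f (k + 1) x) - sd -
      sdHomotopy.comp bd from DFunLike.congr_fun h z
  refine lift_ext _ _ fun p => ?_
  rw [AddMonoidHom.comp_apply, AddMonoidHom.sub_apply, AddMonoidHom.sub_apply,
    AddMonoidHom.comp_apply, ← push_vertices, sdHomotopy_push, ← push_bd,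
    LocalCoeff.bd_sdHomotopy, sd_push, map_sub, map_sub, ← push_bd, sdHomotopy_push]
  rfl

lemma bd_sd {k : ℕ} (z : BasedChains f (k + 1) x) : bd (sd z) = sd (bd z) := by
  suffices h : bd.comp sd = sd.comp (bd (f := f) (x := x) (k := k)) from DFunLike.congr_fun h z
  refine lift_ext _ _ fun p => ?_
  rw [AddMonoidHom.comp_apply, AddMonoidHom.comp_apply, ← push_vertices, sd_push, ← push_bd,
    Tuples.bd_sd, ← push_bd, sd_push]

/-- Cycles; in degree `0` every chain is a cycle. -/
def IsCycle : ∀ {k : ℕ}, BasedChains f k x → Prop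
  | 0, _ => True
  | _ + 1, z => bd z = 0

lemma IsCycle.sd : ∀ {k : ℕ} {z : BasedChains f k x}, IsCycle z → IsCycle (BasedChains.sd z)
  | 0, _, _ => trivial
  | _ + 1, z, hz => by
    change BasedChains.bd (BasedChains.sd z) = 0
    have hz' : BasedChains.bd z = 0 := hz
    rw [bd_sd, hz', map_zero]

lemma IsCycle.exists_sd_eq : ∀ {k : ℕ} {z : BasedChains f k x}, IsCycle z →
    ∃ y : BasedChains f (k + 1) x, BasedChains.sd z = z + bd y
  | 0, z, _ => ⟨-sdHomotopy z, by rw [map_neg, bd_sdHomotopy_zero]; abel⟩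
  | _ + 1, z, hz => ⟨-sdHomotopy z, by
      have hz' : BasedChains.bd z = 0 := hz
      rw [map_neg, bd_sdHomotopy, hz', map_zero]; abel⟩

lemma IsCycle.exists_sd_iterate_eq {k : ℕ} {z : BasedChains f k x} (hz : IsCycle z) (m : ℕ) :
    IsCycle (BasedChains.sd^[m] z) ∧
      ∃ y : BasedChains f (k + 1) x, BasedChains.sd^[m] z = z + bd y := by
  induction m with
  | zero => exact ⟨hz, 0, by simp⟩
  | succ m ih =>
    obtain ⟨hc, y, hy⟩ := ih
    obtain ⟨y', hy'⟩ := hc.exists_sd_eq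
    rw [Function.iterate_succ_apply']
    exact ⟨hc.sd, y + y', by rw [hy', hy, map_add, add_assoc]⟩

lemma sd_iterate_push (H : C(stdSimplex ℝ ι, Z)) (p : stdSimplex ℝ ι)
    (γ : x ⟶ (⟨f (H p)⟩ : FundamentalGroupoid X)) {k : ℕ} (m : ℕ)
    (c : Tuples (stdSimplex ℝ ι) (k + 1)) :
    sd^[m] (push (f := f) H p γ c) = push H p γ ((Tuples.sd bary (k + 1))^[m] c) := by
  induction m with
  | zero => rfl
  | succ m ih => rw [Function.iterate_succ_apply', Function.iterate_succ_apply', ih, sd_push]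

/-- The based simplices whose image lies in a member of the family `𝒰`. -/
def small (f : C(Z, X)) (k : ℕ) (x : FundamentalGroupoid X) (𝒰 : Set (Set Z)) :
    Set (BasedSimplex f k x) :=
  {p | ∃ U ∈ 𝒰, Set.range p.1 ⊆ U}

variable {𝒰 : Set (Set Z)}

lemma push_mem_small {H : C(stdSimplex ℝ ι, Z)} {U : Set Z} (hU : U ∈ 𝒰)
    (hH : Set.range H ⊆ U) (p : stdSimplex ℝ ι)
    (γ : x ⟶ (⟨f (H p)⟩ : FundamentalGroupoid X)) {k : ℕ} (c : Tuples (stdSimplex ℝ ι) (k + 1)) :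
    push H p γ c ∈ spanned (small f k x 𝒰) := by
  refine map_mem_of_spanned (P := Set.univ) (push H p γ) (fun w _ => ?_) ?_
  · rw [push_of]
    refine of_mem_spanned ⟨U, hU, ?_⟩
    rintro _ ⟨t, rfl⟩
    exact hH ⟨aff w t, rfl⟩
  · refine FreeAbelianGroup.induction_on c (zero_mem _) (fun w => of_mem_spanned trivial)
      (fun w h => neg_mem h) fun a b ha hb => add_mem ha hb

lemma sd_mem_small {k : ℕ} {z : BasedChains f k x} (hz : z ∈ spanned (small f k x 𝒰)) :
    sd z ∈ spanned (small f k x 𝒰) := by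
  refine map_mem_of_spanned sd (fun p hp => ?_) hz
  obtain ⟨U, hU, hp⟩ := hp
  rw [← push_vertices, sd_push]
  exact push_mem_small hU hp _ _ _

lemma sd_iterate_mem_small {k : ℕ} {z : BasedChains f k x} {m n : ℕ} (hmn : m ≤ n)
    (hz : sd^[m] z ∈ spanned (small f k x 𝒰)) : sd^[n] z ∈ spanned (small f k x 𝒰) := by
  induction n, hmn using Nat.le_induction with
  | base => exact hz
  | succ n _ ih =>
    rw [Function.iterate_succ_apply']
    exact sd_mem_small ih

lemma exists_sd_iterate_of_mem_small (ho : ∀ U ∈ 𝒰, IsOpen U) (hc : ⋃₀ 𝒰 = Set.univ) {k : ℕ}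
    (p : BasedSimplex f k x) : ∃ m, sd^[m] (of p) ∈ spanned (small f k x 𝒰) := by
  obtain ⟨δ, hδ, hL⟩ := lebesgue_number_lemma_of_metric_sUnion
    (s := (Set.univ : Set (Simplex k))) (c := (fun U => p.1 ⁻¹' U) '' 𝒰) isCompact_univ
    (by rintro _ ⟨U, hU, rfl⟩; exact (ho U hU).preimage p.1.continuous) (by
      intro t _
      obtain ⟨U, hU, ht⟩ := Set.mem_sUnion.1 (hc ▸ Set.mem_univ (p.1 t))
      exact ⟨_, ⟨U, hU, rfl⟩, ht⟩)
  have hdist (i j : Fin (k + 1)) :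
      dist (stdSimplex.vertex i : Simplex k) (stdSimplex.vertex j) ≤ 1 :=
    dist_le_of_forall zero_le_one fun l => abs_sub_le_iff.2
      ⟨by linarith [stdSimplex.le_one (stdSimplex.vertex i : Simplex k) l,
        stdSimplex.zero_le (stdSimplex.vertex j : Simplex k) l],
      by linarith [stdSimplex.le_one (stdSimplex.vertex j : Simplex k) l,
        stdSimplex.zero_le (stdSimplex.vertex i : Simplex k) l]⟩
  have hκ : (k : ℝ) / (k + 1) < 1 := by
    rw [div_lt_one (by positivity)]
    exact lt_add_one _
  obtain ⟨m, hm⟩ := exists_pow_lt_of_lt_one hδ hκ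
  refine ⟨m, ?_⟩
  rw [← push_vertices, sd_iterate_push]
  refine map_mem_of_spanned (push p.1 (e₀ k) p.2) (fun w hw => ?_)
    (Tuples.sd_iterate_of_mem le_rfl hdist m)
  obtain ⟨_, ⟨U, hU, rfl⟩, hball⟩ := hL (w 0) trivial
  rw [push_of]
  refine of_mem_spanned ⟨U, hU, ?_⟩
  rintro _ ⟨t, rfl⟩
  refine hball (Metric.mem_ball'.2 (lt_of_le_of_lt (dist_aff_le ?_ (hw 0) t) (by simpa using hm)))
  positivity

/-- Every chain becomes small for a given open cover after enough subdivisions. -/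
lemma exists_sd_iterate_mem_small (ho : ∀ U ∈ 𝒰, IsOpen U) (hc : ⋃₀ 𝒰 = Set.univ) {k : ℕ}
    (z : BasedChains f k x) : ∃ m, sd^[m] z ∈ spanned (small f k x 𝒰) := by
  induction z using FreeAbelianGroup.induction_on with
  | zero => exact ⟨0, zero_mem _⟩
  | of p => exact exists_sd_iterate_of_mem_small ho hc p
  | neg p h =>
    obtain ⟨m, hm⟩ := h
    exact ⟨m, by rw [iterate_map_neg]; exact neg_mem hm⟩
  | add z z' h h' =>
    obtain ⟨m, hm⟩ := h
    obtain ⟨m', hm'⟩ := h'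
    refine ⟨max m m', ?_⟩
    rw [iterate_map_add]
    exact add_mem (sd_iterate_mem_small (le_max_left _ _) hm)
      (sd_iterate_mem_small (le_max_right _ _) hm')

/-- A cycle is homologous to a cycle that is small for a given open cover. -/
lemma IsCycle.exists_small (ho : ∀ U ∈ 𝒰, IsOpen U) (hc : ⋃₀ 𝒰 = Set.univ) {k : ℕ}
    {z : BasedChains f k x} (hz : IsCycle z) :
    ∃ y : BasedChains f (k + 1) x, IsCycle (z + bd y) ∧ z + bd y ∈ spanned (small f k x 𝒰) := by
  obtain ⟨m, hm⟩ := exists_sd_iterate_mem_small ho hc z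
  obtain ⟨h, y, hy⟩ := hz.exists_sd_iterate_eq m
  exact ⟨y, hy ▸ h, hy ▸ hm⟩

end BasedChains

end Subdivision

/-! ### Faces and segments in a simplex -/

section Simplices

variable {ι ι' : Type*} [Fintype ι] [Fintype ι']

/-- `stdSimplex.map` as a continuous map. -/
def mapC (θ : ι' → ι) : C(stdSimplex ℝ ι', stdSimplex ℝ ι) :=
  ⟨stdSimplex.map θ, stdSimplex.continuous_map θ⟩

lemma mapC_comp {ι'' : Type*} [Fintype ι''] (θ : ι' → ι) (η : ι'' → ι') :
    (mapC θ).comp (mapC η) = mapC (θ ∘ η) := by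
  ext1 t
  exact stdSimplex.map_comp_apply η θ t

lemma comp_mapC_id {X : Type*} [TopologicalSpace X] (σ : C(stdSimplex ℝ ι, X)) :
    σ.comp (mapC id) = σ := by
  ext1 t
  exact congrArg σ (stdSimplex.map_id_apply t)

lemma exists_map_eq {θ : ι' → ι} (hθ : Function.Injective θ) {y : stdSimplex ℝ ι}
    (hy : ∀ j ∉ Set.range θ, y j = 0) : ∃ w, stdSimplex.map θ w = y := by
  classical
  have hsum : ∑ i, y (θ i) = 1 := by
    rw [← stdSimplex.sum_eq_one y]
    exact Fintype.sum_of_injective θ hθ _ _ hy fun _ => rfl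
  refine ⟨⟨fun i => y (θ i), fun i => stdSimplex.zero_le y _, hsum⟩, ?_⟩
  ext j
  by_cases hj : j ∈ Set.range θ
  · obtain ⟨i, rfl⟩ := hj
    exact map_apply_of_injective hθ _ i
  · rw [map_apply_of_notMem θ _ hj, hy j hj]

/-- The point at time `s` of the segment from `x` to `y`. -/
def mix (s : unitInterval) (x y : stdSimplex ℝ ι) : stdSimplex ℝ ι :=
  ⟨AffineMap.lineMap x.1 y.1 (s : ℝ), (convex_stdSimplex ℝ _).lineMap_mem x.2 y.2 s.2⟩

lemma mix_apply (s : unitInterval) (x y : stdSimplex ℝ ι) (j : ι) :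
    mix s x y j = (1 - (s : ℝ)) * x j + s * y j := by
  change AffineMap.lineMap x.1 y.1 (s : ℝ) j = _
  rw [AffineMap.lineMap_apply_module]
  rfl

@[simp]
lemma mix_zero (x y : stdSimplex ℝ ι) : mix 0 x y = x := by
  ext j
  simp [mix_apply]

@[simp]
lemma mix_one (x y : stdSimplex ℝ ι) : mix 1 x y = y := by
  ext j
  simp [mix_apply]

lemma map_mix (θ : ι' → ι) (s : unitInterval) (x y : stdSimplex ℝ ι') :
    stdSimplex.map θ (mix s x y) = mix s (stdSimplex.map θ x) (stdSimplex.map θ y) := by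
  classical
  ext j
  simp only [map_apply_eq_sum, mix_apply, Finset.mul_sum, ← Finset.sum_add_distrib]
  exact Finset.sum_congr rfl fun i _ => by split_ifs <;> simp

lemma continuous_mix {A : Type*} [TopologicalSpace A] {s : A → unitInterval}
    {x y : A → stdSimplex ℝ ι} (hs : Continuous s) (hx : Continuous x) (hy : Continuous y) :
    Continuous fun a => mix (s a) (x a) (y a) := by
  refine Continuous.subtype_mk ?_ _
  simp only [AffineMap.lineMap_apply]
  fun_prop

end Simplices

/-! ### Pushing a simplex towards its large coordinates -/

section Sharpen

variable {ι ι' : Type*} [Fintype ι] [Fintype ι']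

/-- Half of the sum of the squares of the coordinates. At least one coordinate exceeds this
threshold, which is positive and does not change when zero coordinates are inserted. -/
def threshold (y : stdSimplex ℝ ι) : ℝ := (∑ i, y i ^ 2) / 2

lemma continuous_coord (j : ι) : Continuous fun y : stdSimplex ℝ ι => y j :=
  (continuous_apply j).comp continuous_subtype_val

lemma continuous_threshold : Continuous (threshold (ι := ι)) :=
  (continuous_finsetSum _ fun j _ => (continuous_coord j).pow 2).div_const 2

lemma threshold_pos (y : stdSimplex ℝ ι) : 0 < threshold y := by
  refine half_pos (lt_of_le_of_ne (Finset.sum_nonneg fun i _ => sq_nonneg _) fun h => ?_)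
  have h0 := (Finset.sum_eq_zero_iff_of_nonneg fun i _ => sq_nonneg (y i)).1 h.symm
  have := stdSimplex.sum_eq_one y
  rw [Finset.sum_eq_zero fun i hi => pow_eq_zero_iff two_ne_zero |>.1 (h0 i hi)] at this
  exact zero_ne_one this

lemma exists_threshold_lt (y : stdSimplex ℝ ι) : ∃ i, threshold y < y i := by
  by_contra! h
  have : ∑ i, y i ^ 2 ≤ threshold y := by
    calc ∑ i, y i ^ 2 ≤ ∑ i, y i * threshold y := Finset.sum_le_sum fun i _ => by
          rw [sq]
          exact mul_le_mul_of_nonneg_left (h i) (stdSimplex.zero_le y i)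
      _ = threshold y := by rw [← Finset.sum_mul, stdSimplex.sum_eq_one, one_mul]
  have hpos := threshold_pos y
  rw [threshold] at this hpos
  linarith

lemma sum_excess_pos (y : stdSimplex ℝ ι) : 0 < ∑ i, max (y i - threshold y) 0 := by
  obtain ⟨i, hi⟩ := exists_threshold_lt y
  exact Finset.sum_pos' (fun i _ => le_max_right _ _)
    ⟨i, Finset.mem_univ i, lt_max_of_lt_left (sub_pos.2 hi)⟩

/-- The self-map of a simplex that cuts all coordinates off at the threshold and rescales. It maps
each face to itself, and a neighbourhood of each face into that face. -/
def sharpen (y : stdSimplex ℝ ι) : stdSimplex ℝ ι :=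
  ⟨fun j => max (y j - threshold y) 0 / ∑ i, max (y i - threshold y) 0,
    fun _ => div_nonneg (le_max_right _ _) (sum_excess_pos y).le, by
      rw [← Finset.sum_div, div_self (sum_excess_pos y).ne']⟩

lemma sharpen_apply (y : stdSimplex ℝ ι) (j : ι) :
    sharpen y j = max (y j - threshold y) 0 / ∑ i, max (y i - threshold y) 0 := rfl

lemma sharpen_apply_eq_zero {y : stdSimplex ℝ ι} {j : ι} (h : y j ≤ threshold y) :
    sharpen y j = 0 := by
  rw [sharpen_apply, max_eq_right (sub_nonpos.2 h), zero_div]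

lemma continuous_sharpen : Continuous (sharpen (ι := ι)) := by
  have h (j : ι) : Continuous fun y : stdSimplex ℝ ι => max (y j - threshold y) 0 :=
    ((continuous_coord j).sub continuous_threshold).max continuous_const
  exact Continuous.subtype_mk (continuous_pi fun j => (h j).div
    (continuous_finsetSum _ fun i _ => h i) fun y => (sum_excess_pos y).ne') _

lemma sum_map_of_injective {θ : ι' → ι} (hθ : Function.Injective θ) (y : stdSimplex ℝ ι')
    {g : ℝ → ℝ} (hg : g 0 = 0) : ∑ j, g (stdSimplex.map θ y j) = ∑ i, g (y i) := by
  exact (Fintype.sum_of_injective θ hθ _ _ (fun j hj => by rw [map_apply_of_notMem θ y hj, hg])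
    fun i => by rw [map_apply_of_injective hθ]).symm

lemma threshold_map {θ : ι' → ι} (hθ : Function.Injective θ) (y : stdSimplex ℝ ι') :
    threshold (stdSimplex.map θ y) = threshold y := by
  rw [threshold, threshold, sum_map_of_injective hθ y (g := fun a => a ^ 2) (by simp)]

lemma sharpen_map {θ : ι' → ι} (hθ : Function.Injective θ) (y : stdSimplex ℝ ι') :
    sharpen (stdSimplex.map θ y) = stdSimplex.map θ (sharpen y) := by
  ext j
  rw [sharpen_apply, threshold_map hθ,
    sum_map_of_injective hθ y (g := fun a => max (a - threshold y) 0)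
      (max_eq_right (by linarith [threshold_pos y]))]
  by_cases hj : j ∈ Set.range θ
  · obtain ⟨i, rfl⟩ := hj
    rw [map_apply_of_injective hθ, map_apply_of_injective hθ, sharpen_apply]
  · rw [map_apply_of_notMem θ _ hj, map_apply_of_notMem θ _ hj,
      max_eq_right (by linarith [threshold_pos y]), zero_div]

end Sharpen

/-! ### Dominant faces -/

section Dominates

variable {m m' n : ℕ}

/-- The face `θ` of the simplex dominates the point `y` if the coordinates of `y` on that face are
positive and larger than all others, and if the others are below the threshold. -/
structure Dominates (y : Simplex n) (θ : Fin (m + 1) → Fin (n + 1)) : Prop where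
  strictMono : StrictMono θ
  pos : ∀ i, 0 < y (θ i)
  lt_threshold : ∀ j ∉ Set.range θ, y j < threshold y
  lt : ∀ j ∉ Set.range θ, ∀ i, y j < y (θ i)

lemma isOpen_dominates (θ : Fin (m + 1) → Fin (n + 1)) :
    IsOpen {y : Simplex n | Dominates y θ} := by
  by_cases hθ : StrictMono θ
  · have : {y : Simplex n | Dominates y θ} = (⋂ i, {y | 0 < y (θ i)}) ∩
        ⋂ j : {j // j ∉ Set.range θ}, {y | y j.1 < threshold y} ∩ ⋂ i, {y | y j.1 < y (θ i)} := by
      ext y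
      simp only [Set.mem_inter_iff, Set.mem_iInter, Set.mem_ofPred_eq]
      exact ⟨fun h => ⟨h.pos, fun j => ⟨h.lt_threshold j.1 j.2, h.lt j.1 j.2⟩⟩,
        fun h => ⟨hθ, h.1, fun j hj => (h.2 ⟨j, hj⟩).1, fun j hj => (h.2 ⟨j, hj⟩).2⟩⟩
    rw [this]
    refine IsOpen.inter (isOpen_iInter_of_finite fun i =>
      isOpen_lt continuous_const (continuous_coord _)) (isOpen_iInter_of_finite fun j => ?_)
    exact (isOpen_lt (continuous_coord _) continuous_threshold).inter
      (isOpen_iInter_of_finite fun i => isOpen_lt (continuous_coord _) (continuous_coord _))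
  · have : {y : Simplex n | Dominates y θ} = ∅ :=
      Set.eq_empty_of_forall_notMem fun y hy => hθ hy.strictMono
    rw [this]
    exact isOpen_empty

lemma exists_dominates (y : Simplex n) :
    ∃ (m : ℕ) (θ : Fin (m + 1) → Fin (n + 1)), Dominates y θ := by
  let E : Finset (Fin (n + 1)) := {i | threshold y ≤ y i}
  have hE : E.Nonempty := by
    obtain ⟨i, hi⟩ := exists_threshold_lt y
    exact ⟨i, by simpa [E] using hi.le⟩
  obtain ⟨m, hm⟩ : ∃ m, E.card = m + 1 := ⟨E.card - 1, by have := hE.card_pos; omega⟩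
  have hmem (i) : threshold y ≤ y (E.orderEmbOfFin hm i) := by
    exact (Finset.mem_filter.1 (E.orderEmbOfFin_mem hm i)).2
  have hnot (j) (hj : j ∉ Set.range (E.orderEmbOfFin hm)) : y j < threshold y := by
    rw [Finset.range_orderEmbOfFin] at hj
    simpa [E] using hj
  exact ⟨m, E.orderEmbOfFin hm, (E.orderEmbOfFin hm).strictMono,
    fun i => (threshold_pos y).trans_le (hmem i), hnot, fun j hj i => (hnot j hj).trans_le (hmem i)⟩

/-- The faces dominating a point are nested. -/
lemma Dominates.range_subset {y : Simplex n} {θ : Fin (m + 1) → Fin (n + 1)}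
    {θ' : Fin (m' + 1) → Fin (n + 1)} (h : Dominates y θ) (h' : Dominates y θ') (hm : m ≤ m') :
    Set.range θ ⊆ Set.range θ' := by
  rintro _ ⟨i, rfl⟩
  by_contra hi
  have hsub : Set.range θ' ⊂ Set.range θ := by
    refine Set.ssubset_iff_subset_ne.2 ⟨?_, fun heq => hi (heq ▸ ⟨i, rfl⟩)⟩
    rintro _ ⟨i', rfl⟩
    by_contra hi'
    exact lt_asymm (h.lt _ hi' i) (h'.lt _ hi i')
  have hcard := Set.ncard_lt_ncard hsub (Set.toFinite _)
  rw [← Set.image_univ, ← Set.image_univ, Set.ncard_image_of_injective _ h.strictMono.injective,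
    Set.ncard_image_of_injective _ h'.strictMono.injective, Set.ncard_univ, Set.ncard_univ,
    Nat.card_fin, Nat.card_fin] at hcard
  omega

lemma Dominates.unique {y : Simplex n} {θ θ' : Fin (m + 1) → Fin (n + 1)} (h : Dominates y θ)
    (h' : Dominates y θ') : θ = θ' :=
  (h.strictMono.range_inj h'.strictMono).1
    ((h.range_subset h' le_rfl).antisymm (h'.range_subset h le_rfl))

lemma exists_strictMono_factor {θ : Fin (m + 1) → Fin (n + 1)} {θ' : Fin (m' + 1) → Fin (n + 1)}
    (h : StrictMono θ) (h' : StrictMono θ') (hr : Set.range θ ⊆ Set.range θ') :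
    ∃ ψ : Fin (m + 1) → Fin (m' + 1), StrictMono ψ ∧ θ = θ' ∘ ψ := by
  choose ψ hψ using fun i => hr ⟨i, rfl⟩
  exact ⟨ψ, fun i j hij => h'.lt_iff_lt.1 (by rw [hψ, hψ]; exact h hij),
    funext fun i => (hψ i).symm⟩

lemma Dominates.sharpen_eq_zero {y : Simplex n} {θ : Fin (m + 1) → Fin (n + 1)}
    (h : Dominates y θ) {j : Fin (n + 1)} (hj : j ∉ Set.range θ) : sharpen y j = 0 :=
  sharpen_apply_eq_zero (h.lt_threshold j hj).le

lemma face_apply_succAbove (i : Fin (n + 2)) (y : Simplex n) (j : Fin (n + 1)) :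
    face i y (i.succAbove j) = y j :=
  map_apply_of_injective Fin.succAbove_right_injective y j

lemma face_apply_self (i : Fin (n + 2)) (y : Simplex n) : face i y i = 0 :=
  map_apply_of_notMem _ y (by simp)

lemma threshold_face (i : Fin (n + 2)) (y : Simplex n) : threshold (face i y) = threshold y :=
  threshold_map Fin.succAbove_right_injective y

lemma sharpen_face (i : Fin (n + 2)) (y : Simplex n) : sharpen (face i y) = face i (sharpen y) :=
  sharpen_map Fin.succAbove_right_injective y

lemma dominates_face_iff (i : Fin (n + 2)) (y : Simplex n) (θ : Fin (m + 1) → Fin (n + 1)) :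
    Dominates (face i y) (i.succAbove ∘ θ) ↔ Dominates y θ := by
  have hr (j) : i.succAbove j ∈ Set.range (i.succAbove ∘ θ) ↔ j ∈ Set.range θ := by
    rw [Set.range_comp, Fin.succAbove_right_injective.mem_set_image]
  constructor
  · intro h
    refine ⟨fun a b hab => (Fin.strictMono_succAbove i).lt_iff_lt.1 (h.strictMono hab),
      fun a => ?_, fun j hj => ?_, fun j hj a => ?_⟩
    · simpa only [Function.comp_apply, face_apply_succAbove] using h.pos a
    · simpa only [threshold_face, face_apply_succAbove] using
        h.lt_threshold _ (mt (hr j).1 hj)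
    · simpa only [Function.comp_apply, face_apply_succAbove] using h.lt _ (mt (hr j).1 hj) a
  · intro h
    refine ⟨(Fin.strictMono_succAbove i).comp h.strictMono, fun a => ?_, fun j hj => ?_,
      fun j hj a => ?_⟩
    · simpa only [Function.comp_apply, face_apply_succAbove] using h.pos a
    · refine Fin.succAboveCases i ?_ (fun j => ?_) j hj
      · intro _
        rw [face_apply_self]
        exact threshold_pos _
      · intro hj
        rw [face_apply_succAbove, threshold_face]
        exact h.lt_threshold _ (mt (hr j).2 hj)
    · rw [Function.comp_apply, face_apply_succAbove]
      refine Fin.succAboveCases i ?_ (fun j => ?_) j hj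
      · intro _
        rw [face_apply_self]
        exact h.pos a
      · intro hj
        rw [face_apply_succAbove]
        exact h.lt _ (mt (hr j).2 hj) a

lemma Dominates.exists_eq_succAbove_comp {i : Fin (n + 2)} {y : Simplex n}
    {θ : Fin (m + 1) → Fin (n + 2)} (h : Dominates (face i y) θ) :
    ∃ θ' : Fin (m + 1) → Fin (n + 1), θ = i.succAbove ∘ θ' := by
  have hne (a) : θ a ≠ i := by
    intro ha
    have := h.pos a
    rw [ha, face_apply_self] at this
    exact lt_irrefl _ this
  choose θ' hθ' using fun a => Fin.exists_succAbove_eq (hne a)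
  exact ⟨θ', funext fun a => (hθ' a).symm⟩

end Dominates

/-! ### Cells of the singular complex -/

section Cells

variable {X : Type u} [TopologicalSpace X] {m m' n k k' : ℕ}

/-- The characteristic map of the cell of `S X` indexed by the singular simplex `σ`. -/
def charMap (σ : C(Simplex n, X)) : C(Simplex n, SingularComplex X) where
  toFun t := Quot.mk _ ⟨⟨n, σ⟩, t⟩
  continuous_toFun := continuous_quot_mk.comp
    (continuous_sigmaMk (σ := fun s : Σ k : ℕ, C(Simplex k, X) => Simplex s.1) (i := ⟨n, σ⟩))

lemma exists_eq_charMap (p : SingularComplex X) :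
    ∃ (n : ℕ) (σ : C(Simplex n, X)) (y : Simplex n), p = charMap σ y := by
  obtain ⟨⟨⟨n, σ⟩, y⟩, rfl⟩ := Quot.exists_rep p
  exact ⟨n, σ, y, rfl⟩

lemma charMap_face (σ : C(Simplex (n + 1), X)) (i : Fin (n + 2)) (t : Simplex n) :
    charMap σ (face i t) = charMap (simplexFace σ i) t :=
  Quot.sound (Glue.face σ i t)

lemma charMap_map (σ : C(Simplex n, X)) {θ : Fin (m + 1) → Fin (n + 1)} (hθ : StrictMono θ)
    (t : Simplex m) : charMap σ (stdSimplex.map θ t) = charMap (σ.comp (mapC θ)) t := by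
  induction n with
  | zero =>
    obtain rfl : m = 0 := by
      have := Fintype.card_le_of_injective θ hθ.injective
      simp only [Fintype.card_fin] at this
      omega
    obtain rfl : θ = id := funext fun i => Fin.ext (by omega)
    rw [stdSimplex.map_id_apply, comp_mapC_id]
  | succ n ih =>
    by_cases hs : Function.Surjective θ
    · obtain rfl : m = n + 1 := by
        have := Fintype.card_of_bijective ⟨hθ.injective, hs⟩
        simpa using this
      obtain rfl : θ = id :=
        (hθ.range_inj strictMono_id).1 (by rw [hs.range_eq, Set.range_id])
      rw [stdSimplex.map_id_apply, comp_mapC_id]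
    · obtain ⟨i, hi⟩ := not_forall.1 hs
      choose θ' hθ' using fun a => Fin.exists_succAbove_eq fun h => hi ⟨a, h⟩
      obtain rfl : θ = i.succAbove ∘ θ' := funext fun a => (hθ' a).symm
      have hmono : StrictMono θ' := fun a b hab =>
        (Fin.strictMono_succAbove i).lt_iff_lt.1 (hθ hab)
      rw [← stdSimplex.map_comp_apply]
      refine (charMap_face σ i _).trans ?_
      rw [ih (simplexFace σ i) hmono, simplexFace, ContinuousMap.comp_assoc]
      exact congrArg (fun g => charMap (σ.comp g) t) (mapC_comp i.succAbove θ')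

lemma continuous_charMap_mix {A : Type*} [TopologicalSpace A] (σ : C(Simplex n, X))
    {s : A → unitInterval} {x y : A → Simplex n} (hs : Continuous s) (hx : Continuous x)
    (hy : Continuous y) : Continuous fun a => charMap σ (mix (s a) (x a) (y a)) :=
  (charMap σ).continuous.comp (continuous_mix hs hx hy)

/-- The straight path from a point `y` of a cell to `sharpen y`. -/
def sharpenPath (σ : C(Simplex n, X)) (y : Simplex n) : C(unitInterval, SingularComplex X) where
  toFun s := charMap σ (mix s y (sharpen y))
  continuous_toFun := continuous_charMap_mix σ continuous_id continuous_const continuous_const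

lemma continuous_sharpenPath (σ : C(Simplex n, X)) : Continuous (sharpenPath σ) :=
  (ContinuousMap.curry ⟨fun p : Simplex n × unitInterval => charMap σ (mix p.2 p.1 (sharpen p.1)),
    continuous_charMap_mix σ continuous_snd continuous_fst
      (continuous_sharpen.comp continuous_fst)⟩).continuous

lemma sharpenPath_face (σ : C(Simplex (n + 1), X)) (i : Fin (n + 2)) (t : Simplex n) :
    sharpenPath σ (face i t) = sharpenPath (simplexFace σ i) t := by
  ext1 s
  change charMap σ (mix s (face i t) (sharpen (face i t))) =
    charMap (simplexFace σ i) (mix s t (sharpen t))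
  rw [sharpen_face, ← charMap_face]
  exact congrArg _ (map_mix i.succAbove s t (sharpen t)).symm

/-- The homotopy `S X → (unitInterval → S X)` from the identity which moves every point `y` of a
cell straight to `sharpen y`. -/
def sharpenHomotopy (X : Type u) [TopologicalSpace X] :
    C(SingularComplex X, C(unitInterval, SingularComplex X)) where
  toFun := Quot.lift (fun q : SimplexUnion X => sharpenPath q.1.2 q.2) (by
    rintro _ _ ⟨σ, i, t⟩
    exact sharpenPath_face σ i t)
  continuous_toFun :=
    continuous_quot_lift _ (continuous_sigma fun q => continuous_sharpenPath q.2)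

lemma sharpenHomotopy_charMap (σ : C(Simplex n, X)) (y : Simplex n) (s : unitInterval) :
    sharpenHomotopy X (charMap σ y) s = charMap σ (mix s y (sharpen y)) := rfl

/-- The points of `S X` near the cell of `a`: those which, in some cell of which `a` is the face
`θ`, are a point `y` dominated by `θ` such that `P y θ`. For compatible conditions `P` the choice of
the cell does not matter, so that the definition descends to the quotient. -/
def nearCell (a : C(Simplex m, X)) (P : ∀ n, Simplex n → (Fin (m + 1) → Fin (n + 1)) → Prop)
    (hP : ∀ n (i : Fin (n + 2)) y θ, P (n + 1) (face i y) (i.succAbove ∘ θ) ↔ P n y θ) :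
    Set (SingularComplex X) :=
  Quot.lift (fun q : SimplexUnion X => ∃ θ : Fin (m + 1) → Fin (q.1.1 + 1),
    Dominates q.2 θ ∧ a = q.1.2.comp (mapC θ) ∧ P q.1.1 q.2 θ) (by
  rintro _ _ ⟨σ, i, t⟩
  refine propext ⟨?_, ?_⟩
  · rintro ⟨θ, hθ, ha, h⟩
    obtain ⟨θ', rfl⟩ := hθ.exists_eq_succAbove_comp
    refine ⟨θ', (dominates_face_iff i t θ').1 hθ, ?_, (hP _ _ _ _).1 h⟩
    rw [ha, simplexFace, ContinuousMap.comp_assoc]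
    exact congrArg _ (mapC_comp i.succAbove θ').symm
  · rintro ⟨θ', hθ, ha, h⟩
    refine ⟨i.succAbove ∘ θ', (dominates_face_iff i t θ').2 hθ, ?_, (hP _ _ _ _).2 h⟩
    rw [ha, simplexFace, ContinuousMap.comp_assoc]
    exact congrArg _ (mapC_comp i.succAbove θ'))

lemma charMap_mem_nearCell {a : C(Simplex m, X)}
    {P : ∀ n, Simplex n → (Fin (m + 1) → Fin (n + 1)) → Prop}
    {hP : ∀ n (i : Fin (n + 2)) y θ, P (n + 1) (face i y) (i.succAbove ∘ θ) ↔ P n y θ}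
    {σ : C(Simplex n, X)} {y : Simplex n} : charMap σ y ∈ nearCell a P hP ↔
      ∃ θ : Fin (m + 1) → Fin (n + 1), Dominates y θ ∧ a = σ.comp (mapC θ) ∧ P n y θ :=
  Iff.rfl

lemma isOpen_nearCell (a : C(Simplex m, X))
    (P : ∀ n, Simplex n → (Fin (m + 1) → Fin (n + 1)) → Prop)
    (hP : ∀ n (i : Fin (n + 2)) y θ, P (n + 1) (face i y) (i.succAbove ∘ θ) ↔ P n y θ)
    (ho : ∀ n θ, IsOpen {y | P n y θ}) : IsOpen (nearCell a P hP) := by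
  have hq : Topology.IsQuotientMap (Quot.mk (Glue X) : SimplexUnion X → SingularComplex X) :=
    isQuotientMap_quot_mk
  refine hq.isOpen_preimage.1 (isOpen_sigma_iff.2 ?_)
  rintro ⟨n, σ⟩
  change IsOpen {y : Simplex n | ∃ θ : Fin (m + 1) → Fin (n + 1),
    Dominates y θ ∧ a = σ.comp (mapC θ) ∧ P n y θ}
  have : {y : Simplex n | ∃ θ : Fin (m + 1) → Fin (n + 1),
      Dominates y θ ∧ a = σ.comp (mapC θ) ∧ P n y θ} =
      ⋃ (θ : Fin (m + 1) → Fin (n + 1)) (_ : a = σ.comp (mapC θ)),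
        {y | Dominates y θ} ∩ {y | P n y θ} := by
    ext y
    simp only [Set.mem_iUnion, Set.mem_inter_iff, Set.mem_ofPred_eq, exists_prop]
    exact exists_congr fun θ => by tauto
  rw [this]
  exact isOpen_iUnion fun θ => isOpen_iUnion fun _ => (isOpen_dominates θ).inter (ho n θ)

/-- The points near the cell of `a` whose image under sharpening has coordinates in `S` on that
cell. -/
def coordNear (a : C(Simplex m, X)) (S : Set (Fin (m + 1) → ℝ)) : Set (SingularComplex X) :=
  nearCell a (fun _ y θ => (fun i => sharpen y (θ i)) ∈ S) fun n i y θ => by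
    simp only [sharpen_face, Function.comp_apply, face_apply_succAbove]

/-- The open set of all points near the cell of `a`. -/
def near (a : C(Simplex m, X)) : Set (SingularComplex X) := coordNear a Set.univ

lemma charMap_mem_coordNear {a : C(Simplex m, X)} {S : Set (Fin (m + 1) → ℝ)}
    {σ : C(Simplex n, X)} {y : Simplex n} : charMap σ y ∈ coordNear a S ↔
      ∃ θ : Fin (m + 1) → Fin (n + 1), Dominates y θ ∧ a = σ.comp (mapC θ) ∧
        (fun i => sharpen y (θ i)) ∈ S :=
  Iff.rfl

lemma charMap_mem_near {a : C(Simplex m, X)} {σ : C(Simplex n, X)} {y : Simplex n} :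
    charMap σ y ∈ near a ↔
      ∃ θ : Fin (m + 1) → Fin (n + 1), Dominates y θ ∧ a = σ.comp (mapC θ) :=
  exists_congr fun _ => and_congr_right fun _ => and_iff_left trivial

lemma isOpen_coordNear (a : C(Simplex m, X)) {S : Set (Fin (m + 1) → ℝ)} (hS : IsOpen S) :
    IsOpen (coordNear a S) :=
  isOpen_nearCell _ _ _ fun _ θ =>
    hS.preimage (continuous_pi fun i => (continuous_coord (θ i)).comp continuous_sharpen)

lemma isOpen_near (a : C(Simplex m, X)) : IsOpen (near a) := isOpen_coordNear a isOpen_univ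

/-- The open cover of `S X` by the sets of points near a cell. -/
def nearCover (X : Type u) [TopologicalSpace X] : Set (Set (SingularComplex X)) :=
  {U | ∃ (m : ℕ) (a : C(Simplex m, X)), U = near a}

lemma isOpen_of_mem_nearCover {U : Set (SingularComplex X)} (hU : U ∈ nearCover X) : IsOpen U := by
  obtain ⟨m, a, rfl⟩ := hU
  exact isOpen_near a

lemma sUnion_nearCover : ⋃₀ nearCover X = Set.univ := by
  refine Set.eq_univ_of_forall fun p => ?_
  obtain ⟨n, σ, y, rfl⟩ := exists_eq_charMap p
  obtain ⟨m, θ, hθ⟩ := exists_dominates y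
  exact ⟨_, ⟨m, σ.comp (mapC θ), rfl⟩, charMap_mem_near.2 ⟨θ, hθ, rfl⟩⟩

/-- A chart of a singular simplex `τ` of `S X` in the cell of `a`: all points of `τ` are near
that cell, and sharpening moves `τ x` to the point `ρ x` of the cell. -/
def IsChart (τ : C(Simplex k, SingularComplex X)) (a : C(Simplex m, X))
    (ρ : C(Simplex k, Simplex m)) : Prop :=
  ∀ x, τ x ∈ coordNear a {(ρ x).1}

lemma charMap_mem_coordNear_singleton {a : C(Simplex m, X)} {w : Simplex m} {σ : C(Simplex n, X)}
    {y : Simplex n} : charMap σ y ∈ coordNear a {w.1} ↔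
      ∃ θ : Fin (m + 1) → Fin (n + 1), Dominates y θ ∧ a = σ.comp (mapC θ) ∧
        sharpen y = stdSimplex.map θ w := by
  refine exists_congr fun θ => and_congr_right fun hθ => and_congr_right fun _ => ?_
  change (fun i => sharpen y (θ i)) = w.1 ↔ _
  constructor
  · intro h
    ext j
    by_cases hj : j ∈ Set.range θ
    · obtain ⟨i, rfl⟩ := hj
      rw [map_apply_of_injective hθ.strictMono.injective]
      exact congrFun h i
    · rw [hθ.sharpen_eq_zero hj, map_apply_of_notMem _ _ hj]
  · intro h
    funext i
    rw [h, map_apply_of_injective hθ.strictMono.injective]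
    rfl

lemma mem_of_mem_coordNear {a : C(Simplex m, X)} {w : Simplex m} {S : Set (Fin (m + 1) → ℝ)}
    {p : SingularComplex X} (hw : p ∈ coordNear a {w.1}) (hS : p ∈ coordNear a S) : w.1 ∈ S := by
  obtain ⟨n, σ, y, rfl⟩ := exists_eq_charMap p
  obtain ⟨θ, hθ, -, h⟩ := charMap_mem_nearCell.1 hw
  obtain ⟨θ', hθ', -, h'⟩ := charMap_mem_nearCell.1 hS
  obtain rfl := hθ.unique hθ'
  rwa [← Set.mem_singleton_iff.1 h]

lemma exists_mem_coordNear {a : C(Simplex m, X)} {p : SingularComplex X} (hp : p ∈ near a) :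
    ∃ w : Simplex m, p ∈ coordNear a {w.1} := by
  obtain ⟨n, σ, y, rfl⟩ := exists_eq_charMap p
  obtain ⟨θ, hθ, ha⟩ := charMap_mem_near.1 hp
  obtain ⟨w, hw⟩ := exists_map_eq hθ.strictMono.injective fun j hj => hθ.sharpen_eq_zero hj
  exact ⟨w, charMap_mem_coordNear_singleton.2 ⟨θ, hθ, ha, hw.symm⟩⟩

lemma exists_isChart {τ : C(Simplex k, SingularComplex X)} {a : C(Simplex m, X)}
    (h : Set.range τ ⊆ near a) : ∃ ρ, IsChart τ a ρ := by
  choose ρ hρ using fun x => exists_mem_coordNear (h ⟨x, rfl⟩)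
  refine ⟨⟨ρ, continuous_def.2 ?_⟩, hρ⟩
  rintro _ ⟨V, hV, rfl⟩
  have : ρ ⁻¹' (Subtype.val ⁻¹' V) = τ ⁻¹' coordNear a V := by
    ext x
    refine ⟨fun hx => ?_, fun hx => mem_of_mem_coordNear (hρ x) hx⟩
    obtain ⟨n, σ, y, hy⟩ := exists_eq_charMap (τ x)
    have hx' := hρ x
    rw [Set.mem_preimage, hy]
    rw [hy] at hx'
    obtain ⟨θ, hθ, ha, h⟩ := charMap_mem_nearCell.1 hx'
    refine charMap_mem_nearCell.2 ⟨θ, hθ, ha, ?_⟩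
    rw [Set.mem_singleton_iff.1 h]
    exact hx
  rw [this]
  exact (isOpen_coordNear a hV).preimage τ.continuous

/-- The points near the cell of `a'` at which the face `ψ` of that cell is dominant as well. -/
def nearFace (a' : C(Simplex m', X)) (ψ : Fin (m + 1) → Fin (m' + 1)) : Set (SingularComplex X) :=
  nearCell a' (fun _ y θ => Dominates y (θ ∘ ψ)) fun _ i y θ => dominates_face_iff i y (θ ∘ ψ)

lemma isOpen_nearFace (a' : C(Simplex m', X)) (ψ : Fin (m + 1) → Fin (m' + 1)) :
    IsOpen (nearFace a' ψ) :=
  isOpen_nearCell _ _ _ fun _ θ => isOpen_dominates (θ ∘ ψ)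

lemma exists_mem_nearFace {a : C(Simplex m, X)} {a' : C(Simplex m', X)} (hm : m ≤ m')
    {p : SingularComplex X} (h : p ∈ near a) (h' : p ∈ near a') :
    ∃ ψ : Fin (m + 1) → Fin (m' + 1), StrictMono ψ ∧ p ∈ nearFace a' ψ := by
  obtain ⟨n, σ, y, rfl⟩ := exists_eq_charMap p
  obtain ⟨θ, hθ, -⟩ := charMap_mem_near.1 h
  obtain ⟨θ', hθ', ha'⟩ := charMap_mem_near.1 h'
  obtain ⟨ψ, hψ, rfl⟩ :=
    exists_strictMono_factor hθ.strictMono hθ'.strictMono (hθ.range_subset hθ' hm)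
  exact ⟨ψ, hψ, charMap_mem_nearCell.2 ⟨θ', hθ', ha', hθ⟩⟩

lemma eq_of_mem_nearFace {a' : C(Simplex m', X)} {ψ ψ' : Fin (m + 1) → Fin (m' + 1)}
    {p : SingularComplex X} (h : p ∈ nearFace a' ψ) (h' : p ∈ nearFace a' ψ') : ψ = ψ' := by
  obtain ⟨n, σ, y, rfl⟩ := exists_eq_charMap p
  obtain ⟨θ, hθ, -, hψ⟩ := charMap_mem_nearCell.1 h
  obtain ⟨θ', hθ', -, hψ'⟩ := charMap_mem_nearCell.1 h'
  obtain rfl := hθ.unique hθ'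
  exact funext fun i => hθ.strictMono.injective (congrFun (hψ.unique hψ') i)

lemma face_of_mem_nearFace {a : C(Simplex m, X)} {a' : C(Simplex m', X)}
    {ψ : Fin (m + 1) → Fin (m' + 1)} {p : SingularComplex X} {w : Simplex m} {w' : Simplex m'}
    (h : p ∈ nearFace a' ψ) (hw : p ∈ coordNear a {w.1})
    (hw' : p ∈ coordNear a' {w'.1}) : a = a'.comp (mapC ψ) ∧ w' = stdSimplex.map ψ w := by
  obtain ⟨n, σ, y, rfl⟩ := exists_eq_charMap p
  obtain ⟨θ', hθ', -, hθ'ψ⟩ := charMap_mem_nearCell.1 h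
  obtain ⟨θ, hθ, ha, hy⟩ := charMap_mem_coordNear_singleton.1 hw
  obtain ⟨θ'', hθ'', ha', hy'⟩ := charMap_mem_coordNear_singleton.1 hw'
  obtain rfl := hθ.unique hθ'ψ
  obtain rfl := hθ'.unique hθ''
  refine ⟨?_, map_injective hθ'.strictMono.injective ?_⟩
  · rw [ha, ha', ContinuousMap.comp_assoc, mapC_comp]
  · rw [← hy', hy, stdSimplex.map_comp_apply]

/-- Two charts of the same simplex differ by a face inclusion. Pointwise the face inclusion is
clear, since dominant faces are nested, and it is constant because the simplex is connected. -/
lemma IsChart.exists_face {τ : C(Simplex k, SingularComplex X)} {a : C(Simplex m, X)}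
    {ρ : C(Simplex k, Simplex m)} {a' : C(Simplex m', X)} {ρ' : C(Simplex k, Simplex m')}
    (h : IsChart τ a ρ) (h' : IsChart τ a' ρ') (hm : m ≤ m') :
    ∃ ψ : Fin (m + 1) → Fin (m' + 1), StrictMono ψ ∧ a = a'.comp (mapC ψ) ∧
      ∀ x, ρ' x = stdSimplex.map ψ (ρ x) := by
  have hnear {m : ℕ} {a : C(Simplex m, X)} {w : Fin (m + 1) → ℝ} {p : SingularComplex X}
      (hp : p ∈ coordNear a {w}) : p ∈ near a := by
    obtain ⟨n, σ, y, rfl⟩ := exists_eq_charMap p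
    obtain ⟨θ, hθ, ha, -⟩ := charMap_mem_coordNear.1 hp
    exact charMap_mem_near.2 ⟨θ, hθ, ha⟩
  choose ψ hψ hψn using fun x => exists_mem_nearFace hm (hnear (h x)) (hnear (h' x))
  have hloc : IsLocallyConstant ψ := by
    refine (IsLocallyConstant.iff_exists_open ψ).2 fun x =>
      ⟨τ ⁻¹' nearFace a' (ψ x), (isOpen_nearFace a' (ψ x)).preimage τ.continuous, hψn x,
        fun x' hx' => eq_of_mem_nearFace (hψn x') hx'⟩
  have hconst (x) : ψ x = ψ (e₀ k) := hloc.apply_eq_of_preconnectedSpace x (e₀ k)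
  refine ⟨ψ (e₀ k), hψ _, (face_of_mem_nearFace (hψn _) (h _) (h' _)).1, fun x => ?_⟩
  rw [← hconst x]
  exact (face_of_mem_nearFace (hψn _) (h _) (h' _)).2

end Cells

/-! ### Deforming small simplices to cells -/

section Deform

variable {X : Type u} [TopologicalSpace X] {m m' n k k' : ℕ}

/-- The simplex of `X` that `a` makes of the affine map `Δ^{k+1+m} → Δ^m` which takes the first
`k + 1` vertices to the points `ρ e_i` and the others to the vertices of `Δ^m`. -/
def joinSimplex (a : C(Simplex m, X)) (ρ : C(Simplex k, Simplex m)) :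
    C(Simplex (k + 1 + m), X) :=
  a.comp (aff (Fin.append (m := k + 1) (n := m + 1) (fun i => ρ (stdSimplex.vertex i))
    fun j => stdSimplex.vertex j))

/-- The vertices of the front `k`-face of `Δ^{k+1+m}`. -/
def frontIdx (k m : ℕ) : Fin (k + 1) → Fin (k + 1 + m + 1) :=
  Fin.castAdd (n := k + 1) (m + 1)

/-- The vertices of the back `m`-face of `Δ^{k+1+m}`. -/
def backIdx (k m : ℕ) : Fin (m + 1) → Fin (k + 1 + m + 1) :=
  Fin.natAdd (m := m + 1) (k + 1)

lemma strictMono_frontIdx : StrictMono (frontIdx k m) := Fin.strictMono_castAdd _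

lemma strictMono_backIdx : StrictMono (backIdx k m) := Fin.strictMono_natAdd _

/-- The straight homotopy, inside the cell of `joinSimplex a ρ`, from `ρ` on the back face to the
identity of the front face. -/
def slide (a : C(Simplex m, X)) (ρ : C(Simplex k, Simplex m)) (s : unitInterval) (x : Simplex k) :
    SingularComplex X :=
  charMap (joinSimplex a ρ)
    (mix s (stdSimplex.map (backIdx k m) (ρ x)) (stdSimplex.map (frontIdx k m) x))

lemma continuous_slide (a : C(Simplex m, X)) (ρ : C(Simplex k, Simplex m)) :
    Continuous fun p : unitInterval × Simplex k => slide a ρ p.1 p.2 :=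
  continuous_charMap_mix _ continuous_fst
    (((mapC (backIdx k m)).comp ρ).continuous.comp continuous_snd)
    ((mapC (frontIdx k m)).continuous.comp continuous_snd)

lemma slide_zero (a : C(Simplex m, X)) (ρ : C(Simplex k, Simplex m)) (x : Simplex k) :
    slide a ρ 0 x = charMap a (ρ x) := by
  rw [slide, mix_zero, charMap_map _ strictMono_backIdx]
  congr 2
  ext1 t
  refine congrArg a ((aff_map _ _ t).trans ?_)
  have : (Fin.append (m := k + 1) (n := m + 1) (fun i => ρ (stdSimplex.vertex i))
      fun j => stdSimplex.vertex j) ∘ backIdx k m = fun j => stdSimplex.vertex j :=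
    funext fun j => Fin.append_right _ _ j
  rw [this, aff_vertices]
  rfl

lemma slide_one (a : C(Simplex m, X)) (ρ : C(Simplex k, Simplex m)) (x : Simplex k) :
    slide a ρ 1 x = charMap (a.comp (aff fun i => ρ (stdSimplex.vertex i))) x := by
  rw [slide, mix_one, charMap_map _ strictMono_frontIdx]
  congr 2
  ext1 t
  refine congrArg a ((aff_map _ _ t).trans ?_)
  have : (Fin.append (m := k + 1) (n := m + 1) (fun i => ρ (stdSimplex.vertex i))
      fun j => stdSimplex.vertex j) ∘ frontIdx k m = fun i => ρ (stdSimplex.vertex i) :=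
    funext fun j => Fin.append_left _ _ j
  rw [this]

/-- The slide is compatible with passing to faces of the simplex and of the cell. -/
lemma slide_map {a : C(Simplex m, X)} {ρ : C(Simplex k, Simplex m)} {a' : C(Simplex m', X)}
    {ρ' : C(Simplex k', Simplex m')} {α : Fin (k + 1) → Fin (k' + 1)} (hα : StrictMono α)
    {ψ : Fin (m + 1) → Fin (m' + 1)} (hψ : StrictMono ψ) (ha : a = a'.comp (mapC ψ))
    (hρ : ∀ x, ρ' (stdSimplex.map α x) = stdSimplex.map ψ (ρ x)) (s : unitInterval)
    (x : Simplex k) : slide a' ρ' s (stdSimplex.map α x) = slide a ρ s x := by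
  let φ : Fin (k + 1 + m + 1) → Fin (k' + 1 + m' + 1) :=
    Fin.append (m := k + 1) (n := m + 1) (frontIdx k' m' ∘ α) (backIdx k' m' ∘ ψ)
  have hfront : φ ∘ frontIdx k m = frontIdx k' m' ∘ α := funext fun i => Fin.append_left _ _ i
  have hback : φ ∘ backIdx k m = backIdx k' m' ∘ ψ := funext fun i => Fin.append_right _ _ i
  have hφ : StrictMono φ := by
    intro i j
    refine Fin.addCases (m := k + 1) (n := m + 1) (fun i => ?_) (fun i => ?_) i <;>
    refine Fin.addCases (m := k + 1) (n := m + 1) (fun j => ?_) (fun j => ?_) j <;> intro hij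
    · have h1 := congrFun hfront i
      have h2 := congrFun hfront j
      simp only [Function.comp_apply, frontIdx] at h1 h2
      rw [h1, h2]
      exact strictMono_frontIdx (hα (strictMono_frontIdx.lt_iff_lt.1 hij))
    · have h1 := congrFun hfront i
      have h2 := congrFun hback j
      simp only [Function.comp_apply, frontIdx, backIdx] at h1 h2
      rw [h1, h2, Fin.lt_def]
      simp only [Fin.val_castAdd, Fin.val_natAdd]
      omega
    · rw [Fin.lt_def] at hij
      simp only [Fin.val_castAdd, Fin.val_natAdd] at hij
      omega
    · have h1 := congrFun hback i
      have h2 := congrFun hback j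
      simp only [Function.comp_apply, backIdx] at h1 h2
      rw [h1, h2]
      exact strictMono_backIdx (hψ (strictMono_backIdx.lt_iff_lt.1 hij))
  have hjoin : (joinSimplex a' ρ').comp (mapC φ) = joinSimplex a ρ := by
    ext1 t
    rw [joinSimplex, joinSimplex, ha]
    refine congrArg a' ?_
    refine Eq.trans (aff_map _ φ t) (Eq.trans ?_ (map_aff ψ _ t).symm)
    congr 2
    funext i
    refine Fin.addCases (m := k + 1) (n := m + 1) (fun i => ?_) (fun i => ?_) i
    · have h1 := congrFun hfront i
      simp only [Function.comp_apply, frontIdx] at h1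
      rw [Function.comp_apply, h1, Fin.append_left, Fin.append_left, ← hρ, stdSimplex.map_vertex]
    · have h1 := congrFun hback i
      simp only [Function.comp_apply, backIdx] at h1
      rw [Function.comp_apply, h1, Fin.append_right, Fin.append_right, stdSimplex.map_vertex]
  rw [slide, slide, ← hjoin, ← charMap_map _ hφ, map_mix, stdSimplex.map_comp_apply,
    stdSimplex.map_comp_apply, hρ, stdSimplex.map_comp_apply, stdSimplex.map_comp_apply]
  congr 2
  · exact congrArg₂ _ hback.symm rfl
  · exact congrArg₂ _ hfront.symm rfl

/-- The deformation of a simplex `τ` with a chart to a characteristic map: sharpening, followed by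
the slide. -/
def deform {τ : C(Simplex k, SingularComplex X)} {a : C(Simplex m, X)}
    {ρ : C(Simplex k, Simplex m)} (h : IsChart τ a ρ) :
    ContinuousMap.Homotopy τ (charMap (a.comp (aff fun i => ρ (stdSimplex.vertex i)))) :=
  ContinuousMap.Homotopy.trans (f₁ := (charMap a).comp ρ)
    { toFun := fun p => sharpenHomotopy X (τ p.2) p.1
      continuous_toFun := ((sharpenHomotopy X).comp τ).uncurry.continuous.comp continuous_swap
      map_zero_left := fun x => by
        obtain ⟨n, σ, y, hy⟩ := exists_eq_charMap (τ x)
        simp only [hy, sharpenHomotopy_charMap, mix_zero]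
      map_one_left := fun x => by
        obtain ⟨n, σ, y, hy⟩ := exists_eq_charMap (τ x)
        have hx := h x
        rw [hy] at hx
        obtain ⟨θ, hθ, ha, hw⟩ := charMap_mem_coordNear_singleton.1 hx
        simp only [hy, sharpenHomotopy_charMap, mix_one, hw, ContinuousMap.comp_apply]
        rw [charMap_map _ hθ.strictMono, ← ha] }
    { toFun := fun p => slide a ρ p.1 p.2
      continuous_toFun := continuous_slide a ρ
      map_zero_left := slide_zero a ρ
      map_one_left := slide_one a ρ }

lemma IsChart.face {τ : C(Simplex (k + 1), SingularComplex X)} {a : C(Simplex m, X)}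
    {ρ : C(Simplex (k + 1), Simplex m)} (h : IsChart τ a ρ) (i : Fin (k + 2)) :
    IsChart (simplexFace τ i) a (ρ.comp (LocalCoeff.face i)) :=
  fun x => h (LocalCoeff.face i x)

/-- The deformation does not depend on the charts and is compatible with faces. -/
lemma deform_face {τ : C(Simplex (k + 1), SingularComplex X)} {i : Fin (k + 2)}
    {a : C(Simplex m, X)} {ρ : C(Simplex k, Simplex m)} (h : IsChart (simplexFace τ i) a ρ)
    {a' : C(Simplex m', X)} {ρ' : C(Simplex (k + 1), Simplex m')} (h' : IsChart τ a' ρ')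
    (s : unitInterval) (x : Simplex k) : deform h' (s, face i x) = deform h (s, x) := by
  have hslide (s) : slide a' ρ' s (face i x) = slide a ρ s x := by
    have hα := Fin.strictMono_succAbove i
    obtain hm | hm := le_total m m'
    · obtain ⟨ψ, hψ, ha, hρ⟩ := h.exists_face (h'.face i) hm
      exact slide_map hα hψ ha hρ s x
    · obtain ⟨ψ, hψ, ha, hρ⟩ := (h'.face i).exists_face h hm
      -- both sides agree with the slide of the face in the chart of `τ`
      have h1 := slide_map (ρ' := ρ') (ρ := ρ'.comp (face i)) (a' := a') hα strictMono_id
        (a := a') (by ext1 t; exact congrArg a' (stdSimplex.map_id_apply t).symm)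
        (fun x => (stdSimplex.map_id_apply _).symm) s x
      have h2 := slide_map (ρ' := ρ) (ρ := ρ'.comp (face i)) (k := k) strictMono_id hψ ha
        (fun x => by rw [stdSimplex.map_id_apply]; exact hρ x) s x
      rw [stdSimplex.map_id_apply] at h2
      exact h1.trans h2.symm
  rw [deform, deform, ContinuousMap.Homotopy.trans_apply, ContinuousMap.Homotopy.trans_apply]
  split_ifs
  · rfl
  · exact hslide _

end Deform

/-! ### The prism operator -/

section Prism

open FreeAbelianGroup

/-- The triangulation of the prism over ordered chains, as a homotopy between the inclusions of its
bottom and its top. -/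
def prism {V : Type*} (n : ℕ) : Tuples V n →+ Tuples (V × Fin 2) (n + 1) :=
  Tuples.coneHomotopy (fun _ => Tuples.map fun a => (a, 1)) (fun _ => Tuples.map fun a => (a, 0))
    (fun _ w => (w 0, 0)) n

lemma prism_zero {V : Type*} (c : Tuples V 0) : prism 0 c = 0 := rfl

lemma bd_prism {V : Type*} (n : ℕ) (c : Tuples V (n + 1)) :
    Tuples.bd (prism (n + 1) c) = Tuples.map (fun a => (a, 1)) c - Tuples.map (fun a => (a, 0)) c -
      prism n (Tuples.bd c) := by
  rw [prism, Tuples.bd_coneHomotopy _ (fun n c => (Tuples.map_bd _ c).symm)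
    (fun n c => (Tuples.map_bd _ c).symm) (fun c => ?_), prism]
  suffices h : (Tuples.map fun a : V => (a, (1 : Fin 2))) = Tuples.map (n := 0) fun a => (a, 0) from
    DFunLike.congr_fun h c
  refine lift_ext _ _ fun w => ?_
  rw [Tuples.map_of, Tuples.map_of]
  exact congrArg _ (Subsingleton.elim _ _)

lemma map_prism {V W : Type*} (g : V → W) (n : ℕ) (c : Tuples V n) :
    Tuples.map (Prod.map g id) (prism n c) = prism n (Tuples.map g c) := by
  rw [prism, prism]
  exact Tuples.map_coneHomotopy _
    (fun n c => by rw [Tuples.map_map, Tuples.map_map]; rfl)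
    (fun n c => by rw [Tuples.map_map, Tuples.map_map]; rfl) (fun _ _ => rfl) n c

/-- The simplex spanned by the vertices of the prism over `Δ^k`. It maps onto the prism, and it is
more convenient than the prism since it is a simplex. -/
abbrev PrismSimplex (k : ℕ) : Type := stdSimplex ℝ (Fin (k + 1) × Fin 2)

/-- The bottom (`ε = 0`) and the top (`ε = 1`) face of the prism over `Δ^k`. -/
def prismEnd (k : ℕ) (ε : Fin 2) (i : Fin (k + 1)) : PrismSimplex k := stdSimplex.vertex (i, ε)

/-- The `i`-th side of the prism over `Δ^{k+1}`. -/
def prismSide {k : ℕ} (i : Fin (k + 2)) (a : Fin (k + 1) × Fin 2) : PrismSimplex (k + 1) :=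
  stdSimplex.vertex (Prod.map i.succAbove id a)

/-- The triangulated prism over `Δ^k`. -/
def prismChain (k : ℕ) : Tuples (PrismSimplex k) (k + 2) :=
  Tuples.map (fun a => stdSimplex.vertex a) (prism (k + 1) (of id))

lemma bd_prismChain (k : ℕ) : Tuples.bd (prismChain k) =
    of (prismEnd k 1) - of (prismEnd k 0) -
      Tuples.map (fun a => stdSimplex.vertex a) (prism k (Tuples.bd (of id))) := by
  rw [prismChain, ← Tuples.map_bd, bd_prism, map_sub, map_sub, Tuples.map_map, Tuples.map_map,
    Tuples.map_of, Tuples.map_of]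
  rfl

lemma bd_prismChain_zero :
    Tuples.bd (prismChain 0) = of (prismEnd 0 1) - of (prismEnd 0 0) := by
  rw [bd_prismChain, prism_zero, map_zero, sub_zero]

lemma bd_prismChain_succ (k : ℕ) : Tuples.bd (prismChain (k + 1)) =
    of (prismEnd (k + 1) 1) - of (prismEnd (k + 1) 0) -
      ∑ i : Fin (k + 2), (-1 : ℤ) ^ (i : ℕ) • Tuples.map (aff (prismSide i)) (prismChain k) := by
  rw [bd_prismChain, Tuples.bd_of, map_sum, map_sum]
  congr 1
  refine Finset.sum_congr rfl fun i _ => ?_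
  rw [map_zsmul, map_zsmul]
  congr 1
  have h : of (id ∘ i.succAbove) = Tuples.map i.succAbove (of (id : Fin (k + 1) → _)) := by
    rw [Tuples.map_of]
    rfl
  rw [h, ← map_prism, prismChain, Tuples.map_map, Tuples.map_map]
  congr 2
  funext a
  exact (aff_vertex _ a).symm

end Prism

/-! ### Chain homotopies from homotopies of simplices -/

section Family

open FreeAbelianGroup

variable {X Z : Type u} [TopologicalSpace X] [TopologicalSpace Z]
  {f : C(Z, X)} {x : FundamentalGroupoid X}
  {ι ι' : Type} [Fintype ι] [Nonempty ι] [Fintype ι'] [Nonempty ι']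

lemma comp_eqToHom_comp {C : Type*} [Category C] {o a b c d d' : C} (γ : o ⟶ a) (h : a = b)
    (e : b ⟶ c) (h₁ : a = b) (h₂ : c = d) (h₃ : d = d') (h₄ : d' = c) :
    (γ ≫ eqToHom h) ≫ e =
      ((γ ≫ eqToHom h₁ ≫ e ≫ eqToHom h₂) ≫ eqToHom h₃) ≫ eqToHom h₄ := by
  subst h h₂ h₃
  simp

lemma edge_eq_of_eq_comp {H' : C(stdSimplex ℝ ι', X)} {H : C(stdSimplex ℝ ι, X)}
    {w : ι' → stdSimplex ℝ ι} (h : H' = H.comp (aff w)) {a' b' : stdSimplex ℝ ι'}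
    {a b : stdSimplex ℝ ι} (ha : aff w a' = a) (hb : aff w b' = b) :
    edge H' a' b' =
      eqToHom (by rw [h, ← ha]; rfl) ≫ edge H a b ≫ eqToHom (by rw [h, ← hb]; rfl) := by
  subst h ha hb
  rw [eqToHom_refl, eqToHom_refl, Category.comp_id, Category.id_comp]
  exact edge_comp H (aff w) a' b'

lemma push_eq_of_eq_comp {H' : C(stdSimplex ℝ ι', Z)} {H : C(stdSimplex ℝ ι, Z)}
    {w : ι' → stdSimplex ℝ ι} (h : H' = H.comp (aff w)) {p' : stdSimplex ℝ ι'}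
    {p : stdSimplex ℝ ι} (hp : aff w p' = p)
    (γ : x ⟶ (⟨f (H' p')⟩ : FundamentalGroupoid X)) {l : ℕ}
    (c : Tuples (stdSimplex ℝ ι') (l + 1)) :
    push H' p' γ c = push H p (γ ≫ eqToHom (by rw [h, ← hp]; rfl)) (Tuples.map (aff w) c) := by
  subst h hp
  rw [eqToHom_refl, Category.comp_id]
  exact push_comp H w p' γ c

/-- The map on the prism simplex given by a homotopy of singular simplices. -/
def cylinder {k : ℕ} {τ τ' : C(Simplex k, Z)} (F : ContinuousMap.Homotopy τ τ') :
    C(PrismSimplex k, Z) where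
  toFun t := F (⟨stdSimplex.map Prod.snd t 1, stdSimplex.zero_le _ _, stdSimplex.le_one _ _⟩,
    stdSimplex.map Prod.fst t)
  continuous_toFun := F.continuous.comp
    ((Continuous.subtype_mk ((continuous_coord 1).comp (stdSimplex.continuous_map _)) _).prodMk
      (stdSimplex.continuous_map _))

lemma cylinder_apply {k : ℕ} {τ τ' : C(Simplex k, Z)} (F : ContinuousMap.Homotopy τ τ')
    (t : PrismSimplex k) {s : unitInterval} (hs : stdSimplex.map Prod.snd t 1 = s) :
    cylinder F t = F (s, stdSimplex.map Prod.fst t) :=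
  congrArg (fun r => F (r, stdSimplex.map Prod.fst t)) (Subtype.ext hs)

lemma aff_prismEnd (k : ℕ) (ε : Fin 2) (t : Simplex k) :
    aff (prismEnd k ε) t = stdSimplex.map (fun i => (i, ε)) t :=
  (map_eq_aff _ t).symm

lemma map_fst_prismEnd (k : ℕ) (ε : Fin 2) (t : Simplex k) :
    stdSimplex.map Prod.fst (aff (prismEnd k ε) t) = t := by
  rw [aff_prismEnd, stdSimplex.map_comp_apply]
  exact stdSimplex.map_id_apply t

lemma cylinder_comp_bottom {k : ℕ} {τ τ' : C(Simplex k, Z)} (F : ContinuousMap.Homotopy τ τ') :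
    τ = (cylinder F).comp (aff (prismEnd k 0)) := by
  ext1 t
  rw [ContinuousMap.comp_apply, cylinder_apply F _ (s := 0), map_fst_prismEnd, F.apply_zero]
  rw [aff_prismEnd, stdSimplex.map_comp_apply, map_apply_eq_sum]
  simp

lemma cylinder_comp_top {k : ℕ} {τ τ' : C(Simplex k, Z)} (F : ContinuousMap.Homotopy τ τ') :
    τ' = (cylinder F).comp (aff (prismEnd k 1)) := by
  ext1 t
  rw [ContinuousMap.comp_apply, cylinder_apply F _ (s := 1), map_fst_prismEnd, F.apply_one]
  rw [aff_prismEnd, stdSimplex.map_comp_apply, map_apply_eq_sum]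
  simp

lemma cylinder_comp_side {k : ℕ} {τ τ' : C(Simplex (k + 1), Z)} {i : Fin (k + 2)}
    {τ'' : C(Simplex k, Z)}
    {F : ContinuousMap.Homotopy τ τ'} {F' : ContinuousMap.Homotopy (simplexFace τ i) τ''}
    (h : ∀ s y, F (s, face i y) = F' (s, y)) :
    cylinder F' = (cylinder F).comp (aff (prismSide i)) := by
  ext1 t
  have ht : aff (prismSide i) t = stdSimplex.map (Prod.map i.succAbove id) t :=
    (map_eq_aff _ t).symm
  rw [ContinuousMap.comp_apply, ht, cylinder_apply F' t (s := ⟨stdSimplex.map Prod.snd t 1,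
    stdSimplex.zero_le _ _, stdSimplex.le_one _ _⟩) rfl, ← h, cylinder_apply F _
      (s := ⟨stdSimplex.map Prod.snd t 1, stdSimplex.zero_le _ _, stdSimplex.le_one _ _⟩)]
  · rw [stdSimplex.map_comp_apply]
    refine congrArg (fun y => F (_, y)) ?_
    exact stdSimplex.map_comp_apply Prod.fst i.succAbove t
  · rw [stdSimplex.map_comp_apply]
    rfl

/-- A family of homotopies of singular simplices that is compatible with faces. The class of
simplices on which it is defined is closed under faces. -/
structure SimplexDeformation (Z : Type u) [TopologicalSpace Z] where
  /-- The simplices that are deformed. -/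
  carrier : ∀ k, Set C(Simplex k, Z)
  face_mem : ∀ {k} {τ : C(Simplex (k + 1), Z)}, τ ∈ carrier (k + 1) →
    ∀ i, simplexFace τ i ∈ carrier k
  /-- The result of the deformation. -/
  target : ∀ {k} {τ : C(Simplex k, Z)}, τ ∈ carrier k → C(Simplex k, Z)
  /-- The deformation of a simplex. -/
  homotopy : ∀ {k} {τ : C(Simplex k, Z)} (h : τ ∈ carrier k),
    ContinuousMap.Homotopy τ (target h)
  homotopy_face : ∀ {k} {τ : C(Simplex (k + 1), Z)} (h : τ ∈ carrier (k + 1)) (i : Fin (k + 2))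
    (s : unitInterval) (y : Simplex k),
    homotopy h (s, face i y) = homotopy (face_mem h i) (s, y)

namespace SimplexDeformation

variable (𝓓 : SimplexDeformation Z)

lemma cylinder_origin {k : ℕ} {τ τ' : C(Simplex k, Z)} (F : ContinuousMap.Homotopy τ τ') :
    (⟨f (τ (e₀ k))⟩ : FundamentalGroupoid X) = ⟨f (cylinder F (prismEnd k 0 0))⟩ := by
  have h : τ (e₀ k) = cylinder F (prismEnd k 0 0) := by
    conv_lhs => rw [cylinder_comp_bottom F]
    rw [ContinuousMap.comp_apply, e₀, aff_vertex]
  rw [h]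

/-- The chain on the prism over a deformed simplex that tuples of points of the prism define. -/
def prismPush {k : ℕ} {p : BasedSimplex f k x} (h : p.1 ∈ 𝓓.carrier k) {l : ℕ} :
    Tuples (PrismSimplex k) (l + 1) →+ BasedChains f l x :=
  push (cylinder (𝓓.homotopy h)) (prismEnd k 0 0)
    (p.2 ≫ eqToHom (cylinder_origin (𝓓.homotopy h)))

open scoped Classical in
/-- The chain homotopy given by a deformation of simplices; simplices that are not deformed are sent
to `0`. -/
def chainHomotopy {k : ℕ} : BasedChains f k x →+ BasedChains f (k + 1) x :=
  lift fun p => if h : p.1 ∈ 𝓓.carrier k then 𝓓.prismPush h (prismChain k) else 0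

lemma chainHomotopy_of {k : ℕ} {p : BasedSimplex f k x} (h : p.1 ∈ 𝓓.carrier k) :
    𝓓.chainHomotopy (of p) = 𝓓.prismPush h (prismChain k) := by
  rw [chainHomotopy, lift_apply_of, dif_pos h]

lemma prismPush_bottom {k : ℕ} {p : BasedSimplex f k x} (h : p.1 ∈ 𝓓.carrier k) :
    𝓓.prismPush h (of (prismEnd k 0)) = of p := by
  rw [← push_vertices p, push_eq_of_eq_comp (cylinder_comp_bottom (𝓓.homotopy h))
    (show aff (prismEnd k 0) (e₀ k) = prismEnd k 0 0 from aff_vertex _ _), map_aff_vertices]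
  rfl

lemma prismPush_side {k : ℕ} {p : BasedSimplex f (k + 1) x} (h : p.1 ∈ 𝓓.carrier (k + 1))
    (i : Fin (k + 2)) :
    𝓓.prismPush h (Tuples.map (aff (prismSide i)) (prismChain k)) =
      𝓓.chainHomotopy (of (entry p.1 (e₀ (k + 1)) p.2 (face i))) := by
  have hside : aff (prismEnd (k + 1) 0) (face i (e₀ k)) =
      aff (prismSide i) (prismEnd k 0 0) := by
    have h1 : face i (e₀ k) = stdSimplex.vertex (i.succAbove 0) := stdSimplex.map_vertex _ _
    rw [h1, aff_vertex, prismEnd, prismEnd, aff_vertex]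
    rfl
  have hedge := edge_eq_of_eq_comp (H' := f.comp p.1) (H := f.comp (cylinder (𝓓.homotopy h)))
    (congrArg f.comp (cylinder_comp_bottom (𝓓.homotopy h)))
    (aff_vertex (prismEnd (k + 1) 0) 0) hside
  rw [𝓓.chainHomotopy_of (p := entry p.1 (e₀ (k + 1)) p.2 (face i)) (𝓓.face_mem h i)]
  refine (push_base _ (prismEnd (k + 1) 0 0) (aff (prismSide i) (prismEnd k 0 0)) _ _).symm.trans
    (Eq.trans ?_ (push_eq_of_eq_comp (cylinder_comp_side (𝓓.homotopy_face h i)) rfl _ _).symm)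
  refine congrArg (fun γ => push (cylinder (𝓓.homotopy h)) _ γ _) ?_
  have hentry : (entry p.1 (e₀ (k + 1)) p.2 (face i)).2 =
      p.2 ≫ edge (f.comp p.1) (stdSimplex.vertex 0) (face i (e₀ k)) := rfl
  rw [hentry, hedge]
  exact comp_eqToHom_comp _ _ _ _ _ _ _

/-- The target of a deformed based simplex, based along the deformation. -/
def basedTarget {k : ℕ} {p : BasedSimplex f k x} (h : p.1 ∈ 𝓓.carrier k) : BasedSimplex f k x :=
  entry (cylinder (𝓓.homotopy h)) (prismEnd k 0 0)
    (p.2 ≫ eqToHom (cylinder_origin (𝓓.homotopy h))) (aff (prismEnd k 1))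

lemma basedTarget_fst {k : ℕ} {p : BasedSimplex f k x} (h : p.1 ∈ 𝓓.carrier k) :
    (𝓓.basedTarget h).1 = 𝓓.target h :=
  (cylinder_comp_top (𝓓.homotopy h)).symm

lemma prismPush_top {k : ℕ} {p : BasedSimplex f k x} (h : p.1 ∈ 𝓓.carrier k) :
    𝓓.prismPush h (of (prismEnd k 1)) = of (𝓓.basedTarget h) := by
  rw [prismPush, push_of, basedTarget]

lemma bd_chainHomotopy_zero {p : BasedSimplex f 0 x} (h : p.1 ∈ 𝓓.carrier 0) :
    of p + BasedChains.bd (𝓓.chainHomotopy (of p)) = of (𝓓.basedTarget h) := by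
  rw [𝓓.chainHomotopy_of h, prismPush, ← push_bd, ← prismPush, bd_prismChain_zero, map_sub,
    prismPush_top, prismPush_bottom]
  abel

lemma bd_chainHomotopy_succ {k : ℕ} {p : BasedSimplex f (k + 1) x}
    (h : p.1 ∈ 𝓓.carrier (k + 1)) :
    of p + BasedChains.bd (𝓓.chainHomotopy (of p)) + 𝓓.chainHomotopy (BasedChains.bd (of p)) =
      of (𝓓.basedTarget h) := by
  rw [𝓓.chainHomotopy_of h, prismPush, ← push_bd, ← prismPush, bd_prismChain_succ, map_sub,
    map_sub, prismPush_top, prismPush_bottom, BasedChains.bd_of, map_sum, map_sum]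
  simp only [map_zsmul, prismPush_side]
  abel

end SimplexDeformation

end Family

/-! ### Cycles of the singular complex -/

section Cycles

open FreeAbelianGroup

variable {X : Type u} [TopologicalSpace X] {x : FundamentalGroupoid X}

/-- The projection of the based chains of `S X` onto those spanned by characteristic maps: it
replaces `τ` by the characteristic map of the simplex of `X` under `τ`. -/
def cellular {k : ℕ} :
    BasedChains (canonicalMap X) k x →+ BasedChains (canonicalMap X) k x :=
  FreeAbelianGroup.map fun p => ⟨charMap ((canonicalMap X).comp p.1), p.2⟩

lemma cellular_of_eq {k : ℕ} {p : BasedSimplex (canonicalMap X) k x} {σ : C(Simplex k, X)}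
    (h : p.1 = charMap σ) : cellular (of p) = of p := by
  obtain ⟨τ, γ⟩ := p
  obtain rfl : τ = charMap σ := h
  exact map_of_apply _

/-- The deformation to characteristic maps of the simplices of `S X` that have a chart. -/
def chartDeformation (X : Type u) [TopologicalSpace X] :
    SimplexDeformation (SingularComplex X) where
  carrier k := {τ | ∃ (m : ℕ) (a : C(Simplex m, X)) (ρ : C(Simplex k, Simplex m)), IsChart τ a ρ}
  face_mem := by
    rintro k τ ⟨m, a, ρ, h⟩ i
    exact ⟨m, a, _, h.face i⟩
  target h := charMap (h.choose_spec.choose.comp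
    (aff fun i => h.choose_spec.choose_spec.choose (stdSimplex.vertex i)))
  homotopy h := deform h.choose_spec.choose_spec.choose_spec
  homotopy_face _ _ s y := deform_face _ _ s y

/-- Every cycle of `S X` is homologous to a combination of characteristic maps. -/
lemma BasedChains.IsCycle.exists_cellular_eq {k : ℕ} {z : BasedChains (canonicalMap X) k x}
    (hz : IsCycle z) : ∃ y : BasedChains (canonicalMap X) (k + 1) x,
      cellular (z + bd y) = z + bd y := by
  obtain ⟨y, hc, hs⟩ :=
    hz.exists_small (fun _ => isOpen_of_mem_nearCover) (sUnion_nearCover (X := X))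
  have hmem {k : ℕ} {p : BasedSimplex (canonicalMap X) k x}
      (hp : p ∈ small (canonicalMap X) k x (nearCover X)) :
      p.1 ∈ (chartDeformation X).carrier k := by
    obtain ⟨_, ⟨m, a, rfl⟩, hp⟩ := hp
    obtain ⟨ρ, hρ⟩ := exists_isChart hp
    exact ⟨m, a, ρ, hρ⟩
  refine ⟨y + (chartDeformation X).chainHomotopy (z + bd y), ?_⟩
  rw [map_add bd, ← add_assoc]
  generalize z + bd y = z at hc hs
  have hfix {k : ℕ} {p : BasedSimplex (canonicalMap X) k x}
      (hp : p.1 ∈ (chartDeformation X).carrier k) :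
      cellular (of ((chartDeformation X).basedTarget hp)) =
        of ((chartDeformation X).basedTarget hp) :=
    cellular_of_eq ((chartDeformation X).basedTarget_fst hp)
  cases k with
  | zero =>
    refine eqOn_spanned (f := cellular.comp
      (AddMonoidHom.id _ + bd.comp (chartDeformation X).chainHomotopy))
      (g := AddMonoidHom.id _ + bd.comp (chartDeformation X).chainHomotopy) (fun p hp => ?_) hs
    simp only [AddMonoidHom.comp_apply, AddMonoidHom.add_apply, AddMonoidHom.id_apply]
    rw [(chartDeformation X).bd_chainHomotopy_zero (hmem hp)]
    exact hfix _
  | succ k =>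
    have h := eqOn_spanned (f := cellular.comp (AddMonoidHom.id _ +
        bd.comp (chartDeformation X).chainHomotopy + (chartDeformation X).chainHomotopy.comp bd))
      (g := AddMonoidHom.id _ + bd.comp (chartDeformation X).chainHomotopy +
        (chartDeformation X).chainHomotopy.comp bd) (fun p hp => by
          simp only [AddMonoidHom.comp_apply, AddMonoidHom.add_apply, AddMonoidHom.id_apply]
          rw [(chartDeformation X).bd_chainHomotopy_succ (hmem hp)]
          exact hfix _) hs
    have hc' : bd z = 0 := hc
    simpa only [AddMonoidHom.comp_apply, AddMonoidHom.add_apply, AddMonoidHom.id_apply, hc',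
      map_zero, add_zero] using h

end Cycles

/-! ### The universal chain homotopy -/

section Universal

open FreeAbelianGroup

variable {X Z : Type u} [TopologicalSpace X] [TopologicalSpace Z] {f : C(Z, X)}
  {x y : FundamentalGroupoid X}

/-- The based simplex of `τ` with constant path class, based at the image of the leading vertex. -/
abbrev baseSimplex (f : C(Z, X)) {k : ℕ} (τ : C(Simplex k, Z)) :
    BasedSimplex f k ⟨f (τ (e₀ k))⟩ := ⟨τ, 𝟙 _⟩

lemma of_eq_pull {k : ℕ} (p : BasedSimplex f k x) : of p = pull p.2 (of (baseSimplex f p.1)) := by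
  rw [pull_of, Category.comp_id]

/-- The extension to based chains, compatible with changes of the base point, of an assignment of
based chains to singular simplices. -/
def extend {k l : ℕ} (D : ∀ τ : C(Simplex k, Z), BasedChains f l ⟨f (τ (e₀ k))⟩) :
    BasedChains f k x →+ BasedChains f l x :=
  lift fun p => pull p.2 (D p.1)

lemma extend_of {k l : ℕ} (D : ∀ τ : C(Simplex k, Z), BasedChains f l ⟨f (τ (e₀ k))⟩)
    (p : BasedSimplex f k x) : extend D (of p) = pull p.2 (D p.1) :=
  lift_apply_of _ _

lemma extend_pull {k l : ℕ} (D : ∀ τ : C(Simplex k, Z), BasedChains f l ⟨f (τ (e₀ k))⟩)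
    (γ : y ⟶ x) (z : BasedChains f k x) : extend D (pull γ z) = pull γ (extend D z) := by
  suffices h : (extend D).comp (pull γ) = (pull γ).comp (extend D) from DFunLike.congr_fun h z
  refine lift_ext _ _ fun p => ?_
  simp only [AddMonoidHom.comp_apply, pull_of, extend_of, pull_pull]

lemma extend_baseSimplex {k l : ℕ} (D : ∀ τ : C(Simplex k, Z), BasedChains f l ⟨f (τ (e₀ k))⟩)
    (τ : C(Simplex k, Z)) : extend D (of (baseSimplex f τ)) = D τ := by
  rw [extend_of]
  suffices h : pull (f := f) (k := l) (𝟙 (⟨f (τ (e₀ k))⟩ : FundamentalGroupoid X)) =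
      AddMonoidHom.id _ from DFunLike.congr_fun h (D τ)
  refine lift_ext _ _ fun p => ?_
  rw [pull_of, Category.id_comp]
  rfl

lemma cellular_of {k : ℕ} {x : FundamentalGroupoid X} (p : BasedSimplex (canonicalMap X) k x) :
    cellular (of p) =
      of (⟨charMap ((canonicalMap X).comp p.1), p.2⟩ : BasedSimplex (canonicalMap X) k x) :=
  map_of_apply _

lemma cellular_cellular {k : ℕ} (z : BasedChains (canonicalMap X) k x) :
    cellular (cellular z) = cellular z := by
  suffices h : cellular.comp cellular = cellular (X := X) (x := x) (k := k) from
    DFunLike.congr_fun h z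
  refine lift_ext _ _ fun p => ?_
  rw [AddMonoidHom.comp_apply, cellular_of, cellular_of_eq rfl]

lemma cellular_pull {k : ℕ} (γ : y ⟶ x) (z : BasedChains (canonicalMap X) k x) :
    cellular (pull γ z) = pull γ (cellular z) := by
  suffices h : cellular.comp (pull γ) = (pull γ).comp (cellular (X := X) (k := k)) from
    DFunLike.congr_fun h z
  refine lift_ext _ _ fun p => ?_
  simp only [AddMonoidHom.comp_apply, pull_of, cellular_of]
  rfl

lemma charMap_comp_face {k : ℕ} (σ : C(Simplex (k + 1), X)) (i : Fin (k + 2)) :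
    simplexFace (charMap σ) i = charMap (simplexFace σ i) := by
  ext1 t
  exact charMap_face σ i t

lemma cellular_bd {k : ℕ} (z : BasedChains (canonicalMap X) (k + 1) x) :
    cellular (BasedChains.bd z) = BasedChains.bd (cellular z) := by
  suffices h : cellular.comp BasedChains.bd = BasedChains.bd.comp (cellular (X := X) (x := x)) from
    DFunLike.congr_fun h z
  refine lift_ext _ _ fun p => ?_
  simp only [AddMonoidHom.comp_apply, BasedChains.bd_of, cellular_of, map_sum, map_zsmul]
  refine Finset.sum_congr rfl fun i _ => ?_
  congr 1
  have h := cellular_of_eq (p := entry (charMap ((canonicalMap X).comp p.1)) (e₀ (k + 1)) p.2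
    (face i)) (charMap_comp_face ((canonicalMap X).comp p.1) i)
  exact ((cellular_of _).symm.trans h)

namespace BasedChains

/-- An assignment of chains `D` to the simplices of dimension `k` bounds every cycle modulo
combinations of characteristic maps. -/
def BoundsCycles {k : ℕ} (D : ∀ τ : C(Simplex k, SingularComplex X),
    BasedChains (canonicalMap X) (k + 1) ⟨canonicalMap X (τ (e₀ k))⟩) : Prop :=
  ∀ (x : FundamentalGroupoid X) (z : BasedChains (canonicalMap X) k x), IsCycle z →
    cellular (z + bd (extend D z)) = z + bd (extend D z)

variable (X) in
lemma exists_boundsCycles_zero : ∃ D : ∀ τ : C(Simplex 0, SingularComplex X),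
    BasedChains (canonicalMap X) 1 ⟨canonicalMap X (τ (e₀ 0))⟩,
    ∀ (x : FundamentalGroupoid X) (z : BasedChains (canonicalMap X) 0 x),
      cellular (z + bd (extend D z)) = z + bd (extend D z) := by
  choose D hD using fun τ : C(Simplex 0, SingularComplex X) =>
    IsCycle.exists_cellular_eq (X := X) (k := 0) (z := of (baseSimplex (canonicalMap X) τ)) trivial
  refine ⟨D, fun x z => ?_⟩
  suffices h : cellular.comp (AddMonoidHom.id _ + bd.comp (extend D)) =
      AddMonoidHom.id _ + (bd.comp (extend D (x := x))) from DFunLike.congr_fun h z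
  refine lift_ext _ _ fun p => ?_
  simp only [AddMonoidHom.comp_apply, AddMonoidHom.add_apply, AddMonoidHom.id_apply]
  rw [of_eq_pull, extend_pull, ← pull_bd, extend_baseSimplex, ← map_add, cellular_pull, hD]

lemma BoundsCycles.exists_succ {k : ℕ} {D : ∀ τ : C(Simplex k, SingularComplex X),
    BasedChains (canonicalMap X) (k + 1) ⟨canonicalMap X (τ (e₀ k))⟩} (h : BoundsCycles D) :
    ∃ D' : ∀ τ : C(Simplex (k + 1), SingularComplex X),
      BasedChains (canonicalMap X) (k + 2) ⟨canonicalMap X (τ (e₀ (k + 1)))⟩,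
      ∀ (x : FundamentalGroupoid X) (z : BasedChains (canonicalMap X) (k + 1) x),
        cellular (z + bd (extend D' z) + extend D (bd z)) =
          z + bd (extend D' z) + extend D (bd z) := by
  have key : ∀ (x : FundamentalGroupoid X) (z : BasedChains (canonicalMap X) (k + 1) x),
      ∃ y, cellular (z + bd y + extend D (bd z)) = z + bd y + extend D (bd z) := by
    intro x z
    have hbd : IsCycle (bd z) := by
      cases k with
      | zero => trivial
      | succ k => exact bd_bd z
    -- `w` has a cellular boundary, so that the non-cellular part of `w` is a cycle
    set w := z + extend D (bd z) with hw
    have hcyc : IsCycle (w - cellular w) := by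
      change bd (w - cellular w) = 0
      rw [map_sub, ← cellular_bd, hw, map_add, h x _ hbd, sub_self]
    obtain ⟨y, hy⟩ := hcyc.exists_cellular_eq
    refine ⟨y, ?_⟩
    have hsum : z + bd y + extend D (bd z) = (w - cellular w + bd y) + cellular w := by
      rw [hw]
      abel
    rw [hsum, map_add, hy, cellular_cellular]
  choose D' hD' using fun τ : C(Simplex (k + 1), SingularComplex X) =>
    key _ (of (baseSimplex (canonicalMap X) τ))
  refine ⟨D', fun x z => ?_⟩
  suffices h : cellular.comp (AddMonoidHom.id _ + bd.comp (extend D') + (extend D).comp bd) =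
      AddMonoidHom.id _ + bd.comp (extend D' (x := x)) + (extend D).comp bd from
    DFunLike.congr_fun h z
  refine lift_ext _ _ fun p => ?_
  simp only [AddMonoidHom.comp_apply, AddMonoidHom.add_apply, AddMonoidHom.id_apply]
  rw [of_eq_pull, extend_pull, ← pull_bd, ← pull_bd, extend_baseSimplex, extend_pull, ← map_add,
    ← map_add, cellular_pull, hD']

variable (X) in
/-- A chain homotopy from the identity of the based chains of `S X` to a chain map with values in
the combinations of characteristic maps. It is built by induction on the dimension, as for a
resolution by free objects: the obstruction in each step is a cycle. -/
theorem exists_homotopy_to_cellular : ∃ D : ∀ (k : ℕ) (τ : C(Simplex k, SingularComplex X)),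
    BasedChains (canonicalMap X) (k + 1) ⟨canonicalMap X (τ (e₀ k))⟩,
    (∀ (x : FundamentalGroupoid X) (z : BasedChains (canonicalMap X) 0 x),
      cellular (z + bd (extend (D 0) z)) = z + bd (extend (D 0) z)) ∧
    ∀ (k : ℕ) (x : FundamentalGroupoid X) (z : BasedChains (canonicalMap X) (k + 1) x),
      cellular (z + bd (extend (D (k + 1)) z) + extend (D k) (bd z)) =
        z + bd (extend (D (k + 1)) z) + extend (D k) (bd z) := by
  obtain ⟨D₀, hD₀⟩ := exists_boundsCycles_zero X
  choose! next hnext using fun (k : ℕ) (D : ∀ τ : C(Simplex k, SingularComplex X),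
    BasedChains (canonicalMap X) (k + 1) ⟨canonicalMap X (τ (e₀ k))⟩) (h : BoundsCycles D) =>
    h.exists_succ
  let D : ∀ (k : ℕ) (τ : C(Simplex k, SingularComplex X)),
      BasedChains (canonicalMap X) (k + 1) ⟨canonicalMap X (τ (e₀ k))⟩ :=
    fun k => Nat.rec D₀ (fun k D => next k D) k
  have hD : ∀ k, BoundsCycles (D k) := by
    intro k
    induction k with
    | zero => exact fun x z _ => hD₀ x z
    | succ k ih =>
      intro x z hz
      have hz' : bd z = 0 := hz
      have := hnext k (D k) ih x z
      rwa [hz', map_zero, add_zero] at this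
  exact ⟨D, hD₀, fun k => hnext k (D k) (hD k)⟩

end BasedChains

end Universal

/-! ### Action on chains with local coefficients -/

section ChainAction

open scoped Classical

variable {X Z : Type u} [TopologicalSpace X] [TopologicalSpace Z] {f : C(Z, X)}
  {x y : FundamentalGroupoid X} (G : CoefficientSystem.{u, v} X)

/-- The action of based chains on coefficients: `(τ, γ)` takes `g` to `(γ g) τ`. -/
def evalChain {k : ℕ} :
    BasedChains f k x →+ G.obj x →+ Chains (CoefficientSystem.pullback f G) k :=
  FreeAbelianGroup.lift fun p =>
    (single (CoefficientSystem.pullback f G) p.1).comp (G.map p.2).hom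

lemma evalChain_of {k : ℕ} (p : BasedSimplex f k x) (g : G.obj x) :
    evalChain G (FreeAbelianGroup.of p) g =
      single (CoefficientSystem.pullback f G) p.1 (G.map p.2 g) :=
  DFunLike.congr_fun (FreeAbelianGroup.lift_apply_of _ _) g

lemma evalChain_baseSimplex {k : ℕ} (τ : C(Simplex k, Z))
    (g : coeffAt (CoefficientSystem.pullback f G) τ) :
    evalChain G (FreeAbelianGroup.of (baseSimplex f τ)) g =
      single (CoefficientSystem.pullback f G) τ g :=
  (evalChain_of G (baseSimplex f τ) g).trans
    (congrArg (single (CoefficientSystem.pullback f G) τ)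
      (ConcreteCategory.congr_hom (G.map_id _) g))

lemma evalChain_pull {k : ℕ} (γ : y ⟶ x) (z : BasedChains f k x) (g : G.obj y) :
    evalChain G (pull γ z) g = evalChain G z (G.map γ g) := by
  suffices h : (AddMonoidHom.eval g).comp ((evalChain G).comp (pull γ)) =
      (AddMonoidHom.eval (G.map γ g)).comp (evalChain G (f := f) (k := k)) from
    DFunLike.congr_fun h z
  refine FreeAbelianGroup.lift_ext _ _ fun p => ?_
  simp only [AddMonoidHom.comp_apply, AddMonoidHom.eval_apply_apply, pull_of]
  refine (evalChain_of G _ g).trans (Eq.trans ?_ (evalChain_of G p (G.map γ g)).symm)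
  exact congrArg (single (CoefficientSystem.pullback f G) p.1)
    (ConcreteCategory.congr_hom (G.map_comp γ p.2) g)

lemma evalChain_bd {k : ℕ} (z : BasedChains f (k + 1) x) (g : G.obj x) :
    evalChain G (BasedChains.bd z) g = boundary _ k (evalChain G z g) := by
  suffices h : (AddMonoidHom.eval g).comp ((evalChain G).comp BasedChains.bd) =
      (boundary (CoefficientSystem.pullback f G) k).comp
        ((AddMonoidHom.eval g).comp (evalChain G (x := x))) from DFunLike.congr_fun h z
  refine FreeAbelianGroup.lift_ext _ _ fun p => ?_
  simp only [AddMonoidHom.comp_apply, AddMonoidHom.eval_apply_apply, BasedChains.bd_of, map_sum,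
    map_zsmul]
  refine Eq.trans (Finset.sum_congr rfl fun i _ => ?_)
    ((boundary_single _ k p.1 _).symm.trans
      (congrArg (boundary (CoefficientSystem.pullback f G) k) (evalChain_of G p g).symm))
  have h : toFace (CoefficientSystem.pullback f G) p.1 i =
      G.map (edge (f.comp p.1) (e₀ (k + 1)) (face i (e₀ k))) :=
    transport_eq_map_edge G (f.comp p.1) _ _
  refine congrArg ((-1 : ℤ) ^ (i : ℕ) • ·) ((evalChain_of G _ g).trans ?_)
  exact congrArg (single (CoefficientSystem.pullback f G) (simplexFace p.1 i))
    ((ConcreteCategory.congr_hom (G.map_comp p.2 _) g).trans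
      (ConcreteCategory.congr_hom h (G.map p.2 g)).symm)

/-- The operator on chains with local coefficients that an assignment of based chains to singular
simplices determines. -/
def opChain {k l : ℕ} (D : ∀ τ : C(Simplex k, Z), BasedChains f l ⟨f (τ (e₀ k))⟩) :
    Chains (CoefficientSystem.pullback f G) k →+ Chains (CoefficientSystem.pullback f G) l :=
  DirectSum.toAddMonoid fun τ => evalChain G (D τ)

lemma opChain_evalChain {k l : ℕ} (D : ∀ τ : C(Simplex k, Z), BasedChains f l ⟨f (τ (e₀ k))⟩)
    (z : BasedChains f k x) (g : G.obj x) :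
    opChain G D (evalChain G z g) = evalChain G (extend D z) g := by
  suffices h : (opChain G D).comp ((AddMonoidHom.eval g).comp (evalChain G)) =
      (AddMonoidHom.eval g).comp ((evalChain G).comp (extend D)) from DFunLike.congr_fun h z
  refine FreeAbelianGroup.lift_ext _ _ fun p => ?_
  simp only [AddMonoidHom.comp_apply, AddMonoidHom.eval_apply_apply, extend_of]
  refine (congrArg (opChain G D) (evalChain_of G p g)).trans
    (Eq.trans ?_ (evalChain_pull G p.2 (D p.1) g).symm)
  exact DirectSum.toAddMonoid_of _ _ _

/-- Two endomorphisms of the group of chains agree if they agree on the chains that come from based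
chains. -/
lemma chains_hom_ext {k : ℕ} {A : Type*} [AddCommGroup A]
    {φ ψ : Chains (CoefficientSystem.pullback f G) k →+ A}
    (h : ∀ (x : FundamentalGroupoid X) (z : BasedChains f k x) (g : G.obj x),
      φ (evalChain G z g) = ψ (evalChain G z g)) : φ = ψ := by
  refine DirectSum.addHom_ext' fun τ => AddMonoidHom.ext fun g => ?_
  have := h _ (FreeAbelianGroup.of (baseSimplex f τ)) g
  rw [evalChain_baseSimplex] at this
  exact this

/-- The section of `I_*` on chains, given by the characteristic maps of `S X`. -/
def charPush (k : ℕ) :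
    Chains G k →+ Chains (CoefficientSystem.pullback (canonicalMap X) G) k :=
  DirectSum.toAddMonoid fun σ =>
    single (CoefficientSystem.pullback (canonicalMap X) G) (charMap σ)

lemma charPush_single {k : ℕ} (σ : C(Simplex k, X)) (g : coeffAt G σ) :
    charPush G k (single G σ g) =
      single (CoefficientSystem.pullback (canonicalMap X) G) (charMap σ) g :=
  DirectSum.toAddMonoid_of _ _ _

lemma chainPush_single (f : C(Z, X)) {k : ℕ} (τ : C(Simplex k, Z))
    (g : coeffAt (CoefficientSystem.pullback f G) τ) :
    chainPush f G k (single (CoefficientSystem.pullback f G) τ g) = single G (f.comp τ) g :=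
  DirectSum.toAddMonoid_of _ _ _

lemma chainPush_charPush (k : ℕ) (c : Chains G k) :
    chainPush (canonicalMap X) G k (charPush G k c) = c := by
  suffices h : (chainPush (canonicalMap X) G k).comp (charPush G k) = AddMonoidHom.id _ from
    DFunLike.congr_fun h c
  refine DirectSum.addHom_ext' fun σ => AddMonoidHom.ext fun g => ?_
  exact (congrArg (chainPush (canonicalMap X) G k) (charPush_single G σ g)).trans
    (chainPush_single G (canonicalMap X) (charMap σ) g)

lemma charPush_chainPush {k : ℕ} (z : BasedChains (canonicalMap X) k x) (g : G.obj x) :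
    charPush G k (chainPush (canonicalMap X) G k (evalChain G z g)) =
      evalChain G (cellular z) g := by
  suffices h : ((charPush G k).comp (chainPush (canonicalMap X) G k)).comp
      ((AddMonoidHom.eval g).comp (evalChain G)) =
      (AddMonoidHom.eval g).comp ((evalChain G).comp cellular) from DFunLike.congr_fun h z
  refine FreeAbelianGroup.lift_ext _ _ fun p => ?_
  simp only [AddMonoidHom.comp_apply, AddMonoidHom.eval_apply_apply, cellular_of]
  refine (congrArg (fun c => charPush G k (chainPush (canonicalMap X) G k c))
    (evalChain_of G p g)).trans (Eq.trans ?_ (evalChain_of G _ g).symm)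
  exact (congrArg (charPush G k) (chainPush_single G (canonicalMap X) p.1 _)).trans
    (charPush_single G _ _)

lemma single_simplexFace_charMap {k : ℕ} (σ : C(Simplex (k + 1), X)) (i : Fin (k + 2))
    (g : coeffAt G σ) :
    single (CoefficientSystem.pullback (canonicalMap X) G) (simplexFace (charMap σ) i)
        (toFace (CoefficientSystem.pullback (canonicalMap X) G) (charMap σ) i g) =
      single (CoefficientSystem.pullback (canonicalMap X) G) (charMap (simplexFace σ i))
        (toFace G σ i g) := by
  have h₂ : toFace G σ i = G.map (edge σ (e₀ (k + 1)) (face i (e₀ k))) :=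
    transport_eq_map_edge G σ _ _
  let p : BasedSimplex (canonicalMap X) k ⟨σ (e₀ (k + 1))⟩ :=
    ⟨simplexFace (charMap σ) i, edge σ (e₀ (k + 1)) (face i (e₀ k))⟩
  have h := congrArg (fun z => evalChain G z g)
    ((cellular_of_eq (p := p) (charMap_comp_face σ i)).symm.trans (cellular_of p))
  have e₁ := (evalChain_of G p g).symm.trans (h.trans (evalChain_of G _ g))
  have h₃ := ConcreteCategory.congr_hom h₂ g
  exact (congrArg (single (CoefficientSystem.pullback (canonicalMap X) G)
    (simplexFace (charMap σ) i)) h₃).trans (e₁.trans (congrArg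
      (single (CoefficientSystem.pullback (canonicalMap X) G) (charMap (simplexFace σ i))) h₃.symm))

lemma boundary_charPush (k : ℕ) (c : Chains G (k + 1)) :
    boundary _ k (charPush G (k + 1) c) = charPush G k (boundary G k c) := by
  suffices h : (boundary _ k).comp (charPush G (k + 1)) = (charPush G k).comp (boundary G k) from
    DFunLike.congr_fun h c
  refine DirectSum.addHom_ext' fun σ => AddMonoidHom.ext fun g => ?_
  let T := CoefficientSystem.pullback (canonicalMap X) G
  have h₁ : boundary T k (charPush G (k + 1) (single G σ g)) = ∑ i : Fin (k + 2),
      (-1 : ℤ) ^ (i : ℕ) • single T (charMap (simplexFace σ i)) (toFace G σ i g) := by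
    rw [charPush_single]
    refine (boundary_single T k (charMap σ) g).trans (Finset.sum_congr rfl fun i _ => ?_)
    exact congrArg ((-1 : ℤ) ^ (i : ℕ) • ·) (single_simplexFace_charMap G σ i g)
  have h₂ : charPush G k (boundary G k (single G σ g)) = ∑ i : Fin (k + 2),
      (-1 : ℤ) ^ (i : ℕ) • single T (charMap (simplexFace σ i)) (toFace G σ i g) := by
    rw [boundary_single, map_sum]
    refine Finset.sum_congr rfl fun i _ => ?_
    rw [map_zsmul]
    exact congrArg ((-1 : ℤ) ^ (i : ℕ) • ·) (charPush_single G _ _)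
  exact h₁.trans h₂.symm

end ChainAction

/-! ### Action on cochains with local coefficients -/

section CochainAction

variable {X Z : Type u} [TopologicalSpace X] [TopologicalSpace Z] {f : C(Z, X)}
  {x y : FundamentalGroupoid X} (G : CoefficientSystem.{u, v} X)

/-- The evaluation of cochains on based chains: the value of `c` at `(τ, γ)` is `γ⁻¹ c(τ)`. -/
def evalCochain {k : ℕ} :
    BasedChains f k x →+ Cochains (CoefficientSystem.pullback f G) k →+ G.obj x :=
  FreeAbelianGroup.lift fun p => (G.map (inv p.2)).hom.comp
    (Pi.evalAddMonoidHom (fun τ : C(Simplex k, Z) =>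
      (coeffAt (CoefficientSystem.pullback f G) τ : Type v)) p.1)

lemma evalCochain_of {k : ℕ} (p : BasedSimplex f k x)
    (c : Cochains (CoefficientSystem.pullback f G) k) :
    evalCochain G (FreeAbelianGroup.of p) c = G.map (inv p.2) (c p.1) :=
  DFunLike.congr_fun (FreeAbelianGroup.lift_apply_of _ _) c

lemma evalCochain_baseSimplex {k : ℕ} (τ : C(Simplex k, Z))
    (c : Cochains (CoefficientSystem.pullback f G) k) :
    evalCochain G (FreeAbelianGroup.of (baseSimplex f τ)) c = c τ := by
  have h : G.map (inv (𝟙 (⟨f (τ (e₀ k))⟩ : FundamentalGroupoid X))) = 𝟙 _ := by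
    rw [IsIso.inv_id, CategoryTheory.Functor.map_id]
  exact (evalCochain_of G (baseSimplex f τ) c).trans (ConcreteCategory.congr_hom h (c τ))

lemma evalCochain_pull {k : ℕ} (γ : y ⟶ x) (z : BasedChains f k x)
    (c : Cochains (CoefficientSystem.pullback f G) k) :
    evalCochain G (pull γ z) c = G.map (inv γ) (evalCochain G z c) := by
  suffices h : (AddMonoidHom.eval c).comp ((evalCochain G).comp (pull γ)) =
      (G.map (inv γ)).hom.comp ((AddMonoidHom.eval c).comp (evalCochain G)) from
    DFunLike.congr_fun h z
  refine FreeAbelianGroup.lift_ext _ _ fun p => ?_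
  have h : G.map (inv (γ ≫ p.2)) = G.map (inv p.2) ≫ G.map (inv γ) := by
    rw [IsIso.inv_comp, CategoryTheory.Functor.map_comp]
  simp only [AddMonoidHom.comp_apply, AddMonoidHom.eval_apply_apply, pull_of]
  refine (evalCochain_of G _ c).trans ((ConcreteCategory.congr_hom h (c p.1)).trans ?_)
  exact congrArg (G.map (inv γ)) (evalCochain_of G p c).symm

lemma inv_edge {k : ℕ} (σ : C(Simplex k, X)) (a b : Simplex k) :
    inv (edge σ a b) = edge σ b a := by
  rw [IsIso.inv_eq_of_hom_inv_id]
  rw [edge_trans, edge_self]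

lemma evalCochain_bd {k : ℕ} (z : BasedChains f (k + 1) x)
    (c : Cochains (CoefficientSystem.pullback f G) k) :
    evalCochain G (BasedChains.bd z) c =
      (-1 : ℤ) ^ k • evalCochain G z (coboundary _ k c) := by
  suffices h : (AddMonoidHom.eval c).comp ((evalCochain G).comp BasedChains.bd) =
      (-1 : ℤ) ^ k • (AddMonoidHom.eval (coboundary _ k c)).comp (evalCochain G (x := x)) from
    DFunLike.congr_fun h z
  refine FreeAbelianGroup.lift_ext _ _ fun p => ?_
  have h₁ : (-1 : ℤ) ^ k • coboundary _ k c p.1 = ∑ i : Fin (k + 2), (-1 : ℤ) ^ (i : ℕ) •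
      ofFace (CoefficientSystem.pullback f G) p.1 i (c (simplexFace p.1 i)) := by
    rw [coboundary_apply, smul_smul, ← mul_pow, neg_one_mul, neg_neg, one_pow, one_smul]
  have h₂ : (-1 : ℤ) ^ k • evalCochain G (FreeAbelianGroup.of p) (coboundary _ k c) =
      ∑ i : Fin (k + 2), (-1 : ℤ) ^ (i : ℕ) • G.map (inv p.2)
        (ofFace (CoefficientSystem.pullback f G) p.1 i (c (simplexFace p.1 i))) := by
    refine (congrArg ((-1 : ℤ) ^ k • ·) (evalCochain_of G p _)).trans ?_
    refine (map_zsmul (G.map (inv p.2)).hom _ _).symm.trans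
      ((congrArg (G.map (inv p.2)) h₁).trans ?_)
    refine (map_sum (G.map (inv p.2)).hom _ _).trans (Finset.sum_congr rfl fun i _ => ?_)
    exact map_zsmul (G.map (inv p.2)).hom _ _
  refine Eq.trans ?_ h₂.symm
  simp only [AddMonoidHom.comp_apply, AddMonoidHom.eval_apply_apply, BasedChains.bd_of, map_sum,
    map_zsmul]
  refine Finset.sum_congr rfl fun i _ => congrArg ((-1 : ℤ) ^ (i : ℕ) • ·) ?_
  have h₃ : ofFace (CoefficientSystem.pullback f G) p.1 i =
      G.map (edge (f.comp p.1) (face i (e₀ k)) (e₀ (k + 1))) :=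
    transport_eq_map_edge G (f.comp p.1) _ _
  have h₄ : G.map (inv (p.2 ≫ edge (f.comp p.1) (e₀ (k + 1)) (face i (e₀ k)))) =
      G.map (edge (f.comp p.1) (face i (e₀ k)) (e₀ (k + 1))) ≫ G.map (inv p.2) := by
    rw [← CategoryTheory.Functor.map_comp, IsIso.inv_comp, inv_edge]
  refine (evalCochain_of G _ c).trans
    ((ConcreteCategory.congr_hom h₄ (c (simplexFace p.1 i))).trans ?_)
  exact congrArg (G.map (inv p.2))
    (ConcreteCategory.congr_hom h₃ (c (simplexFace p.1 i))).symm

/-- The operator on cochains with local coefficients that an assignment of based chains to singular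
simplices determines. -/
def opCochain {k l : ℕ} (D : ∀ τ : C(Simplex k, Z), BasedChains f l ⟨f (τ (e₀ k))⟩) :
    Cochains (CoefficientSystem.pullback f G) l →+ Cochains (CoefficientSystem.pullback f G) k :=
  AddMonoidHom.pi fun τ => evalCochain G (D τ)

lemma evalCochain_opCochain {k l : ℕ}
    (D : ∀ τ : C(Simplex k, Z), BasedChains f l ⟨f (τ (e₀ k))⟩) (z : BasedChains f k x)
    (c : Cochains (CoefficientSystem.pullback f G) l) :
    evalCochain G z (opCochain G D c) = evalCochain G (extend D z) c := by
  suffices h : (AddMonoidHom.eval (opCochain G D c)).comp (evalCochain G) =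
      (AddMonoidHom.eval c).comp ((evalCochain G).comp (extend D)) from DFunLike.congr_fun h z
  refine FreeAbelianGroup.lift_ext _ _ fun p => ?_
  simp only [AddMonoidHom.comp_apply, AddMonoidHom.eval_apply_apply, extend_of]
  exact (evalCochain_of G p _).trans (evalCochain_pull G p.2 (D p.1) c).symm

/-- Cochains are determined by their values on based chains. -/
lemma cochains_ext {k : ℕ} {c c' : Cochains (CoefficientSystem.pullback f G) k}
    (h : ∀ (x : FundamentalGroupoid X) (z : BasedChains f k x),
      evalCochain G z c = evalCochain G z c') : c = c' := by
  funext τ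
  have := h _ (FreeAbelianGroup.of (baseSimplex f τ))
  rwa [evalCochain_baseSimplex, evalCochain_baseSimplex] at this

/-- The retraction of `I^*` on cochains, given by the characteristic maps of `S X`. -/
def charPull (k : ℕ) :
    Cochains (CoefficientSystem.pullback (canonicalMap X) G) k →+ Cochains G k :=
  AddMonoidHom.pi fun σ => Pi.evalAddMonoidHom (fun τ : C(Simplex k, SingularComplex X) =>
    (coeffAt (CoefficientSystem.pullback (canonicalMap X) G) τ : Type v)) (charMap σ)

lemma charPull_cochainPull (k : ℕ) (c : Cochains G k) :
    charPull G k (cochainPull (canonicalMap X) G k c) = c :=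
  rfl

lemma evalCochain_cochainPull_charPull {k : ℕ} (z : BasedChains (canonicalMap X) k x)
    (c : Cochains (CoefficientSystem.pullback (canonicalMap X) G) k) :
    evalCochain G z (cochainPull (canonicalMap X) G k (charPull G k c)) =
      evalCochain G (cellular z) c := by
  suffices h : (AddMonoidHom.eval (cochainPull (canonicalMap X) G k (charPull G k c))).comp
      (evalCochain G) = (AddMonoidHom.eval c).comp ((evalCochain G).comp cellular) from
    DFunLike.congr_fun h z
  refine FreeAbelianGroup.lift_ext _ _ fun p => ?_
  simp only [AddMonoidHom.comp_apply, AddMonoidHom.eval_apply_apply, cellular_of]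
  exact (evalCochain_of G p _).trans (evalCochain_of G
    (⟨charMap ((canonicalMap X).comp p.1), p.2⟩ : BasedSimplex (canonicalMap X) k x) c).symm

lemma coboundary_charPull (k : ℕ)
    (c : Cochains (CoefficientSystem.pullback (canonicalMap X) G) k) :
    coboundary G k (charPull G k c) = charPull G (k + 1) (coboundary _ k c) := by
  funext σ
  refine (coboundary_apply G k _ σ).trans (Eq.trans ?_ (coboundary_apply _ k c (charMap σ)).symm)
  refine congrArg ((-1 : ℤ) ^ k • ·) (Finset.sum_congr rfl fun i _ =>
    congrArg ((-1 : ℤ) ^ (i : ℕ) • ·) ?_)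
  let p : BasedSimplex (canonicalMap X) k ⟨σ (e₀ (k + 1))⟩ :=
    ⟨simplexFace (charMap σ) i, edge σ (e₀ (k + 1)) (face i (e₀ k))⟩
  have hp : ofFace G σ i = G.map (inv p.2) :=
    (transport_eq_map_edge G σ _ _).trans (congrArg (fun γ => G.map γ) (inv_edge σ _ _).symm)
  have h := congrArg (fun z => evalCochain G z c)
    ((cellular_of_eq (p := p) (charMap_comp_face σ i)).symm.trans (cellular_of p))
  have e := (evalCochain_of G p c).symm.trans (h.trans (evalCochain_of G _ c))
  exact (ConcreteCategory.congr_hom hp (c (charMap (simplexFace σ i)))).trans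
    (e.symm.trans (ConcreteCategory.congr_hom hp (c (simplexFace (charMap σ) i))).symm)

end CochainAction

/-! ### The section on complexes -/

section Complexes

variable {X : Type u} [TopologicalSpace X] (G : CoefficientSystem.{u, v} X)

/-- An endomorphism of a complex that is the identity on the image, or modulo the kernel, of a map
homotopic to the identity induces the identity on homology. -/
lemma homologyMap_eq_id {c : ComplexShape ℕ} {K : HomologicalComplex AddCommGrpCat.{v} c}
    {e N : K ⟶ K} (hN : Homotopy N 0) (h : (𝟙 K + N) ≫ e = 𝟙 K + N ∨ e ≫ (𝟙 K + N) = 𝟙 K + N)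
    (n : ℕ) : HomologicalComplex.homologyMap e n = 𝟙 _ := by
  have h₁ : HomologicalComplex.homologyMap (𝟙 K + N) n = 𝟙 _ := by
    rw [HomologicalComplex.homologyMap_add, hN.homologyMap_eq,
      HomologicalComplex.homologyMap_zero, add_zero, HomologicalComplex.homologyMap_id]
  rcases h with h | h
  · have := congrArg (fun φ => HomologicalComplex.homologyMap φ n) h
    simpa only [HomologicalComplex.homologyMap_comp, h₁, Category.id_comp] using this
  · have := congrArg (fun φ => HomologicalComplex.homologyMap φ n) h
    simpa only [HomologicalComplex.homologyMap_comp, h₁, Category.comp_id] using this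

/-- The chain map `S_*(X; G) → S_*(SX; I^*G)` given by the characteristic maps. -/
def charChainMap :
    chainComplex G ⟶ chainComplex (CoefficientSystem.pullback (canonicalMap X) G) :=
  ChainComplex.ofHom (fun k => AddCommGrpCat.ofHom (charPush G k)) fun k => by
    rw [chainComplex_d, chainComplex_d]
    exact congrArg AddCommGrpCat.ofHom (AddMonoidHom.ext (boundary_charPush G k))

/-- The cochain map `S^*(SX; I^*G) → S^*(X; G)` given by the characteristic maps. -/
def charCochainMap :
    cochainComplex (CoefficientSystem.pullback (canonicalMap X) G) ⟶ cochainComplex G :=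
  CochainComplex.ofHom (fun k => AddCommGrpCat.ofHom (charPull G k)) fun k => by
    rw [cochainComplex_d, cochainComplex_d]
    exact congrArg AddCommGrpCat.ofHom (AddMonoidHom.ext (coboundary_charPull G k))

lemma charChainMap_chainMap : charChainMap G ≫ chainMap (canonicalMap X) G = 𝟙 _ := by
  ext k : 1
  exact congrArg AddCommGrpCat.ofHom (AddMonoidHom.ext (chainPush_charPush G k))

lemma cochainMap_charCochainMap : cochainMap (canonicalMap X) G ≫ charCochainMap G = 𝟙 _ := by
  ext k : 1
  exact congrArg AddCommGrpCat.ofHom (AddMonoidHom.ext (charPull_cochainPull G k))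

open BasedChains in
theorem isIso_homologyMap_canonicalMap (n : ℕ) :
    IsIso (homologyMap (canonicalMap X) G n) := by
  obtain ⟨D, hD₀, hD⟩ := exists_homotopy_to_cellular X
  set T := CoefficientSystem.pullback (canonicalMap X) G
  let s : ∀ i j, (ComplexShape.down ℕ).Rel j i → ((chainComplex T).X i ⟶ (chainComplex T).X j) :=
    fun i j hij => by
      obtain rfl : i + 1 = j := hij
      exact AddCommGrpCat.ofHom (opChain G (D i))
  have key : HomologicalComplex.homologyMap (chainMap (canonicalMap X) G ≫ charChainMap G) n =
      𝟙 _ := by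
    refine homologyMap_eq_id (Homotopy.nullHomotopy' s) (Or.inl ?_) n
    ext k : 1
    cases k with
    | zero =>
      let Φ : Chains T 0 →+ Chains T 0 :=
        AddMonoidHom.id _ + (boundary T 0).comp (opChain G (D 0))
      have h₁ : (𝟙 (chainComplex T) + Homotopy.nullHomotopicMap' s).f 0 =
          AddCommGrpCat.ofHom Φ := by
        rw [HomologicalComplex.add_f_apply, Homotopy.nullHomotopicMap'_f_of_not_rel_left
          (k₁ := 1) (k₀ := 0) rfl (fun l => by simp), chainComplex_d]
        rfl
      have h₂ (x) (z : BasedChains (canonicalMap X) 0 x) (g) :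
          Φ (evalChain G z g) = evalChain G (z + bd (extend (D 0) z)) g := by
        change evalChain G z g + boundary T 0 (opChain G (D 0) (evalChain G z g)) = _
        rw [opChain_evalChain, ← evalChain_bd, map_add, AddMonoidHom.add_apply]
      have h₃ : ((charPush G 0).comp (chainPush (canonicalMap X) G 0)).comp Φ = Φ :=
        chains_hom_ext G fun x z g => by
          rw [AddMonoidHom.comp_apply, h₂, AddMonoidHom.comp_apply, charPush_chainPush, hD₀]
      rw [HomologicalComplex.comp_f, h₁]
      exact congrArg AddCommGrpCat.ofHom h₃
    | succ k =>
      let Φ : Chains T (k + 1) →+ Chains T (k + 1) := AddMonoidHom.id _ +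
        ((opChain G (D k)).comp (boundary T k) + (boundary T (k + 1)).comp (opChain G (D (k + 1))))
      have h₁ : (𝟙 (chainComplex T) + Homotopy.nullHomotopicMap' s).f (k + 1) =
          AddCommGrpCat.ofHom Φ := by
        rw [HomologicalComplex.add_f_apply, Homotopy.nullHomotopicMap'_f
          (k₂ := k + 2) (k₁ := k + 1) (k₀ := k) rfl rfl, chainComplex_d, chainComplex_d]
        rfl
      have h₂ (x) (z : BasedChains (canonicalMap X) (k + 1) x) (g) : Φ (evalChain G z g) =
          evalChain G (z + bd (extend (D (k + 1)) z) + extend (D k) (bd z)) g := by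
        change evalChain G z g + (opChain G (D k) (boundary T k (evalChain G z g)) +
          boundary T (k + 1) (opChain G (D (k + 1)) (evalChain G z g))) = _
        rw [opChain_evalChain, ← evalChain_bd, ← evalChain_bd, opChain_evalChain, map_add, map_add,
          AddMonoidHom.add_apply, AddMonoidHom.add_apply, add_comm (evalChain G (extend (D k) _) g)]
        exact (add_assoc _ _ _).symm
      have h₃ : ((charPush G (k + 1)).comp (chainPush (canonicalMap X) G (k + 1))).comp Φ = Φ :=
        chains_hom_ext G fun x z g => by
          rw [AddMonoidHom.comp_apply, h₂, AddMonoidHom.comp_apply, charPush_chainPush, hD]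
      rw [HomologicalComplex.comp_f, h₁]
      exact congrArg AddCommGrpCat.ofHom h₃
  refine ⟨HomologicalComplex.homologyMap (charChainMap G) n, ?_, ?_⟩
  · rw [← key, HomologicalComplex.homologyMap_comp]
  · rw [← HomologicalComplex.homologyMap_comp, charChainMap_chainMap,
      HomologicalComplex.homologyMap_id]

open BasedChains in
theorem isIso_cohomologyMap_canonicalMap (n : ℕ) :
    IsIso (cohomologyMap (canonicalMap X) G n) := by
  obtain ⟨D, hD₀, hD⟩ := exists_homotopy_to_cellular X
  set T := CoefficientSystem.pullback (canonicalMap X) G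
  -- the sign compensates the one in the definition of the coboundary
  let s : ∀ i j, (ComplexShape.up ℕ).Rel j i →
      ((cochainComplex T).X i ⟶ (cochainComplex T).X j) :=
    fun i j hij => by
      obtain rfl : j + 1 = i := hij
      exact AddCommGrpCat.ofHom ((-1 : ℤ) ^ j • opCochain G (D j))
  have hδ (k : ℕ) (x : FundamentalGroupoid X) (z : BasedChains (canonicalMap X) k x)
      (c : Cochains T k) : evalCochain G z ((-1 : ℤ) ^ k • opCochain G (D k) (coboundary T k c)) =
        evalCochain G (bd (extend (D k) z)) c := by
    rw [map_zsmul, evalCochain_opCochain, evalCochain_bd]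
  have hδ' (k : ℕ) (x : FundamentalGroupoid X) (z : BasedChains (canonicalMap X) (k + 1) x)
      (c : Cochains T (k + 1)) :
      evalCochain G z (coboundary T k ((-1 : ℤ) ^ k • opCochain G (D k) c)) =
        evalCochain G (extend (D k) (bd z)) c := by
    rw [map_zsmul, map_zsmul, ← evalCochain_bd, evalCochain_opCochain]
  have key : HomologicalComplex.homologyMap (charCochainMap G ≫ cochainMap (canonicalMap X) G) n =
      𝟙 _ := by
    refine homologyMap_eq_id (Homotopy.nullHomotopy' s) (Or.inr ?_) n
    ext k : 1
    cases k with
    | zero =>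
      let Φ : Cochains T 0 →+ Cochains T 0 :=
        AddMonoidHom.id _ + ((-1 : ℤ) ^ 0 • opCochain G (D 0)).comp (coboundary T 0)
      have h₁ : (𝟙 (cochainComplex T) + Homotopy.nullHomotopicMap' s).f 0 =
          AddCommGrpCat.ofHom Φ := by
        rw [HomologicalComplex.add_f_apply, Homotopy.nullHomotopicMap'_f_of_not_rel_right
          (k₁ := 0) (k₀ := 1) rfl (fun l => by simp), cochainComplex_d]
        rfl
      have h₂ (x) (z : BasedChains (canonicalMap X) 0 x) (c) :
          evalCochain G z (Φ c) = evalCochain G (z + bd (extend (D 0) z)) c := by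
        refine (map_add (evalCochain G z) _ _).trans ?_
        rw [map_add, AddMonoidHom.add_apply, ← hδ]
        rfl
      have h₃ (c) : Φ (cochainPull (canonicalMap X) G 0 (charPull G 0 c)) = Φ c :=
        cochains_ext G fun x z => by
          rw [h₂, h₂, evalCochain_cochainPull_charPull, hD₀]
      rw [HomologicalComplex.comp_f, h₁]
      exact congrArg AddCommGrpCat.ofHom (AddMonoidHom.ext h₃)
    | succ k =>
      let Φ : Cochains T (k + 1) →+ Cochains T (k + 1) := AddMonoidHom.id _ +
        ((-1 : ℤ) ^ (k + 1) • opCochain G (D (k + 1))).comp (coboundary T (k + 1)) +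
        (coboundary T k).comp ((-1 : ℤ) ^ k • opCochain G (D k))
      have h₁ : (𝟙 (cochainComplex T) + Homotopy.nullHomotopicMap' s).f (k + 1) =
          AddCommGrpCat.ofHom Φ := by
        rw [HomologicalComplex.add_f_apply, Homotopy.nullHomotopicMap'_f
          (k₂ := k) (k₁ := k + 1) (k₀ := k + 2) rfl rfl, cochainComplex_d,
          cochainComplex_d, ← add_assoc]
        rfl
      have h₂ (x) (z : BasedChains (canonicalMap X) (k + 1) x) (c) : evalCochain G z (Φ c) =
          evalCochain G (z + bd (extend (D (k + 1)) z) + extend (D k) (bd z)) c := by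
        refine (map_add (evalCochain G z) _ _).trans
          ((congrArg (· + _) (map_add (evalCochain G z) _ _)).trans ?_)
        rw [map_add, map_add, AddMonoidHom.add_apply, AddMonoidHom.add_apply, ← hδ, ← hδ']
        rfl
      have h₃ (c) : Φ (cochainPull (canonicalMap X) G (k + 1) (charPull G (k + 1) c)) = Φ c :=
        cochains_ext G fun x z => by
          rw [h₂, h₂, evalCochain_cochainPull_charPull, hD]
      rw [HomologicalComplex.comp_f, h₁]
      exact congrArg AddCommGrpCat.ofHom (AddMonoidHom.ext h₃)
  refine ⟨HomologicalComplex.homologyMap (charCochainMap G) n, ?_, ?_⟩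
  · rw [← HomologicalComplex.homologyMap_comp, cochainMap_charCochainMap,
      HomologicalComplex.homologyMap_id]
  · rw [← key, HomologicalComplex.homologyMap_comp]

end Complexes

end LocalCoeff

end

theorem theorem4 (X : Type u) [TopologicalSpace X]
    (G : LocalCoeff.CoefficientSystem.{u, v} X) (n : ℕ) :
    IsIso (LocalCoeff.homologyMap (LocalCoeff.canonicalMap X) G n) ∧
      IsIso (LocalCoeff.cohomologyMap (LocalCoeff.canonicalMap X) G n) :=
  ⟨LocalCoeff.isIso_homologyMap_canonicalMap G n, LocalCoeff.isIso_cohomologyMap_canonicalMap G n⟩
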